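/- Let $\Omega\subset\mathbb R^N$ ($N\ge 1$) be open and bounded, $1<p<\infty$, $p'=p/(p-1)$, let $\alpha,\beta,\alpha_0>0$ and $h\in L^{p'}(\Omega)$. Let $a:\Omega\times\mathbb R\times\mathbb R^N\to\mathbb R^N$, $a_0:\Omega\times\mathbb R\to\mathbb R$ and $H:\Omega\times\mathbb R\times\mathbb R^N\to\mathbb R$ be Carathéodory functions (measurable in $x$, continuous in the remaining variables for a.e. $x$) such that, for a.e. $x\in\Omega$, all $s\in\mathbb R$ and all $\xi,\eta\in\mathbb R^N$ with $\xi\ne\eta$, $$a(x,s,\xi)\cdot\xi\ge\alpha|\xi|^p,\qquad |a(x,s,\xi)|\le\beta\big(h(x)+|s|^{p-1}+|\xi|^{p-1}\big),\qquad [a(x,s,\xi)-a(x,s,\eta)]\cdot(\xi-\eta)>0,$$ and, for a.e. $x\in\Omega$, all $s\in\mathbb R$ and all $\xi\in\mathbb R^N$, $$|a_0(x,s)|\le\beta\big(h(x)+|s|^{p-1}\big),\qquad a_0(x,s)\,s\ge\alpha_0|s|^p,\qquad |H(x,s,\xi)|\le f(x)+b(|s|)\,|\xi|^p,$$ where $f\in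 L^\infty(\Omega)$ is nonnegative and $b:[0,\infty)\to[0,\infty)$ is continuous and nondecreasing. Put $\langle A(u),w\rangle=\int_\Omega a(x,u,Du)\cdot Dw\,dx$ for $u,w\in W_0^{1,p}(\Omega)$. For $\psi\in W_0^{1,p}(\Omega)\cap L^\infty(\Omega)$ let $\mathcal C(\psi)=\{v\in W_0^{1,p}(\Omega): v\ge\psi\text{ a.e. in }\Omega\}$, and say that $u$ solves the variational inequality on $\mathcal C(\psi)$ if $u\in\mathcal C(\psi)\cap L^\infty(\Omega)$ and $$\langle A(u),v-u\rangle+\int_\Omega a_0(x,u)(v-u)\,dx+\int_\Omega H(x,u,Du)(v-u)\,dx\ge0\qquad\text{for all }v\in\mathcal C(\psi)\cap L^\infty(\Omega).$$ Let $\psi_n,\psi_0\in W_0^{1,p}(\Omega)\cap L^\infty(\Omega)$, let $\{\psi_n\}_n$ be bounded in $L^\infty(\Omega)$, and suppose that $\mathcal C(\psi_n)$ Mosco-converges to $\mathcal C(\psi_0)$ in $W_0^{1,p}(\Omega)$: (1) whenever $n_1<n_2<\cdots$, $v_i\in\mathcal C(\psi_{n_i})$ and $v_i\rightharpoonup v$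 weakly, one has $v\in\mathcal C(\psi_0)$; (2) for every $v\in\mathcal C(\psi_0)$ there are $v_n\in\mathcal C(\psi_n)$ with $\|v_n-v\|_{W_0^{1,p}(\Omega)}\to0$. For every $n$ let $u_n$ be a (that is, any) solution of the variational inequality on $\mathcal C(\psi_n)$. Then there exist a subsequence $\{u_{n_j}\}_j$ and $u_0\in\mathcal C(\psi_0)$ such that $u_{n_j}\to u_0$ strongly in $W_0^{1,p}(\Omega)$, and $u_0$ solves the variational inequality on $\mathcal C(\psi_0)$ (in particular $u_0\in L^\infty(\Omega)$). -/

import Mathlib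

open MeasureTheory Filter Topology
open scoped ENNReal ContDiff

noncomputable section

/-- The exponent `p ∈ (1, ∞)`, seen in `ℝ≥0∞`, is an admissible exponent for Banach `L^p` spaces. -/
instance instFactOneLeOfReal {p : ℝ} [h : Fact (1 < p)] : Fact ((1 : ℝ≥0∞) ≤ ENNReal.ofReal p) :=
  ⟨by simpa using h.out.le⟩

/-- Lebesgue measure on the set `Ω ⊆ ℝ^N`. -/
abbrev volOn {N : ℕ} (Ω : Set (EuclideanSpace ℝ (Fin N))) : Measure (EuclideanSpace ℝ (Fin N)) :=
  volume.restrict Ω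

/-- The ambient Banach space `L^p(Ω) × L^p(Ω)^N` of pairs (function, gradient field). Its norm
is the maximum of the two `L^p` norms, so on pairs `(u, Du)` it is equivalent to
the usual norm `(‖u‖_p^p + ‖Du‖_p^p)^{1/p}` of `W^{1,p}(Ω)`. -/
abbrev SobolevPair {N : ℕ} (Ω : Set (EuclideanSpace ℝ (Fin N))) (p : ℝ) : Type :=
  Lp ℝ (ENNReal.ofReal p) (volOn Ω) × Lp (EuclideanSpace ℝ (Fin N)) (ENNReal.ofReal p) (volOn Ω)

/-- `φ ∈ C_c^∞(Ω)`. -/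
structure IsTestFun {N : ℕ} (Ω : Set (EuclideanSpace ℝ (Fin N)))
    (φ : EuclideanSpace ℝ (Fin N) → ℝ) : Prop where
  smooth : ContDiff ℝ ∞ φ
  compact : HasCompactSupport φ
  supp : tsupport φ ⊆ Ω

theorem gradient_add_of_contDiff {N : ℕ} {φ χ : EuclideanSpace ℝ (Fin N) → ℝ}
    (hφ : ContDiff ℝ ∞ φ) (hχ : ContDiff ℝ ∞ χ) (x : EuclideanSpace ℝ (Fin N)) :
    gradient (φ + χ) x = gradient φ x + gradient χ x := by
  have h1 : DifferentiableAt ℝ φ x := (hφ.differentiable (by simp)).differentiableAt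
  have h2 : DifferentiableAt ℝ χ x := (hχ.differentiable (by simp)).differentiableAt
  simp [gradient, fderiv_add h1 h2]

theorem gradient_smul_of_contDiff {N : ℕ} {φ : EuclideanSpace ℝ (Fin N) → ℝ}
    (hφ : ContDiff ℝ ∞ φ) (c : ℝ) (x : EuclideanSpace ℝ (Fin N)) :
    gradient (c • φ) x = c • gradient φ x := by
  have h1 : DifferentiableAt ℝ φ x := (hφ.differentiable (by simp)).differentiableAt
  simp [gradient, fderiv_const_smul h1]

/-- The copy `{(φ, Dφ) : φ ∈ C_c^∞(Ω)}` of the test functions inside `L^p(Ω) × L^p(Ω)^N`. -/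
def testPairs {N : ℕ} (Ω : Set (EuclideanSpace ℝ (Fin N))) (p : ℝ) [Fact (1 < p)] :
    Submodule ℝ (SobolevPair Ω p) where
  carrier := {w | ∃ φ : EuclideanSpace ℝ (Fin N) → ℝ, IsTestFun Ω φ ∧
    w.1 =ᵐ[volOn Ω] φ ∧ w.2 =ᵐ[volOn Ω] gradient φ}
  zero_mem' := by
    refine ⟨0, ⟨contDiff_const, HasCompactSupport.zero, by simp [tsupport]⟩,
      Lp.coeFn_zero _ _ _, ?_⟩
    filter_upwards [Lp.coeFn_zero (EuclideanSpace ℝ (Fin N)) (ENNReal.ofReal p) (volOn Ω)]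
      with x hx
    simpa [gradient] using hx
  add_mem' := by
    rintro v w ⟨φ, hφ, hv1, hv2⟩ ⟨χ, hχ, hw1, hw2⟩
    refine ⟨φ + χ, ⟨hφ.smooth.add hχ.smooth, hφ.compact.add hχ.compact,
      (tsupport_add φ χ).trans (Set.union_subset hφ.supp hχ.supp)⟩, ?_, ?_⟩
    · exact (Lp.coeFn_add v.1 w.1).trans (hv1.add hw1)
    · filter_upwards [Lp.coeFn_add v.2 w.2, hv2, hw2] with x h h1 h2
      rw [gradient_add_of_contDiff hφ.smooth hχ.smooth, ← h1, ← h2]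
      exact h
  smul_mem' := by
    rintro c v ⟨φ, hφ, hv1, hv2⟩
    refine ⟨c • φ, ⟨contDiff_const.smul hφ.smooth, hφ.compact.smul_left,
      (closure_mono (Function.support_const_smul_subset c φ)).trans hφ.supp⟩, ?_, ?_⟩
    · exact (Lp.coeFn_smul c v.1).trans (hv1.const_smul c)
    · filter_upwards [Lp.coeFn_smul c v.2, hv2] with x h h1
      rw [gradient_smul_of_contDiff hφ.smooth, ← h1]
      exact h

/-- `W_0^{1,p}(Ω)`, the closure of `C_c^∞(Ω)` in `W^{1,p}(Ω)`. A function `u` is represented by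
the pair `(u, Du)`, so that `W^{1,p}(Ω)` sits isomorphically and as a closed subspace in
`L^p(Ω) × L^p(Ω)^N` and the closure may be taken there. -/
abbrev W01 {N : ℕ} (Ω : Set (EuclideanSpace ℝ (Fin N))) (p : ℝ) [Fact (1 < p)] : Type :=
  (testPairs Ω p).topologicalClosure

namespace W01

variable {N : ℕ} {Ω : Set (EuclideanSpace ℝ (Fin N))} {p : ℝ} [Fact (1 < p)]

/-- The function `u ∈ L^p(Ω)` underlying an element of `W_0^{1,p}(Ω)`. -/
def val (u : W01 Ω p) : EuclideanSpace ℝ (Fin N) → ℝ :=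
  (u : SobolevPair Ω p).1

/-- The weak gradient `Du ∈ L^p(Ω)^N` of an element of `W_0^{1,p}(Ω)`. -/
def grad (u : W01 Ω p) : EuclideanSpace ℝ (Fin N) → EuclideanSpace ℝ (Fin N) :=
  (u : SobolevPair Ω p).2

/-- The second component of an element of `W_0^{1,p}(Ω)` is the weak gradient of the first. -/
theorem isWeakGradient {N : ℕ} {Ω : Set (EuclideanSpace ℝ (Fin N))} {p : ℝ} [hp : Fact (1 < p)]
    (u : W01 Ω p) {φ : EuclideanSpace ℝ (Fin N) → ℝ} (hφ : IsTestFun Ω φ)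
    (e : EuclideanSpace ℝ (Fin N)) :
    ∫ x in Ω, val u x * fderiv ℝ φ x e = - ∫ x in Ω, inner ℝ e (grad u x) * φ x := by
  have hpq : Real.HolderConjugate p p.conjExponent := Real.HolderConjugate.conjExponent hp.out
  have : ENNReal.HolderConjugate (ENNReal.ofReal p) (ENNReal.ofReal p.conjExponent) :=
    hpq.ennrealOfReal
  have : Fact ((1 : ℝ≥0∞) ≤ ENNReal.ofReal p.conjExponent) := ⟨by simpa using hpq.symm.lt.le⟩
  have c1 : Continuous fun x => fderiv ℝ φ x e :=
    (hφ.smooth.continuous_fderiv (by simp)).clm_apply continuous_const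
  have s1 : HasCompactSupport fun x => fderiv ℝ φ x e := hφ.compact.fderiv_apply ℝ e
  have m1 : MemLp (fun x => fderiv ℝ φ x e) (ENNReal.ofReal p.conjExponent) (volOn Ω) :=
    c1.memLp_of_hasCompactSupport s1
  have m2 : MemLp φ (ENNReal.ofReal p.conjExponent) (volOn Ω) :=
    hφ.smooth.continuous.memLp_of_hasCompactSupport hφ.compact
  let B1 := (ContinuousLinearMap.mul ℝ ℝ).lpPairing (volOn Ω) (ENNReal.ofReal p)
    (ENNReal.ofReal p.conjExponent)
  let B2 := ((ContinuousLinearMap.mul ℝ ℝ).comp (innerSL ℝ e)).lpPairing (volOn Ω)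
    (ENNReal.ofReal p) (ENNReal.ofReal p.conjExponent)
  have key : ∀ w ∈ (testPairs Ω p).topologicalClosure,
      B1 w.1 m1.toLp = - B2 w.2 m2.toLp := by
    intro w hw
    have hcl : IsClosed {w : SobolevPair Ω p | B1 w.1 m1.toLp = - B2 w.2 m2.toLp} :=
      isClosed_eq ((B1.flip _).continuous.comp continuous_fst)
        (((B2.flip _).continuous.comp continuous_snd).neg)
    refine closure_minimal ?_ hcl hw
    rintro w ⟨χ, hχ, h1, h2⟩
    simp only [Set.mem_ofPred_eq, B1, B2, ContinuousLinearMap.lpPairing_eq_integral]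
    have a1 : ∫ x in Ω, (ContinuousLinearMap.mul ℝ ℝ (w.1 x)) (m1.toLp _ x)
        = ∫ x, χ x * fderiv ℝ φ x e := by
      rw [← setIntegral_eq_integral_of_forall_compl_eq_zero (s := Ω)
        (f := fun x => χ x * fderiv ℝ φ x e)]
      · refine integral_congr_ae ?_
        filter_upwards [h1, m1.coeFn_toLp] with x ha hb
        rw [ha, hb]; rfl
      · intro x hx
        rw [image_eq_zero_of_notMem_tsupport (fun h => hx (hχ.supp h)), zero_mul]
    have a2 : ∫ x in Ω, ((ContinuousLinearMap.mul ℝ ℝ).comp (innerSL ℝ e) (w.2 x)) (m2.toLp _ x)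
        = ∫ x, fderiv ℝ χ x e * φ x := by
      rw [← setIntegral_eq_integral_of_forall_compl_eq_zero (s := Ω)
        (f := fun x => fderiv ℝ χ x e * φ x)]
      · refine integral_congr_ae ?_
        filter_upwards [h2, m2.coeFn_toLp] with x ha hb
        rw [ha, hb]
        simp only [ContinuousLinearMap.comp_apply, ContinuousLinearMap.mul_apply', innerSL_apply_apply]
        rw [real_inner_comm, gradient, InnerProductSpace.toDual_symm_apply]
      · intro x hx
        rw [image_eq_zero_of_notMem_tsupport (fun h => hx (hφ.supp h)), mul_zero]
    rw [a1, a2]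
    have d1 : Differentiable ℝ χ := hχ.smooth.differentiable (by simp)
    have d2 : Differentiable ℝ φ := hφ.smooth.differentiable (by simp)
    have c2 : Continuous fun x => fderiv ℝ χ x e :=
      (hχ.smooth.continuous_fderiv (by simp)).clm_apply continuous_const
    refine integral_mul_fderiv_eq_neg_fderiv_mul_of_integrable ?_ ?_ ?_
      (fun x _ => d1 x) (fun x _ => d2 x)
    · exact (c2.mul d2.continuous).integrable_of_hasCompactSupport hφ.compact.mul_left
    · exact (d1.continuous.mul c1).integrable_of_hasCompactSupport s1.mul_left
    · exact (d1.continuous.mul d2.continuous).integrable_of_hasCompactSupport hφ.compact.mul_left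
  have := key _ u.2
  simp only [B1, B2, ContinuousLinearMap.lpPairing_eq_integral] at this
  convert this using 1
  · refine integral_congr_ae ?_
    filter_upwards [m1.coeFn_toLp] with x hb
    rw [hb]; rfl
  · congr 1
    refine integral_congr_ae ?_
    filter_upwards [m2.coeFn_toLp] with x hb
    rw [hb]; rfl

/-- The function determines its weak gradient. -/
theorem ext_val {N : ℕ} {Ω : Set (EuclideanSpace ℝ (Fin N))} (hΩ : IsOpen Ω) {p : ℝ}
    [hp : Fact (1 < p)] (u v : W01 Ω p) (h : val u =ᵐ[volOn Ω] val v) : u = v := by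
  have hd : val (u - v) =ᵐ[volOn Ω] 0 := by
    filter_upwards [Lp.coeFn_sub (u : SobolevPair Ω p).1 (v : SobolevPair Ω p).1, h] with x h1 h2
    exact h1.trans (sub_eq_zero.2 h2)
  have hg : ∀ i : Fin N, ∀ᵐ x, x ∈ Ω →
      inner ℝ (EuclideanSpace.single i (1 : ℝ)) (grad (u - v) x) = 0 := by
    intro i
    refine hΩ.ae_eq_zero_of_integral_contDiff_smul_eq_zero ?_ ?_
    · refine locallyIntegrableOn_of_locallyIntegrable_restrict ?_
      exact ((Lp.memLp (u - v : SobolevPair Ω p).2).const_inner _).locallyIntegrable Fact.out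
    · intro φ h1 h2 h3
      have e1 := isWeakGradient (u - v) ⟨h1, h2, h3⟩ (EuclideanSpace.single i (1 : ℝ))
      have e2 : ∫ x in Ω, val (u - v) x * fderiv ℝ φ x (EuclideanSpace.single i (1 : ℝ)) = 0 := by
        refine integral_eq_zero_of_ae ?_
        filter_upwards [hd] with x hx
        simp [hx]
      rw [e2, eq_comm, neg_eq_zero] at e1
      rw [← e1, ← setIntegral_eq_integral_of_forall_compl_eq_zero (s := Ω)]
      · simp [mul_comm]
      · intro x hx
        rw [image_eq_zero_of_notMem_tsupport (fun h => hx (h3 h)), zero_smul]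
  rw [← sub_eq_zero]
  refine Subtype.ext (Prod.ext ?_ ?_)
  · exact Lp.ext (hd.trans (Lp.coeFn_zero _ _ _).symm)
  · refine Lp.ext ?_
    have hg' : ∀ᵐ x ∂(volOn Ω), ∀ i : Fin N,
        inner ℝ (EuclideanSpace.single i (1 : ℝ)) (grad (u - v) x) = 0 := by
      rw [ae_all_iff]
      exact fun i => (ae_restrict_iff' hΩ.measurableSet).2 (hg i)
    filter_upwards [hg', Lp.coeFn_zero (EuclideanSpace ℝ (Fin N)) (ENNReal.ofReal p) (volOn Ω)]
      with x hx h0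
    refine Eq.trans ?_ h0.symm
    refine PiLp.ext fun i => ?_
    simpa [EuclideanSpace.inner_single_left, grad] using hx i

end W01

/-- Mosco-convergence of a sequence of (closed convex) subsets of a Banach space `X`. -/
structure MoscoConverges {X : Type*} [NormedAddCommGroup X] [NormedSpace ℝ X]
    (C : ℕ → Set X) (C₀ : Set X) : Prop where
  weak_limit : ∀ (n : ℕ → ℕ) (v : ℕ → X) (v₀ : X), StrictMono n → (∀ i, v i ∈ C (n i)) →
    Tendsto (fun i => toWeakSpace ℝ X (v i)) atTop (𝓝 (toWeakSpace ℝ X v₀)) → v₀ ∈ C₀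
  recovery : ∀ v₀ ∈ C₀, ∃ v : ℕ → X, (∀ n, v n ∈ C n) ∧
    Tendsto (fun n => ‖v n - v₀‖) atTop (𝓝 0)

/-- `g = g(x, y)` is a Carathéodory function on `Ω`: Lebesgue measurable in `x ∈ Ω` for every `y`,
and continuous in `y` for almost every `x ∈ Ω`. -/
structure IsCaratheodory {N : ℕ} (Ω : Set (EuclideanSpace ℝ (Fin N)))
    {Y Z : Type*} [TopologicalSpace Y] [TopologicalSpace Z] [MeasurableSpace Z]
    (g : EuclideanSpace ℝ (Fin N) → Y → Z) : Prop where
  measurable : ∀ y, AEMeasurable (fun x => g x y) (volOn Ω)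
  continuous : ∀ᵐ x ∂(volOn Ω), Continuous (g x)

section Problem

variable {N : ℕ} {Ω : Set (EuclideanSpace ℝ (Fin N))} {p : ℝ} [Fact (1 < p)]

/-- `C(ψ) = {v ∈ W_0^{1,p}(Ω) : v ≥ ψ a.e. in Ω}`. -/
def obstacleSet (ψ : W01 Ω p) : Set (W01 Ω p) :=
  {v | ∀ᵐ x ∂(volOn Ω), ψ.val x ≤ v.val x}

/-- `⟨A(u), w⟩ = ∫_Ω a(x, u, Du) · Dw` for `A(u) = -div a(x, u, Du)`. -/
def lerayLionsPairing
    (a : EuclideanSpace ℝ (Fin N) → ℝ → EuclideanSpace ℝ (Fin N) → EuclideanSpace ℝ (Fin N))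
    (u w : W01 Ω p) : ℝ :=
  ∫ x in Ω, inner ℝ (a x (u.val x) (u.grad x)) (w.grad x)

/-- `u ∈ C(ψ) ∩ L^∞(Ω)` and
`⟨A(u), v - u⟩ + ∫_Ω a₀(x, u) (v - u) + ∫_Ω H(x, u, Du) (v - u) ≥ 0` for every
`v ∈ C(ψ) ∩ L^∞(Ω)`. For Carathéodory data with
`|a(x, s, ξ)| ≤ β (h(x) + |s|^{p-1} + |ξ|^{p-1})`, `|a₀(x, s)| ≤ β (h(x) + |s|^{p-1})`,
`h ∈ L^{p'}(Ω)`, and `|H(x, s, ξ)| ≤ f(x) + b(|s|) |ξ|^p`, `f ∈ L^∞(Ω)`, on a bounded `Ω`, the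
three integrands are always integrable, because `u` and `v` are bounded. -/
structure IsVISolution
    (a : EuclideanSpace ℝ (Fin N) → ℝ → EuclideanSpace ℝ (Fin N) → EuclideanSpace ℝ (Fin N))
    (a₀ : EuclideanSpace ℝ (Fin N) → ℝ → ℝ)
    (H : EuclideanSpace ℝ (Fin N) → ℝ → EuclideanSpace ℝ (Fin N) → ℝ)
    (ψ u : W01 Ω p) : Prop where
  mem_obstacleSet : u ∈ obstacleSet ψ
  bounded : MemLp u.val ∞ (volOn Ω)
  inequality : ∀ v ∈ obstacleSet ψ, MemLp v.val ∞ (volOn Ω) →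
    0 ≤ lerayLionsPairing a u (v - u)
      + (∫ x in Ω, a₀ x (u.val x) * (v.val x - u.val x))
      + ∫ x in Ω, H x (u.val x) (u.grad x) * (v.val x - u.val x)

end Problem

end

/-! The difficulty is the term `H`, which grows like |Du|^p: it is only in L^1, so it cannot be
passed to the limit along weakly convergent gradients, and it competes with the coercivity of the
principal part. Both problems are met by exponential test functions. If φ' ≥ κφ on the relevant
range with κ = b(bound of u)/α, the part φ'·a·Du produced by the chain rule dominates the gradient
part of Hφ.

A sup bound uniform in n comes from testing with Φ(u), where Φ(t) = exp(λt) times a smooth function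
vanishing for t ≤ K (`VIData.val_le_of_isVISolution`). The qualitative bound of u enters only λ,
while K depends on the obstacle bound, ‖f‖_∞, α₀ and p. From below, u is controlled by its obstacle.

Two-sided comparison with an admissible bounded w uses φ(u - w), φ(s) = s exp(κ²s²), for which φ' -
κ|φ| ≥ 1/2. With w taken from a recovery sequence for ψ₀ this bounds the u_n in W_0^{1,p}
(`VIData.exists_norm_bound`). Weak compactness, derived from uniform convexity, and a Rellich-type
argument then give a weak and almost everywhere limit u₀, and the first Mosco condition puts u₀ in
C(ψ₀).

The second Mosco condition gives w_n → u₀ strongly with w_n ∈ C(ψ_n). A smooth monotone truncation,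
equal to the identity on the ranges of the obstacles and of u₀, makes the w_n uniformly bounded
without leaving C(ψ_n) (`MoscoConverges.exists_bounded_recovery`). Testing with φ(u_n - w_n) shows
that ∫ [a(x,u_n,Du_n) - a(x,u_n,Du₀)]·(Du_n - Du₀) tends to zero
(`VIData.tendsto_integral_monotone`).

The integrand of this gap is nonnegative. Along a subsequence it tends to zero almost everywhere
under an integrable majorant. Coercivity turns the majorant into an L^p majorant of the gradients,
and strict monotonicity gives their pointwise convergence, hence strong convergence
(`VIData.exists_subseq_tendsto_of_monotone`). Once convergence is strong, all three terms of the
inequality pass to the limit by dominated convergence, again with bounded recovery sequences as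
competitors (`VIData.isVISolution_of_tendsto`). -/

/-! ### Dominated subsequences and measurability of Carathéodory compositions -/

section MeasureTheoryPreliminaries

variable {α E : Type*} {m : MeasurableSpace α} {μ : Measure α} [NormedAddCommGroup E]

/-- A sequence that converges in `L^p` has a subsequence that converges almost everywhere and is
dominated by a function in `L^p`. -/
theorem exists_subseq_dominated_of_tendsto_Lp {q : ℝ≥0∞} [hq : Fact (1 ≤ q)]
    {f : ℕ → Lp E q μ} {g : Lp E q μ} (hfg : Tendsto f atTop (𝓝 g)) :
    ∃ (φ : ℕ → ℕ) (G : α → ℝ), StrictMono φ ∧ MemLp G q μ ∧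
      (∀ᵐ x ∂μ, ∀ n, ‖f (φ n) x‖ ≤ G x) ∧
      ∀ᵐ x ∂μ, Tendsto (fun n => f (φ n) x) atTop (𝓝 (g x)) := by
  -- As in the proof of Riesz-Fischer: distances below 2^{-n} make Σ |f_{φ n} - g| an element of
  -- L^q. Added to |g| it is the majorant, and its pointwise summability forces convergence.
  have h1 : ∀ n : ℕ, ∀ᶠ k in atTop, ‖f k - g‖ < (1 / 2 : ℝ) ^ n := by
    intro n
    have := tendsto_iff_norm_sub_tendsto_zero.1 hfg
    exact this.eventually_lt_const (by positivity)
  obtain ⟨φ, hφ, hle⟩ := extraction_forall_of_eventually h1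
  let d : ℕ → Lp ℝ q μ := fun n => (Lp.memLp (f (φ n) - g)).norm.toLp
  have hd : ∀ n, ‖d n‖ = ‖f (φ n) - g‖ := by
    intro n
    rw [Lp.norm_toLp, eLpNorm_norm, Lp.norm_def]
  have hsum : ∑' n, ‖d n‖ₑ ≠ (∞ : ℝ≥0∞) := by
    have hs : Summable fun n => ‖d n‖ := by
      refine Summable.of_nonneg_of_le (fun n => norm_nonneg _) (fun n => ?_)
        (summable_geometric_of_lt_one (by norm_num : (0 : ℝ) ≤ 1 / 2) (by norm_num))
      rw [hd]
      exact (hle n).le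
    exact tsum_enorm_ne_top_iff_summable_norm.2 hs
  have hS := Lp.hasSum_coeFn_tsum hsum
  have hdx : ∀ᵐ x ∂μ, ∀ n, d n x = ‖f (φ n) x - g x‖ := by
    rw [ae_all_iff]
    intro n
    filter_upwards [(Lp.memLp (f (φ n) - g)).norm.coeFn_toLp, Lp.coeFn_sub (f (φ n)) g] with x h2 h3
    rw [h2, h3, Pi.sub_apply]
  refine ⟨φ, fun x => ‖g x‖ + (∑' n, d n : Lp ℝ q μ) x, hφ,
    (Lp.memLp g).norm.add (Lp.memLp _), ?_, ?_⟩
  · filter_upwards [hS, hdx] with x h2 h3 n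
    have h4 : d n x ≤ (∑' n, d n : Lp ℝ q μ) x :=
      le_hasSum h2 n fun k _ => by rw [h3]; exact norm_nonneg _
    rw [h3] at h4
    calc ‖f (φ n) x‖ = ‖g x + (f (φ n) x - g x)‖ := by congr 1; abel
      _ ≤ _ := (norm_add_le _ _).trans (by gcongr)
  · filter_upwards [hS, hdx] with x h2 h3
    rw [tendsto_iff_norm_sub_tendsto_zero]
    simpa only [h3] using h2.summable.tendsto_atTop_zero

/-- Dominated convergence in `L^p`. -/
theorem tendsto_Lp_of_dominated {p : ℝ} [hp : Fact (1 < p)]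
    {f : ℕ → Lp E (ENNReal.ofReal p) μ} {g : Lp E (ENNReal.ofReal p) μ} {G : α → ℝ}
    (hG : MemLp G (ENNReal.ofReal p) μ) (hle : ∀ n, ∀ᵐ x ∂μ, ‖f n x‖ ≤ G x)
    (hlim : ∀ᵐ x ∂μ, Tendsto (fun n => f n x) atTop (𝓝 (g x))) :
    Tendsto f atTop (𝓝 g) := by
  have hp0 : 0 < p := zero_lt_one.trans hp.out
  have hpne : ENNReal.ofReal p ≠ 0 := by simpa using hp0
  rw [Lp.tendsto_Lp_iff_tendsto_eLpNorm']
  have hle' : ∀ᵐ x ∂μ, ∀ n, ‖f n x‖ ≤ G x := ae_all_iff.2 hle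
  have key : Tendsto (fun n => ∫⁻ x, ‖f n x - g x‖ₑ ^ p ∂μ) atTop (𝓝 (∫⁻ _, 0 ∂μ)) := by
    refine tendsto_lintegral_of_dominated_convergence' (fun x => ‖2 * G x‖ₑ ^ p)
      (fun n => ?_) (fun n => ?_) ?_ ?_
    · exact ((Lp.aestronglyMeasurable _).sub (Lp.aestronglyMeasurable _)).enorm.pow_const _
    · filter_upwards [hle', hlim] with x h1 h2
      have h3 : ‖g x‖ ≤ G x := le_of_tendsto h2.norm (Eventually.of_forall h1)
      gcongr
      rw [enorm_le_iff_norm_le]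
      calc ‖f n x - g x‖ ≤ G x + G x := (norm_sub_le _ _).trans (add_le_add (h1 n) h3)
        _ ≤ ‖2 * G x‖ := by rw [← two_mul]; exact Real.le_norm_self _
    · have := (hG.const_mul 2).eLpNorm_ne_top
      have h2 := lintegral_rpow_enorm_lt_top_of_eLpNorm_lt_top hpne ENNReal.ofReal_ne_top
        this.lt_top
      rw [ENNReal.toReal_ofReal hp0.le] at h2
      exact h2.ne
    · filter_upwards [hlim] with x h2
      have h3 : Tendsto (fun n => ‖f n x - g x‖ₑ) atTop (𝓝 0) := by
        have := (h2.sub_const (g x)).enorm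
        simpa using this
      have h4 := (ENNReal.continuous_rpow_const (y := p)).tendsto 0 |>.comp h3
      simpa [ENNReal.zero_rpow_of_pos hp0, Function.comp_def] using h4
  have h5 := (ENNReal.continuous_rpow_const (y := 1 / p)).tendsto _ |>.comp key
  rw [lintegral_zero, ENNReal.zero_rpow_of_pos (by positivity)] at h5
  refine h5.congr fun n => ?_
  rw [eLpNorm_eq_lintegral_rpow_enorm_toReal hpne ENNReal.ofReal_ne_top,
    ENNReal.toReal_ofReal hp0.le]
  simp only [Function.comp]
  congr 1

/-- The composition of a Carathéodory function with a measurable function is measurable. -/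
theorem aemeasurable_caratheodory_comp {Y Z : Type*} [TopologicalSpace Y]
    [TopologicalSpace.MetrizableSpace Y] [MeasurableSpace Y] [SecondCountableTopology Y]
    [OpensMeasurableSpace Y] [TopologicalSpace Z] [TopologicalSpace.PseudoMetrizableSpace Z]
    [MeasurableSpace Z] [BorelSpace Z] [Inhabited Z] {g : α → Y → Z}
    (hg : ∀ y, AEMeasurable (fun x => g x y) μ) (hc : ∀ᵐ x ∂μ, Continuous (g x))
    {v : α → Y} (hv : AEMeasurable v μ) : AEMeasurable (fun x => g x (v x)) μ := by
  classical
  rcases isEmpty_or_nonempty Y with hY | hY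
  · have : IsEmpty α := ⟨fun x => hY.elim (v x)⟩
    exact (measurable_of_empty _).aemeasurable
  let D := TopologicalSpace.denseSeq Y
  have hD : DenseRange D := TopologicalSpace.denseRange_denseSeq Y
  -- Each y has its own exceptional null set, so only countably many y can be treated at once. A
  -- dense sequence is enough because continuity in y recovers the rest.
  have h1 : ∀ᵐ x ∂μ, Continuous (g x) ∧ ∀ k, g x (D k) = (hg (D k)).mk _ x :=
    hc.and (ae_all_iff.2 fun k => (hg (D k)).ae_eq_mk)
  obtain ⟨t, ht, htm, htμ⟩ := exists_measurable_superset_of_null (ae_iff.1 h1)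
  have ht' : ∀ x ∉ t, Continuous (g x) ∧ ∀ k, g x (D k) = (hg (D k)).mk _ x := by
    intro x hx
    by_contra hcon
    exact hx (ht hcon)
  -- On the null set `t` any constant will do: it makes `g'` continuous in y for every x, hence
  -- jointly measurable.
  let g' : Y → α → Z := fun y x => if x ∈ t then default else g x y
  have hg'c : ∀ x, Continuous fun y => g' y x := by
    intro x
    by_cases hx : x ∈ t
    · simpa [g', hx] using continuous_const
    · simpa [g', hx] using (ht' x hx).1
  have hg'D : ∀ k, Measurable (g' (D k)) := by
    intro k
    have : g' (D k) = fun x => if x ∈ t then default else (hg (D k)).mk _ x := by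
      funext x
      by_cases hx : x ∈ t
      · simp [g', hx]
      · simp only [g', hx, if_false]
        exact (ht' x hx).2 k
    rw [this]
    exact Measurable.ite htm measurable_const (hg (D k)).measurable_mk
  have hg'm : ∀ y, Measurable (g' y) := by
    intro y
    obtain ⟨s, hs, hlim⟩ := mem_closure_iff_seq_limit.1 (hD y)
    refine measurable_of_tendsto_metrizable (f := fun k => g' (s k)) (fun k => ?_) ?_
    · obtain ⟨i, hi⟩ := hs k
      rw [← hi]
      exact hg'D i
    · rw [tendsto_pi_nhds]
      exact fun x => ((hg'c x).tendsto y).comp hlim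
  have hm := measurable_uncurry_of_continuous_of_measurable (u := g') hg'c hg'm
  have h2 : AEMeasurable (fun x => Function.uncurry g' (v x, x)) μ :=
    hm.comp_aemeasurable (hv.prodMk aemeasurable_id)
  refine h2.congr ?_
  filter_upwards [compl_mem_ae_iff.2 htμ] with x hx
  have hx' : x ∉ t := hx
  simp [Function.uncurry, g', hx']

end MeasureTheoryPreliminaries

/-! ### Pointwise uniform convexity of the p-th power of the norm -/

section UniformConvexity

variable {E : Type*} [NormedAddCommGroup E] [NormedSpace ℝ E]

theorem norm_midpoint_rpow_le {p : ℝ} (hp : 1 < p) (x y : E) :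
    ‖(1 / 2 : ℝ) • (x + y)‖ ^ p ≤ (‖x‖ ^ p + ‖y‖ ^ p) / 2 := by
  have h1 : ‖(1 / 2 : ℝ) • (x + y)‖ ≤ (1 / 2) * ‖x‖ + (1 / 2) * ‖y‖ := by
    rw [norm_smul, Real.norm_of_nonneg (by norm_num)]
    linarith [norm_add_le x y]
  have h2 := (convexOn_rpow hp.le).2 (norm_nonneg x) (norm_nonneg y)
    (by norm_num : (0 : ℝ) ≤ 1 / 2) (by norm_num : (0 : ℝ) ≤ 1 / 2) (by norm_num)
  simp only [smul_eq_mul] at h2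
  calc _ ≤ ((1 / 2) * ‖x‖ + (1 / 2) * ‖y‖) ^ p := by gcongr
    _ ≤ _ := by linarith

/-- Strictness has two sources: strict convexity of the space when the norms agree, strict convexity
of t ↦ t^p when they differ. -/
theorem norm_midpoint_rpow_lt [StrictConvexSpace ℝ E] {p : ℝ} (hp : 1 < p) {x y : E}
    (hxy : x ≠ y) : ‖(1 / 2 : ℝ) • (x + y)‖ ^ p < (‖x‖ ^ p + ‖y‖ ^ p) / 2 := by
  by_cases hn : ‖x‖ = ‖y‖
  · have h1 : ‖(1 / 2 : ℝ) • (x + y)‖ < ‖x‖ := by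
      have := norm_combo_lt_of_ne (x := x) (y := y) le_rfl hn.ge hxy
        (by norm_num : (0 : ℝ) < 1 / 2) (by norm_num : (0 : ℝ) < 1 / 2) (by norm_num)
      rwa [← smul_add] at this
    rw [← hn, add_self_div_two]
    exact Real.rpow_lt_rpow (norm_nonneg _) h1 (by linarith)
  · have h1 : ‖(1 / 2 : ℝ) • (x + y)‖ ≤ (1 / 2) * ‖x‖ + (1 / 2) * ‖y‖ := by
      rw [norm_smul, Real.norm_of_nonneg (by norm_num)]
      linarith [norm_add_le x y]
    have h2 := (strictConvexOn_rpow hp).2 (norm_nonneg x) (norm_nonneg y) hn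
      (by norm_num : (0 : ℝ) < 1 / 2) (by norm_num : (0 : ℝ) < 1 / 2) (by norm_num)
    simp only [smul_eq_mul] at h2
    calc _ ≤ ((1 / 2) * ‖x‖ + (1 / 2) * ‖y‖) ^ p := by gcongr
      _ < _ := by linarith

/-- A pointwise form of the uniform convexity of `L^p` spaces of finite-dimensional vectors. -/
theorem exists_norm_sub_rpow_le [StrictConvexSpace ℝ E] [FiniteDimensional ℝ E] {p : ℝ}
    (hp : 1 < p) {ε : ℝ} (hε : 0 < ε) :
    ∃ K : ℝ, 0 ≤ K ∧ ∀ x y : E, ‖x - y‖ ^ p ≤ ε * (‖x‖ ^ p + ‖y‖ ^ p) +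
      K * ((‖x‖ ^ p + ‖y‖ ^ p) / 2 - ‖(1 / 2 : ℝ) • (x + y)‖ ^ p) := by
  have hp0 : 0 < p := by linarith
  have : ProperSpace E := FiniteDimensional.proper ℝ E
  -- All terms are homogeneous of degree p, so pairs can be normalised to |x|^p + |y|^p = 1. Those
  -- with |x - y|^p ≥ ε form a compact set, on which the convexity defect `g` has a positive
  -- minimum; the other pairs are covered by the ε term.
  let S : Set (E × E) := {z | ‖z.1‖ ^ p + ‖z.2‖ ^ p = 1 ∧ ε ≤ ‖z.1 - z.2‖ ^ p}
  have cn : ∀ {f : E × E → E}, Continuous f → Continuous fun z => ‖f z‖ ^ p := fun hf =>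
    hf.norm.rpow_const fun _ => Or.inr hp0.le
  have hSc : IsClosed S :=
    (isClosed_eq ((cn continuous_fst).add (cn continuous_snd)) continuous_const).inter
      (isClosed_le continuous_const (cn (continuous_fst.sub continuous_snd)))
  have hle1 : ∀ t s : ℝ, 0 ≤ t → 0 ≤ s → t ^ p + s ^ p = 1 → t ≤ 1 := by
    intro t s ht hs h
    have : 0 ≤ s ^ p := Real.rpow_nonneg hs p
    by_contra hcon
    have := Real.one_lt_rpow (not_le.1 hcon) hp0
    linarith
  have hSb : Bornology.IsBounded S := by
    refine (Metric.isBounded_closedBall (x := (0 : E × E)) (r := 1)).subset ?_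
    rintro ⟨x, y⟩ ⟨h, -⟩
    rw [mem_closedBall_zero_iff, Prod.norm_def]
    exact max_le (hle1 _ _ (norm_nonneg _) (norm_nonneg _) h)
      (hle1 _ _ (norm_nonneg _) (norm_nonneg _) (by rw [add_comm]; exact h))
  have hSk : IsCompact S := Metric.isCompact_of_isClosed_isBounded hSc hSb
  let g : E × E → ℝ := fun z =>
    (‖z.1‖ ^ p + ‖z.2‖ ^ p) / 2 - ‖(1 / 2 : ℝ) • (z.1 + z.2)‖ ^ p
  have hg : Continuous g := (((cn continuous_fst).add (cn continuous_snd)).div_const 2).sub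
    (cn ((continuous_fst.add continuous_snd).const_smul _))
  have hg0 : ∀ x y, 0 ≤ g (x, y) := fun x y => sub_nonneg.2 (norm_midpoint_rpow_le hp x y)
  obtain ⟨K, hK0, hK⟩ : ∃ K : ℝ, 0 ≤ K ∧ ∀ z ∈ S, ‖z.1 - z.2‖ ^ p ≤ K * g z := by
    rcases S.eq_empty_or_nonempty with h | h
    · exact ⟨0, le_rfl, by simp [h]⟩
    · obtain ⟨z₀, hz₀, hmin⟩ := hSk.exists_isMinOn h hg.continuousOn
      have hpos : 0 < g z₀ := by
        refine sub_pos.2 (norm_midpoint_rpow_lt hp ?_)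
        intro heq
        have := hz₀.2
        rw [heq, sub_self, norm_zero, Real.zero_rpow hp0.ne'] at this
        linarith
      -- On `S` both norms are at most 1, so |x - y|^p ≤ 2^p, while the defect is at least `g z₀`.
      refine ⟨2 ^ p / g z₀, by positivity, fun z hz => ?_⟩
      have h2 : ‖z.1 - z.2‖ ≤ 2 := by
        have a1 := hle1 _ _ (norm_nonneg _) (norm_nonneg _) hz.1
        have a2 := hle1 _ _ (norm_nonneg z.2) (norm_nonneg z.1) (by rw [add_comm]; exact hz.1)
        linarith [norm_sub_le z.1 z.2]
      have h3 : g z₀ ≤ g z := hmin hz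
      calc ‖z.1 - z.2‖ ^ p ≤ 2 ^ p := by gcongr
        _ = 2 ^ p / g z₀ * g z₀ := by field_simp
        _ ≤ _ := by gcongr
  refine ⟨K, hK0, fun x y => ?_⟩
  set s := ‖x‖ ^ p + ‖y‖ ^ p with hs
  have hxp : 0 ≤ ‖x‖ ^ p := by positivity
  have hyp : 0 ≤ ‖y‖ ^ p := by positivity
  have hs0 : 0 ≤ s := by positivity
  rcases hs0.eq_or_lt with h0 | hpos
  · have hx : ‖x‖ = 0 := (Real.rpow_eq_zero (norm_nonneg _) hp0.ne').1 (by linarith)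
    have hy : ‖y‖ = 0 := (Real.rpow_eq_zero (norm_nonneg _) hp0.ne').1 (by linarith)
    rw [norm_eq_zero] at hx hy
    rw [← h0, hx, hy]
    simp [Real.zero_rpow hp0.ne']
  · by_cases hcase : ‖x - y‖ ^ p ≤ ε * s
    · have := mul_nonneg hK0 (hg0 x y)
      simp only [g] at this
      linarith
    -- Scaling by s^{-1/p} is the normalisation that moves the pair into `S`.
    · let c : ℝ := s ^ (-(1 / p))
      have hc : 0 < c := Real.rpow_pos_of_pos hpos _
      have hcp : c ^ p = s⁻¹ := by
        rw [← Real.rpow_mul hs0, ← Real.rpow_neg_one]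
        congr 1
        field_simp
      have hsc : ∀ v : E, ‖c • v‖ ^ p = s⁻¹ * ‖v‖ ^ p := by
        intro v
        rw [norm_smul, Real.norm_of_nonneg hc.le, Real.mul_rpow hc.le (norm_nonneg _), hcp]
      have hmem : (c • x, c • y) ∈ S := by
        refine ⟨?_, ?_⟩
        · change ‖c • x‖ ^ p + ‖c • y‖ ^ p = 1
          rw [hsc, hsc, ← mul_add, ← hs, inv_mul_cancel₀ hpos.ne']
        · change ε ≤ ‖c • x - c • y‖ ^ p
          rw [← smul_sub, hsc, inv_mul_eq_div, le_div_iff₀ hpos]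
          exact (not_le.1 hcase).le
      have h5 := hK _ hmem
      simp only [g] at h5
      rw [← smul_sub, ← smul_add, smul_comm, hsc, hsc, hsc, hsc, ← mul_add, ← hs] at h5
      have h6 : ‖x - y‖ ^ p ≤ K * (s / 2 - ‖(1 / 2 : ℝ) • (x + y)‖ ^ p) := by
        have := mul_le_mul_of_nonneg_left h5 hpos.le
        calc _ = s * (s⁻¹ * ‖x - y‖ ^ p) := by field_simp
          _ ≤ _ := this
          _ = _ := by field_simp
      have : 0 ≤ ε * s := by positivity
      linarith

end UniformConvexity

/-! ### Weak sequential compactness from uniform convexity -/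

section WeakCompactness

variable {X : Type*} [NormedAddCommGroup X] [NormedSpace ℝ X]

theorem tendsto_toWeakSpace_iff {ι : Type*} {l : Filter ι} {u : ι → X} {v : X} :
    Tendsto (fun i => toWeakSpace ℝ X (u i)) l (𝓝 (toWeakSpace ℝ X v)) ↔
      ∀ ℓ : StrongDual ℝ X, Tendsto (fun i => ℓ (u i)) l (𝓝 (ℓ v)) := by
  refine ⟨fun h ℓ => ?_, fun h => ?_⟩
  · exact ((WeakBilin.eval_continuous (topDualPairing ℝ X).flip ℓ).tendsto _).comp h
  · refine (WeakBilin.tendsto_iff_forall_eval_tendsto (topDualPairing ℝ X).flip ?_).2 h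
    intro x y hxy
    refine (SeparatingDual.eq_iff_forall_dual_eq (R := ℝ)).2 fun ℓ => ?_
    exact LinearMap.congr_fun hxy ℓ

/-- A separable normed space has a countable separating family of functionals. -/
theorem exists_seq_dual_separating [TopologicalSpace.SeparableSpace X] :
    ∃ ℓ : ℕ → StrongDual ℝ X, ∀ x, (∀ k, ℓ k x = 0) → x = 0 := by
  have hd : DenseRange (TopologicalSpace.denseSeq X) := TopologicalSpace.denseRange_denseSeq X
  -- The functionals norm the points of a dense sequence. If all vanish at x ≠ 0, a dense point y
  -- within ‖x‖/2 of x satisfies ‖y‖ = ℓ(y - x) ≤ ‖y - x‖ < ‖x‖/2, which is incompatible with the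
  -- triangle inequality.
  choose ℓ h1 h2 using fun k => exists_dual_vector'' ℝ (TopologicalSpace.denseSeq X k)
  refine ⟨ℓ, fun x hx => ?_⟩
  by_contra hne
  have hpos : 0 < ‖x‖ := norm_pos_iff.2 hne
  obtain ⟨k, hk⟩ := hd.exists_dist_lt x (half_pos hpos)
  set y := TopologicalSpace.denseSeq X k
  have h3 : ‖y‖ ≤ ‖y - x‖ := by
    have e : ℓ k (y - x) = ‖y‖ := by rw [map_sub, hx k, sub_zero]; exact h2 k
    calc ‖y‖ = ℓ k (y - x) := e.symm
      _ ≤ ‖ℓ k (y - x)‖ := Real.le_norm_self _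
      _ ≤ ‖ℓ k‖ * ‖y - x‖ := (ℓ k).le_opNorm _
      _ ≤ 1 * ‖y - x‖ := by gcongr; exact h1 k
      _ = _ := one_mul _
  rw [dist_eq_norm, norm_sub_rev] at hk
  have h4 : ‖x‖ ≤ ‖y‖ + ‖y - x‖ := by
    have := norm_sub_le y (y - x)
    rwa [sub_sub_cancel] at this
  linarith

/-- In a complete space with a uniformly convex functional, decreasing sequences of nonempty
closed convex bounded sets have nonempty intersection. -/
theorem iInter_convex_nonempty [CompleteSpace X] {J : X → ℝ} (hJ0 : ∀ x, 0 ≤ J x)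
    (hJb : ∀ R, ∃ B, ∀ x, ‖x‖ ≤ R → J x ≤ B)
    (hJ : ∀ R ε, 0 < ε → ∃ δ > 0, ∀ x y, ‖x‖ ≤ R → ‖y‖ ≤ R →
      (J x + J y) / 2 - J ((1 / 2 : ℝ) • (x + y)) ≤ δ → ‖x - y‖ ≤ ε)
    {C : ℕ → Set X} (hC : Antitone C) (hne : ∀ n, (C n).Nonempty) (hcl : ∀ n, IsClosed (C n))
    (hcv : ∀ n, Convex ℝ (C n)) {R : ℝ} (hR : ∀ x ∈ C 0, ‖x‖ ≤ R) : (⋂ n, C n).Nonempty := by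
  obtain ⟨B, hB⟩ := hJb R
  have hCR : ∀ n, ∀ x ∈ C n, ‖x‖ ≤ R := fun n x hx => hR x (hC (Nat.zero_le n) hx)
  -- The infima of `J` on the sets increase to a finite limit. Almost-minimisers `x k`, `x n` with k
  -- ≥ n have their midpoint in `C n`, so their convexity defect is small and the sequence is
  -- Cauchy.
  let M : ℕ → ℝ := fun n => sInf (J '' C n)
  have hbdd : ∀ n, BddBelow (J '' C n) := fun n => ⟨0, by rintro _ ⟨x, -, rfl⟩; exact hJ0 x⟩
  have hMle : ∀ n, ∀ x ∈ C n, M n ≤ J x := fun n x hx => csInf_le (hbdd n) ⟨x, hx, rfl⟩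
  have hMmono : Monotone M := fun i j hij =>
    csInf_le_csInf (hbdd i) ((hne j).image J) (Set.image_mono (hC hij))
  have hMbdd : BddAbove (Set.range M) := by
    refine ⟨B, ?_⟩
    rintro _ ⟨n, rfl⟩
    obtain ⟨x, hx⟩ := hne n
    exact (hMle n x hx).trans (hB x (hCR n x hx))
  have hMlim := tendsto_atTop_ciSup hMmono hMbdd
  set L := ⨆ n, M n
  have hML : ∀ n, M n ≤ L := fun n => le_ciSup hMbdd n
  have hex : ∀ n : ℕ, ∃ x ∈ C n, J x < M n + 1 / ((n : ℝ) + 1) := by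
    intro n
    obtain ⟨_, ⟨x, hx, rfl⟩, h⟩ := exists_lt_of_csInf_lt ((hne n).image J)
      (lt_add_of_pos_right (M n) (by positivity : (0 : ℝ) < 1 / ((n : ℝ) + 1)))
    exact ⟨x, hx, h⟩
  choose x hx hxJ using hex
  have hcau : CauchySeq x := by
    rw [Metric.cauchySeq_iff']
    intro ε hε
    obtain ⟨δ, hδ, hδε⟩ := hJ R (ε / 2) (half_pos hε)
    have h1 : ∀ᶠ n : ℕ in atTop, L - δ / 2 < M n :=
      hMlim.eventually_const_lt (by linarith)
    have h2 : ∀ᶠ n : ℕ in atTop, 1 / ((n : ℝ) + 1) < δ / 2 :=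
      tendsto_one_div_add_atTop_nhds_zero_nat.eventually_lt_const (half_pos hδ)
    obtain ⟨n, h1n, h2n⟩ := (h1.and h2).exists
    refine ⟨n, fun k hk => ?_⟩
    have hxk : x k ∈ C n := hC hk (hx k)
    rw [dist_eq_norm]
    refine lt_of_le_of_lt (hδε _ _ (hCR _ _ (hx k)) (hCR _ _ (hx n)) ?_) (half_lt_self hε)
    have hmid : M n ≤ J ((1 / 2 : ℝ) • (x k + x n)) := by
      refine hMle n _ ?_
      rw [smul_add]
      exact hcv n hxk (hx n) (by norm_num) (by norm_num) (by norm_num)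
    have h3 : 1 / ((k : ℝ) + 1) ≤ 1 / ((n : ℝ) + 1) := by gcongr
    linarith [hxJ k, hxJ n, hML k, hML n]
  obtain ⟨y, hy⟩ := cauchySeq_tendsto_of_complete hcau
  refine ⟨y, Set.mem_iInter.2 fun n => (hcl n).mem_of_tendsto hy ?_⟩
  filter_upwards [eventually_ge_atTop n] with k hk using hC hk (hx k)

/-- In a separable Banach space with a uniformly convex functional, bounded sequences have weakly
convergent subsequences. -/
theorem exists_subseq_tendsto_weak [CompleteSpace X] [TopologicalSpace.SeparableSpace X]
    {J : X → ℝ} (hJ0 : ∀ x, 0 ≤ J x) (hJb : ∀ R, ∃ B, ∀ x, ‖x‖ ≤ R → J x ≤ B)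
    (hJ : ∀ R ε, 0 < ε → ∃ δ > 0, ∀ x y, ‖x‖ ≤ R → ‖y‖ ≤ R →
      (J x + J y) / 2 - J ((1 / 2 : ℝ) • (x + y)) ≤ δ → ‖x - y‖ ≤ ε)
    {u : ℕ → X} {R : ℝ} (hu : ∀ n, ‖u n‖ ≤ R) :
    ∃ (φ : ℕ → ℕ) (v : X), StrictMono φ ∧
      ∀ ℓ : StrongDual ℝ X, Tendsto (fun n => ℓ (u (φ n))) atTop (𝓝 (ℓ v)) := by
  obtain ⟨ℓ, hℓ⟩ := exists_seq_dual_separating (X := X)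
  have hbd : ∀ (f : StrongDual ℝ X) n, f (u n) ∈ Metric.closedBall (0 : ℝ) (‖f‖ * R) := by
    intro f n
    rw [mem_closedBall_zero_iff]
    exact (f.le_opNorm _).trans (mul_le_mul_of_nonneg_left (hu n) (norm_nonneg _))
  have hcpt : IsCompact (Set.univ.pi fun k => Metric.closedBall (0 : ℝ) (‖ℓ k‖ * R)) :=
    isCompact_univ_pi fun k => isCompact_closedBall _ _
  obtain ⟨c, -, φ, hφ, hlim⟩ := hcpt.tendsto_subseq (x := fun n k => ℓ k (u n))
    fun n k _ => hbd (ℓ k) n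
  rw [tendsto_pi_nhds] at hlim
  -- A common point of the closed convex hulls of the tails takes, under every functional that
  -- converges along the sequence, the limit value. The values c_k on the separating family do not
  -- depend on the further subsequence, so all such points coincide and give the weak limit.
  have key : ∀ χ : ℕ → ℕ, StrictMono χ → ∃ v : X, (∀ k, ℓ k v = c k) ∧
      ∀ (f : StrongDual ℝ X) (t : ℝ), Tendsto (fun n => f (u (φ (χ n)))) atTop (𝓝 t) →
        f v = t := by
    intro χ hχ
    let C : ℕ → Set X := fun n => closure (convexHull ℝ {x | ∃ k ≥ n, x = u (φ (χ k))})
    have hsub : ∀ (n : ℕ) (D : Set X), IsClosed D → Convex ℝ D →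
        (∀ k ≥ n, u (φ (χ k)) ∈ D) → C n ⊆ D := by
      intro n D hD hD' h
      refine closure_minimal (convexHull_min ?_ hD') hD
      rintro _ ⟨k, hk, rfl⟩
      exact h k hk
    obtain ⟨v, hv⟩ := iInter_convex_nonempty hJ0 hJb hJ (C := C)
      (fun i j hij => closure_mono (convexHull_mono fun x ⟨k, hk, h⟩ => ⟨k, hij.trans hk, h⟩))
      (fun n => ⟨u (φ (χ n)), subset_closure (subset_convexHull ℝ _ ⟨n, le_rfl, rfl⟩)⟩)
      (fun n => isClosed_closure) (fun n => (convex_convexHull ℝ _).closure) (R := R)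
      (fun x hx => by
        have := hsub 0 (Metric.closedBall 0 R) Metric.isClosed_closedBall
          (convex_closedBall _ _) (fun k _ => by simpa using hu _) hx
        simpa using this)
    have hval : ∀ (f : StrongDual ℝ X) (t : ℝ),
        Tendsto (fun n => f (u (φ (χ n)))) atTop (𝓝 t) → f v = t := by
      intro f t ht
      refine eq_of_forall_dist_le fun ε hε => ?_
      obtain ⟨n, hn⟩ := (Metric.tendsto_atTop.1 ht) ε hε
      have := hsub n (f ⁻¹' Metric.closedBall t ε)
        (Metric.isClosed_closedBall.preimage f.continuous)
        ((convex_closedBall _ _).is_linear_preimage f.toLinearMap.isLinear)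
        (fun k hk => (hn k hk).le) (Set.mem_iInter.1 hv n)
      exact this
    refine ⟨v, fun k => hval (ℓ k) (c k) ?_, hval⟩
    exact (hlim k).comp hχ.tendsto_atTop
  obtain ⟨v, hv, -⟩ := key id strictMono_id
  refine ⟨φ, v, hφ, fun f => ?_⟩
  refine tendsto_of_subseq_tendsto fun ns hns => ?_
  obtain ⟨χ₁, -, hχ₁⟩ := strictMono_subseq_of_tendsto_atTop hns
  obtain ⟨t, -, χ₂, hχ₂, ht⟩ := (isCompact_closedBall (0 : ℝ) (‖f‖ * R)).tendsto_subseq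
    (x := fun n => f (u (φ (ns (χ₁ n))))) fun n => hbd f _
  obtain ⟨w, hw, hwf⟩ := key (fun n => ns (χ₁ (χ₂ n))) (hχ₁.comp hχ₂)
  have hwv : w = v := sub_eq_zero.1 (hℓ _ fun k => by rw [map_sub, hw, hv, sub_self])
  refine ⟨fun n => χ₁ (χ₂ n), ?_⟩
  rw [← hwv, hwf f t ht]
  exact ht

end WeakCompactness

/-! ### Uniform convexity of Lebesgue spaces -/

section LpConvexity

variable {α E : Type*} {m : MeasurableSpace α} {μ : Measure α} [NormedAddCommGroup E]
  {p : ℝ} [hp : Fact (1 < p)]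

theorem MeasureTheory.MemLp.integrable_norm_rpow_ofReal {f : α → E}
    (hf : MemLp f (ENNReal.ofReal p) μ) : Integrable (fun x => ‖f x‖ ^ p) μ := by
  have hp0 : 0 < p := zero_lt_one.trans hp.out
  have := hf.integrable_norm_rpow (by simpa using hp0) ENNReal.ofReal_ne_top
  rwa [ENNReal.toReal_ofReal hp0.le] at this

theorem Lp_norm_rpow_eq_integral (f : Lp E (ENNReal.ofReal p) μ) :
    ‖f‖ ^ p = ∫ x, ‖f x‖ ^ p ∂μ := by
  have hp0 : 0 < p := zero_lt_one.trans hp.out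
  rw [Lp.norm_def, (Lp.memLp f).eLpNorm_eq_integral_rpow_norm (by simpa using hp0)
    ENNReal.ofReal_ne_top, ENNReal.toReal_ofReal hp0.le, ENNReal.toReal_ofReal (by positivity),
    ← Real.rpow_mul (by positivity), inv_mul_cancel₀ hp0.ne', Real.rpow_one]

variable [NormedSpace ℝ E]

theorem Lp_midpoint_rpow_le (f g : Lp E (ENNReal.ofReal p) μ) :
    ‖(1 / 2 : ℝ) • (f + g)‖ ^ p ≤ (‖f‖ ^ p + ‖g‖ ^ p) / 2 :=
  norm_midpoint_rpow_le hp.out f g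

variable [StrictConvexSpace ℝ E] [FiniteDimensional ℝ E]

variable (E μ p) in
/-- Uniform convexity of `L^p`. -/
theorem exists_Lp_norm_sub_rpow_le {ε : ℝ} (hε : 0 < ε) :
    ∃ K : ℝ, 0 ≤ K ∧ ∀ f g : Lp E (ENNReal.ofReal p) μ,
      ‖f - g‖ ^ p ≤ ε * (‖f‖ ^ p + ‖g‖ ^ p) +
        K * ((‖f‖ ^ p + ‖g‖ ^ p) / 2 - ‖(1 / 2 : ℝ) • (f + g)‖ ^ p) := by
  obtain ⟨K, hK, h⟩ := exists_norm_sub_rpow_le (E := E) hp.out hε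
  refine ⟨K, hK, fun f g => ?_⟩
  have i1 := (Lp.memLp f).integrable_norm_rpow_ofReal
  have i2 := (Lp.memLp g).integrable_norm_rpow_ofReal
  have i3 := (Lp.memLp ((1 / 2 : ℝ) • (f + g))).integrable_norm_rpow_ofReal
  have i4 := (Lp.memLp (f - g)).integrable_norm_rpow_ofReal
  simp only [Lp_norm_rpow_eq_integral]
  rw [← integral_add i1 i2, ← integral_const_mul, ← integral_div, ← integral_sub,
    ← integral_const_mul, ← integral_add]
  · refine integral_mono_ae i4 ?_ ?_
    · exact ((i1.add i2).const_mul _).add ((((i1.add i2).div_const _).sub i3).const_mul _)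
    · filter_upwards [Lp.coeFn_sub f g, Lp.coeFn_smul (1 / 2 : ℝ) (f + g), Lp.coeFn_add f g]
        with x h1 h2 h3
      simp only [h1, h2, Pi.sub_apply, Pi.smul_apply, h3, Pi.add_apply]
      exact h _ _
  · exact (i1.add i2).const_mul _
  · exact (((i1.add i2).div_const _).sub i3).const_mul _
  · exact (i1.add i2).div_const _
  · exact i3

variable (E μ p) in
/-- Uniform convexity of `L^p`, for bounded functions of `L^p`. -/
theorem exists_Lp_norm_sub_le (R : ℝ) {ε : ℝ} (hε : 0 < ε) :
    ∃ δ > 0, ∀ f g : Lp E (ENNReal.ofReal p) μ, ‖f‖ ≤ R → ‖g‖ ≤ R →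
      (‖f‖ ^ p + ‖g‖ ^ p) / 2 - ‖(1 / 2 : ℝ) • (f + g)‖ ^ p ≤ δ → ‖f - g‖ ≤ ε := by
  have hp0 : 0 < p := zero_lt_one.trans hp.out
  rcases lt_or_ge R 0 with hR | hR
  · exact ⟨1, one_pos, fun f g hf => absurd ((norm_nonneg f).trans hf) (not_le.2 hR)⟩
  · have hRp : 0 ≤ R ^ p := by positivity
    have hεp : 0 < ε ^ p := by positivity
    -- This constant and the δ below each contribute at most ε^p/2. The added ones in R^p + 1 and K
    -- + 1 keep the denominators positive.
    obtain ⟨K, hK, h⟩ := exists_Lp_norm_sub_rpow_le E μ p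
      (ε := ε ^ p / (4 * (R ^ p + 1))) (by positivity)
    refine ⟨ε ^ p / (2 * (K + 1)), by positivity, fun f g hf hg hδ => ?_⟩
    have hf' : ‖f‖ ^ p ≤ R ^ p := by gcongr
    have hg' : ‖g‖ ^ p ≤ R ^ p := by gcongr
    have h1 : ε ^ p / (4 * (R ^ p + 1)) * (‖f‖ ^ p + ‖g‖ ^ p) ≤ ε ^ p / 2 := by
      calc _ ≤ ε ^ p / (4 * (R ^ p + 1)) * (2 * (R ^ p + 1)) := by gcongr; linarith
        _ = _ := by field_simp; norm_num
    have h2 : K * ((‖f‖ ^ p + ‖g‖ ^ p) / 2 - ‖(1 / 2 : ℝ) • (f + g)‖ ^ p) ≤ ε ^ p / 2 := by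
      calc _ ≤ (K + 1) * (ε ^ p / (2 * (K + 1))) := by
            refine mul_le_mul (by linarith) hδ ?_ (by linarith)
            exact sub_nonneg.2 (Lp_midpoint_rpow_le f g)
        _ = _ := by field_simp
    have h3 : ‖f - g‖ ^ p ≤ ε ^ p := by linarith [h f g]
    exact (Real.rpow_le_rpow_iff (norm_nonneg _) hε.le hp0).1 h3

end LpConvexity

/-! ### Weak compactness of the Sobolev space -/

namespace W01

variable {N : ℕ} {Ω : Set (EuclideanSpace ℝ (Fin N))} {p : ℝ} [hp : Fact (1 < p)]

instance : TopologicalSpace.SeparableSpace (SobolevPair Ω p) := by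
  have : Fact (ENNReal.ofReal p ≠ (∞ : ℝ≥0∞)) := ⟨ENNReal.ofReal_ne_top⟩
  have h1 : SecondCountableTopology (Lp ℝ (ENNReal.ofReal p) (volOn Ω)) := inferInstance
  have h2 : SecondCountableTopology
      (Lp (EuclideanSpace ℝ (Fin N)) (ENNReal.ofReal p) (volOn Ω)) := inferInstance
  have h3 : SecondCountableTopology (SobolevPair Ω p) := inferInstance
  infer_instance

instance : TopologicalSpace.SeparableSpace (W01 Ω p) := by
  have := UniformSpace.secondCountable_of_separable (SobolevPair Ω p)
  exact TopologicalSpace.SecondCountableTopology.to_separableSpace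

instance : CompleteSpace (W01 Ω p) :=
  (testPairs Ω p).isClosed_topologicalClosure.completeSpace_coe

/-- Bounded sequences in `W_0^{1,p}(Ω)` have weakly convergent subsequences. -/
theorem exists_subseq_tendsto_weak {u : ℕ → W01 Ω p} {R : ℝ} (hu : ∀ n, ‖u n‖ ≤ R) :
    ∃ (φ : ℕ → ℕ) (v : W01 Ω p), StrictMono φ ∧
      ∀ ℓ : StrongDual ℝ (W01 Ω p), Tendsto (fun n => ℓ (u (φ n))) atTop (𝓝 (ℓ v)) := by
  have hp0 : 0 < p := zero_lt_one.trans hp.out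
  have e1 : ∀ u : W01 Ω p, ‖(u : SobolevPair Ω p).1‖ ≤ ‖u‖ := fun u => norm_fst_le (u : SobolevPair Ω p)
  have e2 : ∀ u : W01 Ω p, ‖(u : SobolevPair Ω p).2‖ ≤ ‖u‖ := fun u => norm_snd_le (u : SobolevPair Ω p)
  -- The norm of the pair is a maximum, which is not uniformly convex; the sum of the p-th powers of
  -- the two components is used instead.
  refine _root_.exists_subseq_tendsto_weak
    (J := fun u : W01 Ω p => ‖(u : SobolevPair Ω p).1‖ ^ p + ‖(u : SobolevPair Ω p).2‖ ^ p)
    (fun u => by positivity) (fun R => ⟨R ^ p + R ^ p, fun u hu => ?_⟩) (fun R ε hε => ?_) hu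
  · have h1 := (e1 u).trans hu
    have h2 := (e2 u).trans hu
    gcongr
  · obtain ⟨δ₁, hδ₁, h1⟩ := exists_Lp_norm_sub_le ℝ (volOn Ω) p R hε
    obtain ⟨δ₂, hδ₂, h2⟩ := exists_Lp_norm_sub_le (EuclideanSpace ℝ (Fin N)) (volOn Ω) p R hε
    refine ⟨min δ₁ δ₂, lt_min hδ₁ hδ₂, fun x y hx hy hd => ?_⟩
    have m1 := Lp_midpoint_rpow_le (x : SobolevPair Ω p).1 (y : SobolevPair Ω p).1
    have m2 := Lp_midpoint_rpow_le (x : SobolevPair Ω p).2 (y : SobolevPair Ω p).2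
    simp only [Submodule.coe_smul, Submodule.coe_add, Prod.smul_fst, Prod.smul_snd,
      Prod.fst_add, Prod.snd_add] at hd
    rw [Submodule.coe_norm, Submodule.coe_sub, Prod.norm_def]
    refine max_le (h1 _ _ ((e1 x).trans hx) ((e1 y).trans hy) ?_)
      (h2 _ _ ((e2 x).trans hx) ((e2 y).trans hy) ?_)
    · have := min_le_left δ₁ δ₂
      linarith
    · have := min_le_right δ₁ δ₂
      linarith

end W01

/-! ### Smooth truncations -/

theorem abs_le_mul_abs_of_abs_deriv_le {Φ : ℝ → ℝ} (hΦ : ContDiff ℝ ∞ Φ) (h0 : Φ 0 = 0) {L : ℝ}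
    (hL : ∀ s, |deriv Φ s| ≤ L) (s : ℝ) : |Φ s| ≤ L * |s| := by
  have := Convex.norm_image_sub_le_of_norm_deriv_le (𝕜 := ℝ) (f := Φ) (s := Set.univ) (x := 0)
    (y := s) (C := L) (fun x _ => (hΦ.differentiable (by simp)).differentiableAt)
    (fun x _ => hL x) convex_univ (Set.mem_univ _) (Set.mem_univ _)
  simpa [h0] using this

/-- A smooth truncation at height `K`. -/
theorem exists_smooth_truncation {K : ℝ} (hK : 0 < K) :
    ∃ T : ℝ → ℝ, ContDiff ℝ ∞ T ∧ (∀ s, |s| ≤ K → T s = s) ∧ Monotone T ∧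
      (∀ s, |deriv T s| ≤ 1) ∧ ∃ B, ∀ s, |T s| ≤ B := by
  -- The truncation is the primitive of a bump equal to 1 on [-K, K]: 0 ≤ χ ≤ 1 gives monotonicity
  -- and the slope bound, and integrability of χ gives boundedness.
  let χ : ContDiffBump (0 : ℝ) := ⟨K, K + 1, hK, by linarith⟩
  have hχc : Continuous χ := χ.continuous
  have hd : ∀ s, HasDerivAt (fun s => ∫ t in (0 : ℝ)..s, χ t) (χ s) s := fun s =>
    intervalIntegral.integral_hasDerivAt_right (hχc.intervalIntegrable _ _)
      (hχc.stronglyMeasurableAtFilter _ _) hχc.continuousAt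
  have hde : deriv (fun s => ∫ t in (0 : ℝ)..s, χ t) = χ := funext fun s => (hd s).deriv
  refine ⟨fun s => ∫ t in (0 : ℝ)..s, χ t, ?_, ?_, ?_, ?_, ∫ t, ‖χ t‖, ?_⟩
  · rw [contDiff_infty_iff_deriv, hde]
    exact ⟨fun s => (hd s).differentiableAt, χ.contDiff⟩
  · intro s hs
    have : ∫ t in (0 : ℝ)..s, χ t = ∫ t in (0 : ℝ)..s, (1 : ℝ) := by
      refine intervalIntegral.integral_congr fun t ht => χ.one_of_mem_closedBall ?_
      have h1 : |t - 0| ≤ |s - 0| := Set.abs_sub_left_of_mem_uIcc ht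
      rw [mem_closedBall_zero_iff, Real.norm_eq_abs]
      simp only [sub_zero] at h1
      exact h1.trans hs
    simp [this]
  · refine monotone_of_deriv_nonneg (fun s => (hd s).differentiableAt) fun s => ?_
    rw [hde]
    exact χ.nonneg
  · intro s
    rw [hde, abs_of_nonneg χ.nonneg]
    exact χ.le_one
  · intro s
    rw [← Real.norm_eq_abs]
    refine (intervalIntegral.norm_integral_le_integral_norm_uIoc).trans ?_
    refine setIntegral_le_integral ?_ (Eventually.of_forall fun _ => norm_nonneg _)
    exact (hχc.integrable_of_hasCompactSupport χ.hasCompactSupport).norm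

/-- A smooth function can be modified outside a ball so that its derivative is bounded. -/
theorem exists_contDiff_eqOn_bounded_deriv {Φ : ℝ → ℝ} (hΦ : ContDiff ℝ ∞ Φ) (h0 : Φ 0 = 0)
    (R : ℝ) : ∃ Ψ : ℝ → ℝ, ContDiff ℝ ∞ Ψ ∧ Ψ 0 = 0 ∧ (∃ L, ∀ s, |deriv Ψ s| ≤ L) ∧
      ∀ s, |s| ≤ R → Ψ s = Φ s ∧ deriv Ψ s = deriv Φ s := by
  -- The inner radius exceeds |R|, so χ = 1 near every s with |s| ≤ R and the derivatives agree as
  -- well as the values.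
  let χ : ContDiffBump (0 : ℝ) := ⟨|R| + 1, |R| + 2, by positivity, by linarith⟩
  have hs : ContDiff ℝ ∞ fun s => χ s * Φ s := χ.contDiff.mul hΦ
  have hc : HasCompactSupport fun s => χ s * Φ s := χ.hasCompactSupport.mul_right
  refine ⟨fun s => χ s * Φ s, hs, by simp [h0], ?_, fun s hs => ?_⟩
  · obtain ⟨L, hL⟩ := (hs.continuous_deriv (by simp)).bounded_above_of_compact_support hc.deriv
    exact ⟨L, hL⟩
  · have hmem : s ∈ Metric.ball (0 : ℝ) (|R| + 1) := by
      rw [mem_ball_zero_iff, Real.norm_eq_abs]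
      linarith [le_abs_self R]
    have hev : (fun s => χ s * Φ s) =ᶠ[𝓝 s] Φ := by
      filter_upwards [Metric.isOpen_ball.mem_nhds hmem] with t ht
      rw [χ.one_of_mem_closedBall (Metric.ball_subset_closedBall ht), one_mul]
    exact ⟨hev.eq_of_nhds, hev.deriv_eq⟩

/-! ### Convergence and chain rule in the Sobolev space -/

section SobolevPair

variable {N : ℕ} {Ω : Set (EuclideanSpace ℝ (Fin N))} {p : ℝ} [hp : Fact (1 < p)]

theorem SobolevPair.exists_subseq_dominated {u : ℕ → SobolevPair Ω p} {v : SobolevPair Ω p}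
    (h : Tendsto u atTop (𝓝 v)) : ∃ (φ : ℕ → ℕ) (G : EuclideanSpace ℝ (Fin N) → ℝ),
      StrictMono φ ∧ MemLp G (ENNReal.ofReal p) (volOn Ω) ∧
      (∀ᵐ x ∂(volOn Ω), ∀ n, |(u (φ n)).1 x| ≤ G x ∧ ‖(u (φ n)).2 x‖ ≤ G x) ∧
      (∀ᵐ x ∂(volOn Ω), Tendsto (fun n => (u (φ n)).1 x) atTop (𝓝 (v.1 x))) ∧
      ∀ᵐ x ∂(volOn Ω), Tendsto (fun n => (u (φ n)).2 x) atTop (𝓝 (v.2 x)) := by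
  obtain ⟨φ₁, G₁, hφ₁, hG₁, h1, h2⟩ := exists_subseq_dominated_of_tendsto_Lp
    ((continuous_fst.tendsto v).comp h)
  obtain ⟨φ₂, G₂, hφ₂, hG₂, h3, h4⟩ := exists_subseq_dominated_of_tendsto_Lp
    (((continuous_snd.tendsto v).comp h).comp hφ₁.tendsto_atTop)
  refine ⟨φ₁ ∘ φ₂, fun x => ‖G₁ x‖ + ‖G₂ x‖, hφ₁.comp hφ₂, hG₁.norm.add hG₂.norm, ?_, ?_, ?_⟩
  · filter_upwards [h1, h3] with x a1 a3 n
    have b1 := (a1 (φ₂ n)).trans (Real.le_norm_self _)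
    have b3 := (a3 n).trans (Real.le_norm_self _)
    exact ⟨b1.trans (le_add_of_nonneg_right (norm_nonneg _)),
      b3.trans (le_add_of_nonneg_left (norm_nonneg _))⟩
  · filter_upwards [h2] with x a using a.comp hφ₂.tendsto_atTop
  · filter_upwards [h4] with x a using a

end SobolevPair

namespace W01

variable {N : ℕ} {Ω : Set (EuclideanSpace ℝ (Fin N))} {p : ℝ} [hp : Fact (1 < p)]

theorem memLp_val (u : W01 Ω p) : MemLp u.val (ENNReal.ofReal p) (volOn Ω) := Lp.memLp _

theorem memLp_grad (u : W01 Ω p) : MemLp u.grad (ENNReal.ofReal p) (volOn Ω) := Lp.memLp _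

theorem val_sub (u v : W01 Ω p) : ∀ᵐ x ∂(volOn Ω), (u - v).val x = u.val x - v.val x :=
  Lp.coeFn_sub (u : SobolevPair Ω p).1 (v : SobolevPair Ω p).1

theorem grad_sub (u v : W01 Ω p) : ∀ᵐ x ∂(volOn Ω), (u - v).grad x = u.grad x - v.grad x :=
  Lp.coeFn_sub (u : SobolevPair Ω p).2 (v : SobolevPair Ω p).2

theorem val_smul (c : ℝ) (u : W01 Ω p) : ∀ᵐ x ∂(volOn Ω), (c • u).val x = c * u.val x :=
  Lp.coeFn_smul c (u : SobolevPair Ω p).1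

theorem grad_smul (c : ℝ) (u : W01 Ω p) : ∀ᵐ x ∂(volOn Ω), (c • u).grad x = c • u.grad x :=
  Lp.coeFn_smul c (u : SobolevPair Ω p).2

/-- A strongly convergent sequence in `W_0^{1,p}(Ω)` has a subsequence that converges almost
everywhere, together with the gradients, and is dominated by an `L^p` function. -/
theorem exists_subseq_dominated {u : ℕ → W01 Ω p} {v : W01 Ω p} (h : Tendsto u atTop (𝓝 v)) :
    ∃ (φ : ℕ → ℕ) (G : EuclideanSpace ℝ (Fin N) → ℝ),
      StrictMono φ ∧ MemLp G (ENNReal.ofReal p) (volOn Ω) ∧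
      (∀ᵐ x ∂(volOn Ω), ∀ n, |(u (φ n)).val x| ≤ G x ∧ ‖(u (φ n)).grad x‖ ≤ G x) ∧
      (∀ᵐ x ∂(volOn Ω), Tendsto (fun n => (u (φ n)).val x) atTop (𝓝 (v.val x))) ∧
      ∀ᵐ x ∂(volOn Ω), Tendsto (fun n => (u (φ n)).grad x) atTop (𝓝 (v.grad x)) :=
  SobolevPair.exists_subseq_dominated ((continuous_subtype_val.tendsto v).comp h)

/-- Dominated convergence in `W_0^{1,p}(Ω)`. -/
theorem tendsto_of_dominated {u : ℕ → W01 Ω p} {v : W01 Ω p}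
    {G : EuclideanSpace ℝ (Fin N) → ℝ} (hG : MemLp G (ENNReal.ofReal p) (volOn Ω))
    (h1 : ∀ n, ∀ᵐ x ∂(volOn Ω), |(u n).val x| ≤ G x)
    (h2 : ∀ n, ∀ᵐ x ∂(volOn Ω), ‖(u n).grad x‖ ≤ G x)
    (h3 : ∀ᵐ x ∂(volOn Ω), Tendsto (fun n => (u n).val x) atTop (𝓝 (v.val x)))
    (h4 : ∀ᵐ x ∂(volOn Ω), Tendsto (fun n => (u n).grad x) atTop (𝓝 (v.grad x))) :
    Tendsto u atTop (𝓝 v) := by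
  rw [tendsto_subtype_rng]
  exact (tendsto_Lp_of_dominated hG h1 h3).prodMk_nhds (tendsto_Lp_of_dominated hG h2 h4)

/-- The chain rule in `W_0^{1,p}(Ω)`. -/
theorem exists_comp {Φ : ℝ → ℝ} (hΦ : ContDiff ℝ ∞ Φ) (h0 : Φ 0 = 0) {L : ℝ}
    (hL : ∀ s, |deriv Φ s| ≤ L) (u : W01 Ω p) :
    ∃ w : W01 Ω p, (∀ᵐ x ∂(volOn Ω), w.val x = Φ (u.val x)) ∧
      ∀ᵐ x ∂(volOn Ω), w.grad x = deriv Φ (u.val x) • u.grad x := by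
  have hL0 : 0 ≤ L := (abs_nonneg _).trans (hL 0)
  have hlip := abs_le_mul_abs_of_abs_deriv_le hΦ h0 hL
  have hdc : Continuous (deriv Φ) := hΦ.continuous_deriv (by simp)
  have m1 : ∀ w : SobolevPair Ω p,
      MemLp (fun x => Φ (w.1 x)) (ENNReal.ofReal p) (volOn Ω) := fun w =>
    (Lp.memLp w.1).of_le_mul (c := L)
      (hΦ.continuous.comp_aestronglyMeasurable (Lp.aestronglyMeasurable _))
      (Eventually.of_forall fun x => hlip _)
  have m2 : ∀ w : SobolevPair Ω p,
      MemLp (fun x => deriv Φ (w.1 x) • w.2 x) (ENNReal.ofReal p) (volOn Ω) := fun w =>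
    (Lp.memLp w.2).of_le_mul (c := L)
      ((hdc.comp_aestronglyMeasurable (Lp.aestronglyMeasurable _)).smul
        (Lp.aestronglyMeasurable _))
      (Eventually.of_forall fun x => by
        rw [norm_smul]
        exact mul_le_mul_of_nonneg_right (hL _) (norm_nonneg _))
  let F : SobolevPair Ω p → SobolevPair Ω p := fun w => ((m1 w).toLp, (m2 w).toLp)
  have hF1 : ∀ w, ∀ᵐ x ∂(volOn Ω), (F w).1 x = Φ (w.1 x) := fun w => (m1 w).coeFn_toLp
  have hF2 : ∀ w, ∀ᵐ x ∂(volOn Ω), (F w).2 x = deriv Φ (w.1 x) • w.2 x := fun w =>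
    (m2 w).coeFn_toLp
  -- For test functions this is the classical chain rule; Φ(0) = 0 preserves the compact support.
  have hFt : ∀ w ∈ testPairs Ω p, F w ∈ testPairs Ω p := by
    rintro w ⟨φ, hφ, hw1, hw2⟩
    refine ⟨Φ ∘ φ, ⟨hΦ.comp hφ.smooth, hφ.compact.comp_left h0, ?_⟩, ?_, ?_⟩
    · refine (closure_mono fun x hx => ?_).trans hφ.supp
      intro hx0
      exact hx (by simp [hx0, h0])
    · filter_upwards [hF1 w, hw1] with x a b
      rw [a, b]; rfl
    · filter_upwards [hF2 w, hw1, hw2] with x a b c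
      rw [a, b, c]
      have d1 : HasFDerivAt φ (fderiv ℝ φ x) x :=
        (hφ.smooth.differentiable (by simp)).differentiableAt.hasFDerivAt
      have d2 : HasDerivAt Φ (deriv Φ (φ x)) (φ x) :=
        (hΦ.differentiable (by simp)).differentiableAt.hasDerivAt
      have d3 := (d2.comp_hasFDerivAt x d1).fderiv
      rw [gradient, gradient, d3, map_smul]
  -- Membership in the closure needs the convergence of `F` only along a subsequence of the
  -- approximating test functions, chosen dominated and almost everywhere convergent so that the
  -- continuity of Φ' can be used.
  have hmem : F (u : SobolevPair Ω p) ∈ (testPairs Ω p).topologicalClosure := by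
    obtain ⟨w, hw, hlim⟩ := mem_closure_iff_seq_limit.1 u.2
    obtain ⟨φ, G, -, hG, h1, h2, h3⟩ := SobolevPair.exists_subseq_dominated hlim
    have hlimF : Tendsto (fun n => F (w (φ n))) atTop (𝓝 (F u)) := by
      have hF1' := ae_all_iff.2 fun n => hF1 (w (φ n))
      have hF2' := ae_all_iff.2 fun n => hF2 (w (φ n))
      refine Tendsto.prodMk_nhds (tendsto_Lp_of_dominated (hG.const_mul L) (fun n => ?_) ?_)
        (tendsto_Lp_of_dominated (hG.const_mul L) (fun n => ?_) ?_)
      · filter_upwards [h1, hF1'] with x a b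
        change ‖(F (w (φ n))).1 x‖ ≤ _
        rw [b]
        exact (hlip _).trans (mul_le_mul_of_nonneg_left (a n).1 hL0)
      · filter_upwards [h2, hF1', hF1 u] with x a b c
        change Tendsto (fun n => (F (w (φ n))).1 x) atTop (𝓝 ((F u).1 x))
        simp only [b, c]
        exact (hΦ.continuous.tendsto _).comp a
      · filter_upwards [h1, hF2'] with x a b
        change ‖(F (w (φ n))).2 x‖ ≤ _
        rw [b, norm_smul]
        exact mul_le_mul (hL _) (a n).2 (norm_nonneg _) hL0
      · filter_upwards [h2, h3, hF2', hF2 u] with x a a' b c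
        change Tendsto (fun n => (F (w (φ n))).2 x) atTop (𝓝 ((F u).2 x))
        simp only [b, c]
        exact ((hdc.tendsto _).comp a).smul a'
    exact mem_closure_of_tendsto hlimF (Eventually.of_forall fun n => hFt _ (hw _))
  exact ⟨⟨F u, hmem⟩, hF1 u, hF2 u⟩

/-- The chain rule for bounded functions in `W_0^{1,p}(Ω)`. -/
theorem exists_comp_of_bounded {Φ : ℝ → ℝ} (hΦ : ContDiff ℝ ∞ Φ) (h0 : Φ 0 = 0) {u : W01 Ω p}
    {R : ℝ} (hu : ∀ᵐ x ∂(volOn Ω), |u.val x| ≤ R) :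
    ∃ w : W01 Ω p, (∀ᵐ x ∂(volOn Ω), w.val x = Φ (u.val x)) ∧
      ∀ᵐ x ∂(volOn Ω), w.grad x = deriv Φ (u.val x) • u.grad x := by
  obtain ⟨Ψ, hΨ, hΨ0, ⟨L, hL⟩, heq⟩ := exists_contDiff_eqOn_bounded_deriv hΦ h0 R
  obtain ⟨w, h1, h2⟩ := exists_comp hΨ hΨ0 hL u
  refine ⟨w, ?_, ?_⟩
  · filter_upwards [hu, h1] with x a b
    rw [b, (heq _ a).1]
  · filter_upwards [hu, h2] with x a b
    rw [b, (heq _ a).2]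

/-- If `v n → v` in `W_0^{1,p}(Ω)` and `T` is smooth with bounded derivative, then along a
subsequence `T(v n) → T(v)`. -/
theorem exists_subseq_tendsto_comp {T : ℝ → ℝ} (hT : ContDiff ℝ ∞ T) (hT0 : T 0 = 0) {L : ℝ}
    (hL : ∀ s, |deriv T s| ≤ L) {v : ℕ → W01 Ω p} {v₀ w₀ : W01 Ω p}
    (hv : Tendsto v atTop (𝓝 v₀)) {w : ℕ → W01 Ω p}
    (hw : ∀ n, ∀ᵐ x ∂(volOn Ω), (w n).val x = T ((v n).val x))
    (hw' : ∀ n, ∀ᵐ x ∂(volOn Ω), (w n).grad x = deriv T ((v n).val x) • (v n).grad x)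
    (hw₀ : ∀ᵐ x ∂(volOn Ω), w₀.val x = T (v₀.val x))
    (hw₀' : ∀ᵐ x ∂(volOn Ω), w₀.grad x = deriv T (v₀.val x) • v₀.grad x) :
    ∃ φ : ℕ → ℕ, StrictMono φ ∧ Tendsto (fun n => w (φ n)) atTop (𝓝 w₀) := by
  have hL0 : 0 ≤ L := (abs_nonneg _).trans (hL 0)
  have hlip := abs_le_mul_abs_of_abs_deriv_le hT hT0 hL
  have hdc : Continuous (deriv T) := hT.continuous_deriv (by simp)
  obtain ⟨φ, G, hφ, hG, h1, h2, h3⟩ := exists_subseq_dominated hv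
  have e1 := ae_all_iff.2 hw
  have e2 := ae_all_iff.2 hw'
  refine ⟨φ, hφ, tendsto_of_dominated (hG.const_mul L) (fun n => ?_) (fun n => ?_) ?_ ?_⟩
  · filter_upwards [h1, e1] with x a b
    rw [b]
    exact (hlip _).trans (mul_le_mul_of_nonneg_left (a n).1 hL0)
  · filter_upwards [h1, e2] with x a b
    rw [b, norm_smul]
    exact mul_le_mul (hL _) (a n).2 (norm_nonneg _) hL0
  · filter_upwards [h2, e1, hw₀] with x a b c
    simp only [b, c]
    exact (hT.continuous.tendsto _).comp a
  · filter_upwards [h2, h3, e2, hw₀'] with x a a' b c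
    simp only [b, c]
    exact ((hdc.tendsto _).comp a).smul a'

end W01

/-! ### Rellich-type compactness by averaging over balls -/

section Averages

variable {E : Type*} [NormedAddCommGroup E] [NormedSpace ℝ E] [MeasurableSpace E]
  [BorelSpace E] [FiniteDimensional ℝ E] {μ : Measure E} [μ.IsAddHaarMeasure]

/-- The increment is the integral of the derivative along the segment from x to x + z; Tonelli and
translation invariance remove the dependence on the point of the segment. -/
theorem lintegral_enorm_sub_translate_le {φ : E → ℝ} (hφ : ContDiff ℝ ∞ φ) (z : E) :
    ∫⁻ x, ‖φ x - φ (x + z)‖ₑ ∂μ ≤ ‖z‖ₑ * ∫⁻ x, ‖fderiv ℝ φ x‖ₑ ∂μ := by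
  have hd : Differentiable ℝ φ := hφ.differentiable (by simp)
  have hc : Continuous (fderiv ℝ φ) := hφ.continuous_fderiv (by simp)
  have hpt : ∀ x, ‖φ x - φ (x + z)‖ₑ ≤
      ∫⁻ t in Set.Ioc (0 : ℝ) 1, ‖z‖ₑ * ‖fderiv ℝ φ (x + t • z)‖ₑ := by
    intro x
    have hder : ∀ t : ℝ, HasDerivAt (fun t : ℝ => φ (x + t • z)) (fderiv ℝ φ (x + t • z) z) t := by
      intro t
      have h1 : HasDerivAt (fun t : ℝ => x + t • z) z t := by
        simpa using ((hasDerivAt_id t).smul_const z).const_add x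
      exact (hd _).hasFDerivAt.comp_hasDerivAt t h1
    have hcont : Continuous fun t : ℝ => fderiv ℝ φ (x + t • z) z :=
      (hc.comp (by fun_prop)).clm_apply continuous_const
    have hint := intervalIntegral.integral_eq_sub_of_hasDerivAt (a := 0) (b := 1)
      (fun t _ => hder t) (hcont.intervalIntegrable _ _)
    rw [one_smul, zero_smul, add_zero, intervalIntegral.integral_of_le zero_le_one] at hint
    rw [← enorm_neg, neg_sub, ← hint]
    refine (enorm_integral_le_lintegral_enorm _).trans (lintegral_mono fun t => ?_)
    rw [mul_comm]
    exact (fderiv ℝ φ (x + t • z)).le_opENorm z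
  calc ∫⁻ x, ‖φ x - φ (x + z)‖ₑ ∂μ
      ≤ ∫⁻ x, ∫⁻ t in Set.Ioc (0 : ℝ) 1, ‖z‖ₑ * ‖fderiv ℝ φ (x + t • z)‖ₑ ∂volume ∂μ :=
        lintegral_mono hpt
    _ = ∫⁻ t in Set.Ioc (0 : ℝ) 1, ∫⁻ x, ‖z‖ₑ * ‖fderiv ℝ φ (x + t • z)‖ₑ ∂μ := by
        refine lintegral_lintegral_swap (Continuous.aemeasurable ?_)
        refine ENNReal.continuous_const_mul enorm_ne_top |>.comp ?_
        exact (hc.comp (by fun_prop)).enorm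
    _ = ∫⁻ t in Set.Ioc (0 : ℝ) 1, ‖z‖ₑ * ∫⁻ x, ‖fderiv ℝ φ x‖ₑ ∂μ := by
        refine lintegral_congr fun t => ?_
        rw [lintegral_const_mul' _ _ enorm_ne_top,
          lintegral_add_right_eq_self (fun x => ‖fderiv ℝ φ x‖ₑ)]
    _ = _ := by simp

omit [NormedSpace ℝ E] [FiniteDimensional ℝ E] in
theorem setIntegral_ball_eq_translate (g : E → ℝ) (x : E) (r : ℝ) :
    ∫ y in Metric.ball x r, g y ∂μ = ∫ z in Metric.ball (0 : E) r, g (x + z) ∂μ := by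
  have hm := (measurePreserving_add_left μ x).setIntegral_preimage_emb
    (measurableEmbedding_addLeft x) g (Metric.ball x r)
  rw [← hm]
  congr 2
  ext z
  simp [dist_eq_norm]

/-- A smooth function is close in `L^1` to its averages on small balls. -/
theorem lintegral_enorm_sub_average_le {φ : E → ℝ} (hφ : ContDiff ℝ ∞ φ)
    {r : ℝ} (hr : 0 < r) :
    ∫⁻ x, ‖φ x - ⨍ z in Metric.ball (0 : E) r, φ (x + z) ∂μ‖ₑ ∂μ ≤
      ENNReal.ofReal r * ∫⁻ x, ‖fderiv ℝ φ x‖ₑ ∂μ := by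
  set B := Metric.ball (0 : E) r with hB
  have hB0 : μ B ≠ 0 := (Metric.measure_ball_pos μ _ hr).ne'
  have hBt : μ B ≠ ⊤ := measure_ball_lt_top.ne
  have hc := hφ.continuous
  have hpt : ∀ x, ‖φ x - ⨍ z in B, φ (x + z) ∂μ‖ₑ ≤
      (μ B)⁻¹ * ∫⁻ z in B, ‖φ x - φ (x + z)‖ₑ ∂μ := by
    intro x
    have hi : IntegrableOn (fun z => φ (x + z)) B μ := by
      refine (Continuous.continuousOn (by fun_prop)).integrableOn_compact
        (isCompact_closedBall (0 : E) r) |>.mono_set Metric.ball_subset_closedBall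
    have e : φ x - ⨍ z in B, φ (x + z) ∂μ = ⨍ z in B, (φ x - φ (x + z)) ∂μ := by
      rw [setAverage_eq, setAverage_eq, integral_sub (integrable_const_iff.2 (Or.inr ⟨by simpa using hBt.lt_top⟩)) hi, smul_sub,
        ← setAverage_eq, ← setAverage_eq, setAverage_const hB0 hBt]
    rw [e]
    refine (enorm_integral_le_lintegral_enorm _).trans ?_
    rw [lintegral_smul_measure, Measure.restrict_apply_univ, smul_eq_mul]
  calc _ ≤ ∫⁻ x, (μ B)⁻¹ * ∫⁻ z in B, ‖φ x - φ (x + z)‖ₑ ∂μ ∂μ := lintegral_mono hpt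
    _ = (μ B)⁻¹ * ∫⁻ z in B, ∫⁻ x, ‖φ x - φ (x + z)‖ₑ ∂μ ∂μ := by
        rw [lintegral_const_mul' _ _ (ENNReal.inv_ne_top.2 hB0), lintegral_lintegral_swap]
        refine Continuous.aemeasurable (Continuous.enorm ?_)
        fun_prop
    _ ≤ (μ B)⁻¹ * ∫⁻ z in B, ENNReal.ofReal r * ∫⁻ x, ‖fderiv ℝ φ x‖ₑ ∂μ ∂μ := by
        gcongr 1
        refine setLIntegral_mono' Metric.isOpen_ball.measurableSet fun z hz => ?_
        refine (lintegral_enorm_sub_translate_le hφ z).trans ?_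
        gcongr
        rw [← ofReal_norm]
        exact ENNReal.ofReal_le_ofReal (by simpa using (mem_ball_zero_iff.1 hz).le)
    _ = _ := by
        rw [setLIntegral_const, mul_comm _ (μ B), ← mul_assoc, ENNReal.inv_mul_cancel hB0 hBt,
          one_mul]

/-- The compactness argument behind the Rellich-Kondrachov theorem: smooth functions with
gradients bounded in `L^1`, whose integrals over all balls tend to zero, tend to zero
in `L^1` of any set of finite measure. -/
theorem tendsto_setLIntegral_of_tendsto_ball {φ : ℕ → E → ℝ} (hφ : ∀ n, ContDiff ℝ ∞ (φ n))
    {C D : ℝ≥0∞} (hC : C ≠ ⊤) (hD : D ≠ ⊤) (hgrad : ∀ n, ∫⁻ x, ‖fderiv ℝ (φ n) x‖ₑ ∂μ ≤ C)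
    (hL1 : ∀ n, ∫⁻ x, ‖φ n x‖ₑ ∂μ ≤ D)
    (hball : ∀ x r, 0 < r → Tendsto (fun n => ∫ y in Metric.ball x r, φ n y ∂μ) atTop (𝓝 0))
    {Ω : Set E} (hΩ : μ Ω ≠ ⊤) :
    Tendsto (fun n => ∫⁻ x in Ω, ‖φ n x‖ₑ ∂μ) atTop (𝓝 0) := by
  -- At a fixed radius the averages tend to zero pointwise and are bounded by D/μ(B), so finiteness
  -- of the measure of Ω allows dominated convergence.
  have havg : ∀ r : ℝ, 0 < r → Tendsto
      (fun n => ∫⁻ x in Ω, ‖⨍ z in Metric.ball (0 : E) r, φ n (x + z) ∂μ‖ₑ ∂μ) atTop (𝓝 0) := by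
    intro r hr
    set B := Metric.ball (0 : E) r with hB
    have hB0 : μ B ≠ 0 := (Metric.measure_ball_pos μ _ hr).ne'
    have key : Tendsto (fun n => ∫⁻ x in Ω, ‖⨍ z in B, φ n (x + z) ∂μ‖ₑ ∂μ) atTop
        (𝓝 (∫⁻ x in Ω, 0 ∂μ)) := by
      refine tendsto_lintegral_of_dominated_convergence' (fun _ => (μ B)⁻¹ * D)
        (fun n => ?_) (fun n => Eventually.of_forall fun x => ?_) ?_
        (Eventually.of_forall fun x => ?_)
      · have hc := (hφ n).continuous
        have : StronglyMeasurable (Function.uncurry fun x z : E => φ n (x + z)) := by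
          refine Continuous.stronglyMeasurable ?_
          simp only [Function.uncurry_def]
          fun_prop
        exact (StronglyMeasurable.integral_prod_right this).enorm.aemeasurable
      · refine (enorm_integral_le_lintegral_enorm _).trans ?_
        rw [lintegral_smul_measure, Measure.restrict_apply_univ, smul_eq_mul]
        change _ ≤ (μ B)⁻¹ * D
        gcongr
        refine (setLIntegral_le_lintegral _ _).trans ?_
        rw [lintegral_add_left_eq_self (fun z => ‖φ n z‖ₑ) x]
        exact hL1 n
      · rw [setLIntegral_const]
        exact ENNReal.mul_ne_top (ENNReal.mul_ne_top (ENNReal.inv_ne_top.2 hB0) hD) hΩ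
      · have h1 := (hball x r hr).const_smul (μ.real B)⁻¹
        have h2 := h1.enorm
        simp only [smul_zero, enorm_zero] at h2
        refine h2.congr fun n => ?_
        rw [setAverage_eq, ← setIntegral_ball_eq_translate]
    simpa using key
  rw [ENNReal.tendsto_nhds_zero]
  intro ε hε
  -- The radius makes the distance to the averages, at most rC, smaller than ε/2 for all n at once.
  -- The minimum with 1 keeps it finite when ε is infinite.
  obtain ⟨r, hr, hrC⟩ : ∃ r : ℝ, 0 < r ∧ ENNReal.ofReal r * C ≤ ε / 2 := by
    rcases eq_or_ne C 0 with h0 | h0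
    · exact ⟨1, one_pos, by simp [h0]⟩
    · have hpos : 0 < min (ε / 2 / C) 1 :=
        lt_min (ENNReal.div_pos (ENNReal.half_pos hε.ne').ne' hC) one_pos
      have hlt : min (ε / 2 / C) 1 ≠ ⊤ := (lt_of_le_of_lt (min_le_right _ _) ENNReal.one_lt_top).ne
      refine ⟨(min (ε / 2 / C) 1).toReal, ENNReal.toReal_pos hpos.ne' hlt, ?_⟩
      rw [ENNReal.ofReal_toReal hlt]
      calc _ ≤ (ε / 2 / C) * C := by gcongr; exact min_le_left _ _
        _ = _ := ENNReal.div_mul_cancel h0 hC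
  filter_upwards [ENNReal.tendsto_nhds_zero.1 (havg r hr) (ε / 2) (ENNReal.half_pos hε.ne')]
    with n hn
  have hm : AEMeasurable (fun x => ‖φ n x - ⨍ z in Metric.ball (0 : E) r, φ n (x + z) ∂μ‖ₑ)
      (μ.restrict Ω) := by
    have hc := (hφ n).continuous
    have : StronglyMeasurable (Function.uncurry fun x z : E => φ n (x + z)) := by
      refine Continuous.stronglyMeasurable ?_
      simp only [Function.uncurry_def]
      fun_prop
    exact (hc.stronglyMeasurable.sub
      (StronglyMeasurable.integral_prod_right this)).enorm.aemeasurable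
  calc ∫⁻ x in Ω, ‖φ n x‖ₑ ∂μ
      ≤ ∫⁻ x in Ω, (‖φ n x - ⨍ z in Metric.ball (0 : E) r, φ n (x + z) ∂μ‖ₑ +
          ‖⨍ z in Metric.ball (0 : E) r, φ n (x + z) ∂μ‖ₑ) ∂μ := by
        refine lintegral_mono fun x => ?_
        conv_lhs => rw [← sub_add_cancel (φ n x) (⨍ z in Metric.ball (0 : E) r, φ n (x + z) ∂μ)]
        exact enorm_add_le _ _
    _ = ∫⁻ x in Ω, ‖φ n x - ⨍ z in Metric.ball (0 : E) r, φ n (x + z) ∂μ‖ₑ ∂μ +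
          ∫⁻ x in Ω, ‖⨍ z in Metric.ball (0 : E) r, φ n (x + z) ∂μ‖ₑ ∂μ :=
        lintegral_add_left' hm _
    _ ≤ ε / 2 + ε / 2 := by
        refine add_le_add ?_ hn
        refine (setLIntegral_le_lintegral _ _).trans ?_
        refine (lintegral_enorm_sub_average_le (hφ n) hr).trans ?_
        exact le_trans (by gcongr; exact hgrad n) hrC
    _ = ε := ENNReal.add_halves ε

end Averages

/-! ### Dual functionals and almost everywhere convergence of weakly convergent sequences -/

namespace W01

variable {N : ℕ} {Ω : Set (EuclideanSpace ℝ (Fin N))} {p : ℝ} [hp : Fact (1 < p)]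

/-- Integration of `u` against a function in `L^{p'}` is a continuous functional. -/
theorem exists_dual_val {g : EuclideanSpace ℝ (Fin N) → ℝ}
    (hg : MemLp g (ENNReal.ofReal (p / (p - 1))) (volOn Ω)) :
    ∃ ℓ : StrongDual ℝ (W01 Ω p), ∀ u : W01 Ω p, ℓ u = ∫ x in Ω, u.val x * g x := by
  have hpq : Real.HolderConjugate p (p / (p - 1)) := Real.HolderConjugate.conjExponent hp.out
  have : ENNReal.HolderConjugate (ENNReal.ofReal p) (ENNReal.ofReal (p / (p - 1))) :=
    hpq.ennrealOfReal
  have : Fact ((1 : ℝ≥0∞) ≤ ENNReal.ofReal (p / (p - 1))) := ⟨by simpa using hpq.symm.lt.le⟩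
  let B := (ContinuousLinearMap.mul ℝ ℝ).lpPairing (volOn Ω) (ENNReal.ofReal p)
    (ENNReal.ofReal (p / (p - 1)))
  refine ⟨((B.flip hg.toLp).comp (ContinuousLinearMap.fst ℝ _ _)).comp
    (testPairs Ω p).topologicalClosure.subtypeL, fun u => ?_⟩
  change B (u : SobolevPair Ω p).1 hg.toLp = _
  simp only [B, ContinuousLinearMap.lpPairing_eq_integral]
  refine integral_congr_ae ?_
  filter_upwards [hg.coeFn_toLp] with x hx
  rw [hx]; rfl

/-- Integration of `Du` against a vector field in `L^{p'}` is a continuous functional. -/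
theorem exists_dual_grad {F : EuclideanSpace ℝ (Fin N) → EuclideanSpace ℝ (Fin N)}
    (hF : MemLp F (ENNReal.ofReal (p / (p - 1))) (volOn Ω)) :
    ∃ ℓ : StrongDual ℝ (W01 Ω p), ∀ u : W01 Ω p, ℓ u = ∫ x in Ω, inner ℝ (F x) (u.grad x) := by
  have hpq : Real.HolderConjugate p (p / (p - 1)) := Real.HolderConjugate.conjExponent hp.out
  have : ENNReal.HolderConjugate (ENNReal.ofReal p) (ENNReal.ofReal (p / (p - 1))) :=
    hpq.ennrealOfReal
  have : Fact ((1 : ℝ≥0∞) ≤ ENNReal.ofReal (p / (p - 1))) := ⟨by simpa using hpq.symm.lt.le⟩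
  let B := (innerSL ℝ (E := EuclideanSpace ℝ (Fin N))).lpPairing (volOn Ω) (ENNReal.ofReal p)
    (ENNReal.ofReal (p / (p - 1)))
  refine ⟨((B.flip hF.toLp).comp (ContinuousLinearMap.snd ℝ _ _)).comp
    (testPairs Ω p).topologicalClosure.subtypeL, fun u => ?_⟩
  change B (u : SobolevPair Ω p).2 hF.toLp = _
  simp only [B, ContinuousLinearMap.lpPairing_eq_integral]
  refine integral_congr_ae ?_
  filter_upwards [hF.coeFn_toLp] with x hx
  rw [hx, innerSL_apply_apply, real_inner_comm]; rfl

/-- On a set of finite measure the `L^1` norm is controlled by the `L^p` norm. -/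
theorem exists_lintegral_enorm_le (hΩ : volume Ω ≠ (∞ : ℝ≥0∞)) (p : ℝ) [hp : Fact (1 < p)] :
    ∃ c : ℝ≥0∞, c ≠ (∞ : ℝ≥0∞) ∧ ∀ (E : Type) [NormedAddCommGroup E]
      (f : Lp E (ENNReal.ofReal p) (volOn Ω)), ∫⁻ x in Ω, ‖f x‖ₑ ≤ c * ‖f‖ₑ := by
  refine ⟨volOn Ω Set.univ ^ (1 / (1 : ℝ≥0∞).toReal - 1 / (ENNReal.ofReal p).toReal), ?_,
    fun E _ f => ?_⟩
  · refine ENNReal.rpow_ne_top_of_nonneg ?_ (by simpa using hΩ)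
    rw [ENNReal.toReal_ofReal (zero_le_one.trans hp.out.le), ENNReal.toReal_one, sub_nonneg]
    exact one_div_le_one_div_of_le one_pos hp.out.le
  · have := eLpNorm_le_eLpNorm_mul_rpow_measure_univ (μ := volOn Ω)
      (Fact.out : (1 : ℝ≥0∞) ≤ ENNReal.ofReal p) (Lp.aestronglyMeasurable f)
    rwa [eLpNorm_one_eq_lintegral_enorm, mul_comm, ← Lp.enorm_def] at this

/-- Weak convergence to zero in `W_0^{1,p}(Ω)` implies strong convergence in `L^1(Ω)`. -/
theorem tendsto_lintegral_enorm_of_tendsto_weak_zero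
    (hΩf : volume Ω ≠ (∞ : ℝ≥0∞)) {u : ℕ → W01 Ω p} {R : ℝ} (hR : ∀ n, ‖u n‖ ≤ R)
    (hu : ∀ ℓ : StrongDual ℝ (W01 Ω p), Tendsto (fun n => ℓ (u n)) atTop (𝓝 0)) :
    Tendsto (fun n => ∫⁻ x in Ω, ‖(u n).val x‖ₑ) atTop (𝓝 0) := by
  classical
  have : IsFiniteMeasure (volOn Ω) := ⟨by simpa [volOn] using hΩf.lt_top⟩
  obtain ⟨c, hc, hcle⟩ := exists_lintegral_enorm_le hΩf p
  -- Each u_n is replaced by a test function within 1/(n+1). Test functions live on the whole space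
  -- and vanish outside Ω, which is why no regularity of the boundary is needed.
  have happ : ∀ n : ℕ, ∃ w ∈ testPairs Ω p,
      ‖(u n : SobolevPair Ω p) - w‖ < 1 / ((n : ℝ) + 1) := by
    intro n
    obtain ⟨w, hw, hd⟩ := Metric.mem_closure_iff.1 (u n).2 (1 / ((n : ℝ) + 1)) (by positivity)
    exact ⟨w, hw, by rwa [dist_eq_norm] at hd⟩
  choose w hw hwu using happ
  let v : ℕ → W01 Ω p := fun n => ⟨w n, Submodule.le_topologicalClosure _ (hw n)⟩
  have hdiff : Tendsto (fun n => ‖u n - v n‖) atTop (𝓝 0) :=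
    squeeze_zero (fun n => norm_nonneg _) (fun n => (hwu n).le)
      tendsto_one_div_add_atTop_nhds_zero_nat
  choose φ hφ hφ1 hφ2 using fun n => id (hw n)
  have hvR : ∀ n, ‖w n‖ ≤ R + 1 := by
    intro n
    have h1 : (1 : ℝ) / ((n : ℝ) + 1) ≤ 1 := by
      rw [div_le_one (by positivity)]
      linarith [(Nat.cast_nonneg n : (0 : ℝ) ≤ n)]
    have h2 : ‖(u n : SobolevPair Ω p)‖ ≤ R := hR n
    have h3 := norm_sub_norm_le (w n) (u n : SobolevPair Ω p)
    rw [norm_sub_rev] at h3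
    linarith [hwu n]
  have hvR1 : ∀ n, ‖(w n).1‖ₑ ≤ ENNReal.ofReal (R + 1) := fun n => by
    rw [← ofReal_norm]
    exact ENNReal.ofReal_le_ofReal ((norm_fst_le _).trans (hvR n))
  have hvR2 : ∀ n, ‖(w n).2‖ₑ ≤ ENNReal.ofReal (R + 1) := fun n => by
    rw [← ofReal_norm]
    exact ENNReal.ofReal_le_ofReal ((norm_snd_le _).trans (hvR n))
  have hlim : Tendsto (fun n => ∫⁻ x in Ω, ‖φ n x‖ₑ) atTop (𝓝 0) := by
    refine tendsto_setLIntegral_of_tendsto_ball (fun n => (hφ n).smooth)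
      (C := c * ENNReal.ofReal (R + 1)) (D := c * ENNReal.ofReal (R + 1))
      (ENNReal.mul_ne_top hc ENNReal.ofReal_ne_top) (ENNReal.mul_ne_top hc ENNReal.ofReal_ne_top)
      (fun n => ?_) (fun n => ?_) (fun x r hr => ?_) hΩf
    · have h1 : ∫⁻ x, ‖fderiv ℝ (φ n) x‖ₑ = ∫⁻ x in Ω, ‖fderiv ℝ (φ n) x‖ₑ := by
        refine (setLIntegral_eq_of_support_subset ?_).symm
        intro x hx
        exact (hφ n).supp (support_fderiv_subset ℝ fun h => hx (by
          simp only [← ofReal_norm, h, norm_zero, ENNReal.ofReal_zero]))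
      have h2 : ∫⁻ x in Ω, ‖fderiv ℝ (φ n) x‖ₑ = ∫⁻ x in Ω, ‖(w n).2 x‖ₑ := by
        refine lintegral_congr_ae ?_
        filter_upwards [hφ2 n] with x hx
        rw [hx, gradient, LinearIsometryEquiv.enorm_map]
      rw [h1, h2]
      exact (hcle _ _).trans (by gcongr; exact hvR2 n)
    · have h1 : ∫⁻ x, ‖φ n x‖ₑ = ∫⁻ x in Ω, ‖φ n x‖ₑ := by
        refine (setLIntegral_eq_of_support_subset ?_).symm
        intro x hx
        exact (hφ n).supp (subset_tsupport _ fun h => hx (by simp [h]))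
      have h2 : ∫⁻ x in Ω, ‖φ n x‖ₑ = ∫⁻ x in Ω, ‖(w n).1 x‖ₑ := by
        refine lintegral_congr_ae ?_
        filter_upwards [hφ1 n] with x hx
        rw [hx]
      rw [h1, h2]
      exact (hcle _ _).trans (by gcongr; exact hvR1 n)
    -- Integration over a ball is the bounded functional represented by the indicator of the ball,
    -- so weak convergence gives the hypothesis on ball integrals.
    · have hmB : MeasurableSet (Metric.ball x r) := Metric.isOpen_ball.measurableSet
      obtain ⟨ℓ, hℓ⟩ := exists_dual_val (p := p) (Ω := Ω)
        (g := (Metric.ball x r).indicator fun _ => (1 : ℝ)) ((memLp_const 1).indicator hmB)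
      have h1 : ∀ n, ∫ y in Metric.ball x r, φ n y = ℓ (v n) := by
        intro n
        rw [hℓ, ← integral_indicator hmB]
        have h0 : ∀ y ∉ Ω, (Metric.ball x r).indicator (φ n) y = 0 := by
          intro y hy
          rw [Set.indicator_apply, image_eq_zero_of_notMem_tsupport fun h => hy ((hφ n).supp h),
            ite_self]
        rw [← setIntegral_eq_integral_of_forall_compl_eq_zero h0]
        refine integral_congr_ae ?_
        filter_upwards [hφ1 n] with y hy
        change _ = (w n).1 y * _
        rw [hy]
        by_cases hyB : y ∈ Metric.ball x r <;> simp [Set.indicator, hyB]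
      simp only [h1]
      have h2 : Tendsto (fun n => ℓ (u n - v n)) atTop (𝓝 0) := by
        have := (ℓ.continuous.tendsto 0).comp (tendsto_zero_iff_norm_tendsto_zero.2 hdiff)
        simpa [Function.comp_def] using this
      have h3 := (hu ℓ).sub h2
      simpa using h3
  have hdiff' : Tendsto (fun n => c * ‖u n - v n‖ₑ) atTop (𝓝 0) := by
    have h1 : Tendsto (fun n => ‖u n - v n‖ₑ) atTop (𝓝 0) := by
      have := ENNReal.tendsto_ofReal hdiff
      simp only [ofReal_norm, ENNReal.ofReal_zero] at this
      exact this
    simpa using ENNReal.Tendsto.const_mul h1 (Or.inr hc)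
  have hsum := hlim.add hdiff'
  rw [add_zero] at hsum
  refine tendsto_of_tendsto_of_tendsto_of_le_of_le tendsto_const_nhds hsum
    (fun n => bot_le) fun n => ?_
  calc ∫⁻ x in Ω, ‖(u n).val x‖ₑ
      ≤ ∫⁻ x in Ω, (‖φ n x‖ₑ + ‖(u n - v n).val x‖ₑ) := by
        refine lintegral_mono_ae ?_
        filter_upwards [hφ1 n, val_sub (u n) (v n)] with x h1 h2
        have h3 : (v n).val x = φ n x := h1
        rw [h2, h3]
        conv_lhs => rw [← add_sub_cancel (φ n x) ((u n).val x)]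
        exact enorm_add_le _ _
    _ = (∫⁻ x in Ω, ‖φ n x‖ₑ) + ∫⁻ x in Ω, ‖(u n - v n).val x‖ₑ :=
        lintegral_add_left (hφ n).smooth.continuous.enorm.measurable _
    _ ≤ _ := by
        refine add_le_add le_rfl ((hcle ℝ (u n - v n : W01 Ω p).1.1).trans ?_)
        gcongr
        rw [enorm_le_iff_norm_le]
        exact norm_fst_le (u n - v n : W01 Ω p).1

/-- Weakly convergent sequences in `W_0^{1,p}(Ω)` have subsequences that converge almost
everywhere. -/
theorem exists_subseq_tendsto_ae_of_weak
    (hΩf : volume Ω ≠ (∞ : ℝ≥0∞)) {u : ℕ → W01 Ω p} {u₀ : W01 Ω p} {R : ℝ}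
    (hR : ∀ n, ‖u n‖ ≤ R)
    (hu : ∀ ℓ : StrongDual ℝ (W01 Ω p), Tendsto (fun n => ℓ (u n)) atTop (𝓝 (ℓ u₀))) :
    ∃ φ : ℕ → ℕ, StrictMono φ ∧
      ∀ᵐ x ∂(volOn Ω), Tendsto (fun n => (u (φ n)).val x) atTop (𝓝 (u₀.val x)) := by
  have h1 := tendsto_lintegral_enorm_of_tendsto_weak_zero hΩf (u := fun n => u n - u₀)
    (R := R + ‖u₀‖) (fun n => (norm_sub_le _ _).trans (by gcongr; exact hR n)) fun ℓ => by
      simpa using (hu ℓ).sub_const (ℓ u₀)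
  have h2 : Tendsto (fun n => eLpNorm ((u n).val - u₀.val) 1 (volOn Ω)) atTop (𝓝 0) := by
    refine h1.congr fun n => ?_
    rw [eLpNorm_one_eq_lintegral_enorm]
    refine lintegral_congr_ae ?_
    filter_upwards [val_sub (u n) u₀] with x hx
    rw [hx, Pi.sub_apply]
  exact (tendstoInMeasure_of_tendsto_eLpNorm one_ne_zero
    (fun n => (memLp_val (u n)).aestronglyMeasurable)
    (memLp_val u₀).aestronglyMeasurable h2).exists_seq_tendsto_ae

end W01

/-! ### Young inequalities -/

section Young

/-- Young's inequality with a small factor. -/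
theorem exists_rpow_sub_one_mul_le {p : ℝ} (hp : 1 < p) {η : ℝ} (hη : 0 < η) :
    ∃ C : ℝ, 0 ≤ C ∧ ∀ s t : ℝ, 0 ≤ s → 0 ≤ t → s ^ (p - 1) * t ≤ η * s ^ p + C * t ^ p := by
  have hpow : ∀ s : ℝ, 0 ≤ s → s ^ (p - 1) * s = s ^ p := fun s hs => by
    have := Real.rpow_add_one' hs (y := p - 1) (by linarith)
    rw [← this, sub_add_cancel]
  refine ⟨(1 / η) ^ (p - 1), by positivity, fun s t hs ht => ?_⟩
  have hsp : 0 ≤ s ^ p := by positivity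
  have htp : 0 ≤ t ^ p := by positivity
  -- If t ≤ ηs the first term alone is large enough; otherwise s ≤ t/η and the second one is.
  rcases le_total t (η * s) with h | h
  · calc s ^ (p - 1) * t ≤ s ^ (p - 1) * (η * s) := by gcongr
      _ = η * s ^ p := by rw [← hpow s hs]; ring
      _ ≤ _ := le_add_of_nonneg_right (by positivity)
  · have h1 : s ≤ 1 / η * t := by
      rw [one_div, inv_mul_eq_div, le_div_iff₀ hη]
      linarith
    have hp1 : 0 ≤ p - 1 := by linarith
    calc s ^ (p - 1) * t ≤ (1 / η * t) ^ (p - 1) * t := by gcongr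
      _ = (1 / η) ^ (p - 1) * t ^ p := by
        rw [Real.mul_rpow (by positivity) ht, mul_assoc, hpow t ht]
      _ ≤ _ := le_add_of_nonneg_left (by positivity)

/-- The same dichotomy, now between s and ηt^{p-1}. The small factor goes to the p-th power and the
conjugate power falls on s, which will be a datum in L^{p'}. -/
theorem exists_mul_le_rpow_add_rpow {p : ℝ} (hp : 1 < p) {η : ℝ} (hη : 0 < η) :
    ∃ C : ℝ, 0 ≤ C ∧ ∀ s t : ℝ, 0 ≤ s → 0 ≤ t → s * t ≤ η * t ^ p + C * s ^ (p / (p - 1)) := by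
  have hp1 : 0 < p - 1 := by linarith
  refine ⟨(1 / η) ^ (1 / (p - 1)), by positivity, fun s t hs ht => ?_⟩
  have hsp : 0 ≤ s ^ (p / (p - 1)) := by positivity
  have htp : 0 ≤ t ^ p := by positivity
  rcases le_total s (η * t ^ (p - 1)) with h | h
  · have hpow : t ^ (p - 1) * t = t ^ p := by
      have := Real.rpow_add_one' ht (y := p - 1) (by linarith)
      rw [← this, sub_add_cancel]
    calc s * t ≤ η * t ^ (p - 1) * t := by gcongr
      _ = η * t ^ p := by rw [mul_assoc, hpow]
      _ ≤ _ := le_add_of_nonneg_right (by positivity)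
  · have h1 : t ^ (p - 1) ≤ 1 / η * s := by
      rw [one_div, inv_mul_eq_div, le_div_iff₀ hη]
      linarith
    have h2 : t ≤ (1 / η * s) ^ (1 / (p - 1)) := by
      calc t = (t ^ (p - 1)) ^ (1 / (p - 1)) := by
            rw [← Real.rpow_mul ht, mul_one_div_cancel hp1.ne', Real.rpow_one]
        _ ≤ _ := by gcongr
    calc s * t ≤ s * (1 / η * s) ^ (1 / (p - 1)) := by gcongr
      _ = (1 / η) ^ (1 / (p - 1)) * (s ^ (1 / (p - 1)) * s) := by
        rw [Real.mul_rpow (by positivity) hs]; ring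
      _ = (1 / η) ^ (1 / (p - 1)) * s ^ (p / (p - 1)) := by
        have : 1 / (p - 1) + 1 = p / (p - 1) := by field_simp; ring
        rw [← this, Real.rpow_add_one' hs (by positivity)]
      _ ≤ _ := le_add_of_nonneg_left (by positivity)

end Young

/-- The structural assumptions on the data of the variational inequality. -/
structure VIData {N : ℕ} (Ω : Set (EuclideanSpace ℝ (Fin N))) (p α β α₀ : ℝ)
    (h : EuclideanSpace ℝ (Fin N) → ℝ)
    (a : EuclideanSpace ℝ (Fin N) → ℝ → EuclideanSpace ℝ (Fin N) → EuclideanSpace ℝ (Fin N))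
    (a₀ : EuclideanSpace ℝ (Fin N) → ℝ → ℝ) (f : EuclideanSpace ℝ (Fin N) → ℝ) (b : ℝ → ℝ)
    (H : EuclideanSpace ℝ (Fin N) → ℝ → EuclideanSpace ℝ (Fin N) → ℝ) : Prop where
  volume_ne_top : volume Ω ≠ (∞ : ℝ≥0∞)
  α_pos : 0 < α
  β_pos : 0 < β
  α₀_pos : 0 < α₀
  h_memLp : MemLp h (ENNReal.ofReal (p / (p - 1))) (volOn Ω)
  a_car : IsCaratheodory Ω (fun x (q : ℝ × EuclideanSpace ℝ (Fin N)) => a x q.1 q.2)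
  a_coercive : ∀ᵐ x ∂(volOn Ω), ∀ (s : ℝ) (ξ : EuclideanSpace ℝ (Fin N)),
    α * ‖ξ‖ ^ p ≤ inner ℝ (a x s ξ) ξ
  a_growth : ∀ᵐ x ∂(volOn Ω), ∀ (s : ℝ) (ξ : EuclideanSpace ℝ (Fin N)),
    ‖a x s ξ‖ ≤ β * (h x + |s| ^ (p - 1) + ‖ξ‖ ^ (p - 1))
  a_monotone : ∀ᵐ x ∂(volOn Ω), ∀ (s : ℝ) (ξ η : EuclideanSpace ℝ (Fin N)), ξ ≠ η →
    0 < inner ℝ (a x s ξ - a x s η) (ξ - η)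
  a₀_car : IsCaratheodory Ω a₀
  a₀_growth : ∀ᵐ x ∂(volOn Ω), ∀ s : ℝ, |a₀ x s| ≤ β * (h x + |s| ^ (p - 1))
  a₀_coercive : ∀ᵐ x ∂(volOn Ω), ∀ s : ℝ, α₀ * |s| ^ p ≤ a₀ x s * s
  f_memLp : MemLp f (∞ : ℝ≥0∞) (volOn Ω)
  f_nonneg : ∀ᵐ x ∂(volOn Ω), 0 ≤ f x
  b_nonneg : ∀ t, 0 ≤ t → 0 ≤ b t
  b_mono : MonotoneOn b (Set.Ici 0)
  H_car : IsCaratheodory Ω (fun x (q : ℝ × EuclideanSpace ℝ (Fin N)) => H x q.1 q.2)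
  H_growth : ∀ᵐ x ∂(volOn Ω), ∀ (s : ℝ) (ξ : EuclideanSpace ℝ (Fin N)),
    |H x s ξ| ≤ f x + b |s| * ‖ξ‖ ^ p

theorem MeasureTheory.MemLp.exists_ae_bound {α : Type*} {m : MeasurableSpace α} {μ : Measure α}
    {f : α → ℝ} (hf : MemLp f (∞ : ℝ≥0∞) μ) : ∃ C, 0 ≤ C ∧ ∀ᵐ x ∂μ, |f x| ≤ C := by
  refine ⟨(eLpNorm f (∞ : ℝ≥0∞) μ).toReal, ENNReal.toReal_nonneg, ?_⟩
  have h1 : ∀ᵐ x ∂μ, ‖f x‖ₑ ≤ eLpNorm f (∞ : ℝ≥0∞) μ := by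
    rw [eLpNorm_exponent_top]
    exact ae_le_eLpNormEssSup
  filter_upwards [h1] with x hx
  have := ENNReal.toReal_mono hf.eLpNorm_ne_top hx
  simpa using this

/-! ### Integrability of the three terms and admissible test directions -/

namespace VIData

variable {N : ℕ} {Ω : Set (EuclideanSpace ℝ (Fin N))} {p : ℝ} [hp : Fact (1 < p)] {α β α₀ : ℝ}
  {h : EuclideanSpace ℝ (Fin N) → ℝ}
  {a : EuclideanSpace ℝ (Fin N) → ℝ → EuclideanSpace ℝ (Fin N) → EuclideanSpace ℝ (Fin N)}
  {a₀ : EuclideanSpace ℝ (Fin N) → ℝ → ℝ} {f : EuclideanSpace ℝ (Fin N) → ℝ} {b : ℝ → ℝ}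
  {H : EuclideanSpace ℝ (Fin N) → ℝ → EuclideanSpace ℝ (Fin N) → ℝ}

omit hp in
theorem isFiniteMeasure (D : VIData Ω p α β α₀ h a a₀ f b H) : IsFiniteMeasure (volOn Ω) :=
  ⟨by simpa [volOn] using D.volume_ne_top.lt_top⟩

omit hp in
theorem aestronglyMeasurable_a (D : VIData Ω p α β α₀ h a a₀ f b H)
    {U : EuclideanSpace ℝ (Fin N) → ℝ} {V : EuclideanSpace ℝ (Fin N) → EuclideanSpace ℝ (Fin N)}
    (hU : AEStronglyMeasurable U (volOn Ω)) (hV : AEStronglyMeasurable V (volOn Ω)) :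
    AEStronglyMeasurable (fun x => a x (U x) (V x)) (volOn Ω) :=
  (aemeasurable_caratheodory_comp D.a_car.measurable D.a_car.continuous
    (hU.aemeasurable.prodMk hV.aemeasurable)).aestronglyMeasurable

omit hp in
theorem aestronglyMeasurable_a₀ (D : VIData Ω p α β α₀ h a a₀ f b H)
    {U : EuclideanSpace ℝ (Fin N) → ℝ} (hU : AEStronglyMeasurable U (volOn Ω)) :
    AEStronglyMeasurable (fun x => a₀ x (U x)) (volOn Ω) :=
  (aemeasurable_caratheodory_comp D.a₀_car.measurable D.a₀_car.continuous
    hU.aemeasurable).aestronglyMeasurable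

omit hp in
theorem aestronglyMeasurable_H (D : VIData Ω p α β α₀ h a a₀ f b H)
    {U : EuclideanSpace ℝ (Fin N) → ℝ} {V : EuclideanSpace ℝ (Fin N) → EuclideanSpace ℝ (Fin N)}
    (hU : AEStronglyMeasurable U (volOn Ω)) (hV : AEStronglyMeasurable V (volOn Ω)) :
    AEStronglyMeasurable (fun x => H x (U x) (V x)) (volOn Ω) :=
  (aemeasurable_caratheodory_comp D.H_car.measurable D.H_car.continuous
    (hU.aemeasurable.prodMk hV.aemeasurable)).aestronglyMeasurable

theorem memLp_norm_rpow_sub_one {E : Type*} [NormedAddCommGroup E]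
    {V : EuclideanSpace ℝ (Fin N) → E} (hV : MemLp V (ENNReal.ofReal p) (volOn Ω)) :
    MemLp (fun x => ‖V x‖ ^ (p - 1)) (ENNReal.ofReal (p / (p - 1))) (volOn Ω) := by
  have hp1 : 0 < p - 1 := sub_pos.2 hp.out
  have := hV.norm_rpow_div (ENNReal.ofReal (p - 1))
  rwa [ENNReal.toReal_ofReal hp1.le, ← ENNReal.ofReal_div_of_pos hp1] at this

/-- The growth bound of `a`, as a function in `L^{p'}`. -/
theorem memLp_growth (D : VIData Ω p α β α₀ h a a₀ f b H)
    {E E' : Type*} [NormedAddCommGroup E] [NormedAddCommGroup E']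
    {U : EuclideanSpace ℝ (Fin N) → E} {V : EuclideanSpace ℝ (Fin N) → E'}
    (hU : MemLp U (ENNReal.ofReal p) (volOn Ω)) (hV : MemLp V (ENNReal.ofReal p) (volOn Ω)) :
    MemLp (fun x => β * (|h x| + ‖U x‖ ^ (p - 1) + ‖V x‖ ^ (p - 1)))
      (ENNReal.ofReal (p / (p - 1))) (volOn Ω) :=
  ((D.h_memLp.norm.add (memLp_norm_rpow_sub_one hU)).add
    (memLp_norm_rpow_sub_one hV)).const_mul β

omit hp in
theorem norm_a_le (D : VIData Ω p α β α₀ h a a₀ f b H) :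
    ∀ᵐ x ∂(volOn Ω), ∀ (s : ℝ) (ξ : EuclideanSpace ℝ (Fin N)),
      ‖a x s ξ‖ ≤ β * (|h x| + ‖s‖ ^ (p - 1) + ‖ξ‖ ^ (p - 1)) := by
  have := D.β_pos
  filter_upwards [D.a_growth] with x hx s ξ
  refine (hx s ξ).trans ?_
  rw [Real.norm_eq_abs]
  gcongr
  exact le_abs_self _

theorem memLp_a (D : VIData Ω p α β α₀ h a a₀ f b H)
    {U : EuclideanSpace ℝ (Fin N) → ℝ} {V : EuclideanSpace ℝ (Fin N) → EuclideanSpace ℝ (Fin N)}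
    (hU : MemLp U (ENNReal.ofReal p) (volOn Ω)) (hV : MemLp V (ENNReal.ofReal p) (volOn Ω)) :
    MemLp (fun x => a x (U x) (V x)) (ENNReal.ofReal (p / (p - 1))) (volOn Ω) := by
  refine (D.memLp_growth hU hV).mono (D.aestronglyMeasurable_a hU.1 hV.1) ?_
  filter_upwards [D.norm_a_le] with x hx
  exact (hx _ _).trans (Real.le_norm_self _)

theorem memLp_a₀ (D : VIData Ω p α β α₀ h a a₀ f b H)
    {U : EuclideanSpace ℝ (Fin N) → ℝ} (hU : MemLp U (ENNReal.ofReal p) (volOn Ω)) :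
    MemLp (fun x => a₀ x (U x)) (ENNReal.ofReal (p / (p - 1))) (volOn Ω) := by
  have := D.β_pos
  refine (D.memLp_growth hU hU).mono (D.aestronglyMeasurable_a₀ hU.1) ?_
  filter_upwards [D.a₀_growth] with x hx
  refine ((hx (U x)).trans ?_).trans (Real.le_norm_self _)
  have h1 : 0 ≤ |U x| ^ (p - 1) := by positivity
  simp only [Real.norm_eq_abs]
  gcongr
  linarith [le_abs_self (h x)]

theorem integrable_inner {F Z : EuclideanSpace ℝ (Fin N) → EuclideanSpace ℝ (Fin N)}
    (hF : MemLp F (ENNReal.ofReal (p / (p - 1))) (volOn Ω))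
    (hZ : MemLp Z (ENNReal.ofReal p) (volOn Ω)) :
    Integrable (fun x => inner ℝ (F x) (Z x)) (volOn Ω) := by
  have hpq : Real.HolderConjugate p (p / (p - 1)) := Real.HolderConjugate.conjExponent hp.out
  have : ENNReal.HolderConjugate (ENNReal.ofReal p) (ENNReal.ofReal (p / (p - 1))) :=
    hpq.ennrealOfReal
  have h1 : Integrable (fun x => ‖Z x‖ * ‖F x‖) (volOn Ω) := hZ.norm.integrable_mul hF.norm
  refine h1.mono (hF.1.inner hZ.1) (Eventually.of_forall fun x => ?_)
  refine (norm_inner_le_norm _ _).trans ?_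
  rw [mul_comm]
  exact Real.le_norm_self _

theorem integrable_mul {F Z : EuclideanSpace ℝ (Fin N) → ℝ}
    (hF : MemLp F (ENNReal.ofReal (p / (p - 1))) (volOn Ω))
    (hZ : MemLp Z (ENNReal.ofReal p) (volOn Ω)) :
    Integrable (fun x => F x * Z x) (volOn Ω) := by
  have hpq : Real.HolderConjugate p (p / (p - 1)) := Real.HolderConjugate.conjExponent hp.out
  have : ENNReal.HolderConjugate (ENNReal.ofReal p) (ENNReal.ofReal (p / (p - 1))) :=
    hpq.ennrealOfReal
  have h1 : Integrable (fun x => Z x * F x) (volOn Ω) := hZ.integrable_mul hF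
  simpa only [mul_comm] using h1

omit hp in
theorem abs_H_le (D : VIData Ω p α β α₀ h a a₀ f b H) (R : ℝ) :
    ∀ᵐ x ∂(volOn Ω), ∀ (s : ℝ) (ξ : EuclideanSpace ℝ (Fin N)), |s| ≤ R →
      |H x s ξ| ≤ f x + b R * ‖ξ‖ ^ p := by
  filter_upwards [D.H_growth] with x hx s ξ hs
  refine (hx s ξ).trans ?_
  have := D.b_mono (Set.mem_Ici.2 (abs_nonneg s)) (Set.mem_Ici.2 ((abs_nonneg s).trans hs)) hs
  gcongr

omit hp in
theorem integrable_f (D : VIData Ω p α β α₀ h a a₀ f b H) : Integrable f (volOn Ω) := by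
  have := D.isFiniteMeasure
  exact D.f_memLp.integrable le_top

theorem integrable_H_mul (D : VIData Ω p α β α₀ h a a₀ f b H)
    {U Z : EuclideanSpace ℝ (Fin N) → ℝ} {V : EuclideanSpace ℝ (Fin N) → EuclideanSpace ℝ (Fin N)}
    (hU : AEStronglyMeasurable U (volOn Ω)) (hV : MemLp V (ENNReal.ofReal p) (volOn Ω))
    (hZ : AEStronglyMeasurable Z (volOn Ω)) {R S : ℝ} (hR : ∀ᵐ x ∂(volOn Ω), |U x| ≤ R)
    (hS : ∀ᵐ x ∂(volOn Ω), |Z x| ≤ S) :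
    Integrable (fun x => H x (U x) (V x) * Z x) (volOn Ω) := by
  have h1 : Integrable (fun x => (f x + b R * ‖V x‖ ^ p) * S) (volOn Ω) :=
    (D.integrable_f.add (hV.integrable_norm_rpow_ofReal.const_mul _)).mul_const S
  refine h1.mono' ((D.aestronglyMeasurable_H hU hV.1).mul hZ) ?_
  filter_upwards [D.abs_H_le R, hR, hS] with x e1 e2 e3
  rw [norm_mul, Real.norm_eq_abs, Real.norm_eq_abs]
  have h2 := e1 _ (V x) e2
  exact mul_le_mul h2 e3 (abs_nonneg _) ((abs_nonneg _).trans h2)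

/-- The variational inequality, tested with a direction `-z` that is admissible after scaling. -/
theorem test_le_zero {ψ u z : W01 Ω p} (hu : IsVISolution a a₀ H ψ u)
    (hz : MemLp z.val (∞ : ℝ≥0∞) (volOn Ω)) {ε : ℝ} (hε : 0 < ε)
    (hmem : ∀ᵐ x ∂(volOn Ω), ψ.val x ≤ u.val x - ε * z.val x) :
    lerayLionsPairing a u z + (∫ x in Ω, a₀ x (u.val x) * z.val x)
      + ∫ x in Ω, H x (u.val x) (u.grad x) * z.val x ≤ 0 := by
  have hv : ∀ᵐ x ∂(volOn Ω), (u - ε • z).val x = u.val x - ε * z.val x := by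
    filter_upwards [W01.val_sub u (ε • z), W01.val_smul ε z] with x h1 h2
    rw [h1, h2]
  have hd : ∀ᵐ x ∂(volOn Ω), (u - ε • z).val x - u.val x = -ε * z.val x := by
    filter_upwards [hv] with x h1
    rw [h1]; ring
  have hg : ∀ᵐ x ∂(volOn Ω), (u - ε • z - u).grad x = (-ε) • z.grad x := by
    have e : u - ε • z - u = (-ε) • z := by module
    rw [e]
    exact W01.grad_smul _ z
  have hineq := hu.inequality (u - ε • z)
    (by filter_upwards [hv, hmem] with x h1 h2; rwa [h1])
    ((hu.bounded.sub (hz.const_mul ε)).ae_eq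
      (by filter_upwards [hv] with x h1; rw [h1]; rfl))
  have i1 : lerayLionsPairing a u (u - ε • z - u) = -ε * lerayLionsPairing a u z := by
    rw [lerayLionsPairing, lerayLionsPairing, ← integral_const_mul]
    refine integral_congr_ae ?_
    filter_upwards [hg] with x h1
    rw [h1, inner_smul_right]
  have i2 : ∫ x in Ω, a₀ x (u.val x) * ((u - ε • z).val x - u.val x)
      = -ε * ∫ x in Ω, a₀ x (u.val x) * z.val x := by
    rw [← integral_const_mul]
    refine integral_congr_ae ?_
    filter_upwards [hd] with x h1
    rw [h1]; ring
  have i3 : ∫ x in Ω, H x (u.val x) (u.grad x) * ((u - ε • z).val x - u.val x)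
      = -ε * ∫ x in Ω, H x (u.val x) (u.grad x) * z.val x := by
    rw [← integral_const_mul]
    refine integral_congr_ae ?_
    filter_upwards [hd] with x h1
    rw [h1]; ring
  -- All three terms are linear in the direction, so the factor -ε divides out. A test function
  -- therefore needs to be admissible only after multiplication by some positive constant.
  rw [i1, i2, i3, ← mul_add, ← mul_add] at hineq
  by_contra hcon
  have := mul_pos hε (not_le.1 hcon)
  linarith

/-- The previous inequality with a single integral. -/
theorem integral_test_le_zero (D : VIData Ω p α β α₀ h a a₀ f b H) {ψ u z : W01 Ω p}
    (hu : IsVISolution a a₀ H ψ u) (hz : MemLp z.val (∞ : ℝ≥0∞) (volOn Ω)) {ε : ℝ} (hε : 0 < ε)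
    (hmem : ∀ᵐ x ∂(volOn Ω), ψ.val x ≤ u.val x - ε * z.val x) :
    Integrable (fun x => inner ℝ (a x (u.val x) (u.grad x)) (z.grad x)
      + a₀ x (u.val x) * z.val x + H x (u.val x) (u.grad x) * z.val x) (volOn Ω) ∧
    ∫ x in Ω, (inner ℝ (a x (u.val x) (u.grad x)) (z.grad x)
      + a₀ x (u.val x) * z.val x + H x (u.val x) (u.grad x) * z.val x) ≤ 0 := by
  obtain ⟨R, -, hR⟩ := hu.bounded.exists_ae_bound
  obtain ⟨S, -, hS⟩ := hz.exists_ae_bound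
  have j1 := integrable_inner (D.memLp_a (W01.memLp_val u) (W01.memLp_grad u)) (W01.memLp_grad z)
  have j2 := integrable_mul (D.memLp_a₀ (W01.memLp_val u)) (W01.memLp_val z)
  have j3 := D.integrable_H_mul (W01.memLp_val u).1 (W01.memLp_grad u) (W01.memLp_val z).1 hR hS
  refine ⟨(j1.add j2).add j3, ?_⟩
  have := test_le_zero hu hz hε hmem
  have e1 := integral_add (j1.add j2) j3
  have e2 := integral_add j1 j2
  simp only [Pi.add_apply] at e1
  rw [e1, e2]
  exact this

end VIData

/-! ### Exponential test functions -/

/-- Equivalent to 1/t ≤ exp(1/t). It keeps a solution, lowered by a multiple of the test function,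
above the level K and hence above the obstacle. -/
theorem expNegInvGlue_le_self {t : ℝ} (ht : 0 < t) : expNegInvGlue t ≤ t := by
  rw [expNegInvGlue, if_neg (not_le.2 ht), Real.exp_neg]
  refine inv_le_of_inv_le₀ ht ?_
  linarith [Real.add_one_le_exp t⁻¹]

/-- The function `s ↦ s exp(λ s²)`. -/
noncomputable def expTest (l s : ℝ) : ℝ := s * Real.exp (l * s ^ 2)

/-- The derivative of `expTest`. -/
noncomputable def expTestDeriv (l s : ℝ) : ℝ := (1 + 2 * l * s ^ 2) * Real.exp (l * s ^ 2)

theorem contDiff_expTest (l : ℝ) : ContDiff ℝ ∞ (expTest l) := by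
  unfold expTest
  fun_prop

theorem continuous_expTestDeriv (l : ℝ) : Continuous (expTestDeriv l) := by
  unfold expTestDeriv
  fun_prop

theorem expTest_zero (l : ℝ) : expTest l 0 = 0 := by simp [expTest]

theorem expTestDeriv_zero (l : ℝ) : expTestDeriv l 0 = 1 := by simp [expTestDeriv]

theorem deriv_expTest (l s : ℝ) : deriv (expTest l) s = expTestDeriv l s := by
  have h1 : HasDerivAt (fun s : ℝ => l * s ^ 2) (l * (2 * s)) s := by
    simpa using (hasDerivAt_pow 2 s).const_mul l
  have h2 := (hasDerivAt_id s).mul h1.exp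
  have h3 : HasDerivAt (expTest l)
      (1 * Real.exp (l * s ^ 2) + s * (Real.exp (l * s ^ 2) * (l * (2 * s)))) s := h2
  rw [h3.deriv, expTestDeriv]
  ring

theorem abs_expTest (l s : ℝ) : |expTest l s| = |s| * Real.exp (l * s ^ 2) := by
  rw [expTest, abs_mul, Real.abs_exp]

theorem abs_expTest_le {l : ℝ} (hl : 0 ≤ l) {s S : ℝ} (hs : |s| ≤ S) :
    |expTest l s| ≤ expTest l S := by
  have : s ^ 2 ≤ S ^ 2 := sq_le_sq' (by linarith [neg_abs_le s]) ((le_abs_self s).trans hs)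
  rw [abs_expTest, expTest]
  gcongr
  exact (abs_nonneg s).trans hs

theorem expTestDeriv_nonneg {l : ℝ} (hl : 0 ≤ l) (s : ℝ) : 0 ≤ expTestDeriv l s := by
  unfold expTestDeriv
  positivity

theorem expTestDeriv_le {l : ℝ} (hl : 0 ≤ l) {s S : ℝ} (hs : |s| ≤ S) :
    expTestDeriv l s ≤ expTestDeriv l S := by
  have : s ^ 2 ≤ S ^ 2 := sq_le_sq' (by linarith [neg_abs_le s]) ((le_abs_self s).trans hs)
  unfold expTestDeriv
  gcongr

/-- With y = κ|s| the difference is (1 + 2y² - y)exp(y²), and 2y² - y + 1/2 > 0. For κ = b(K)/α it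
is the coefficient of a·Du that survives after the gradient part of `H` has been absorbed. -/
theorem half_le_expTestDeriv_sub (κ s : ℝ) :
    1 / 2 ≤ expTestDeriv (κ ^ 2) s - κ * |expTest (κ ^ 2) s| := by
  rw [abs_expTest, expTestDeriv]
  have h1 : 1 ≤ Real.exp (κ ^ 2 * s ^ 2) := Real.one_le_exp (by positivity)
  have h2 : 1 / 2 ≤ 1 + 2 * κ ^ 2 * s ^ 2 - κ * |s| := by
    have : (κ * |s|) ^ 2 = κ ^ 2 * s ^ 2 := by rw [mul_pow, sq_abs]
    nlinarith [sq_nonneg (κ * |s| - 1)]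
  nlinarith

/-! ### The uniform sup bound and the exponential comparison test -/

namespace VIData

variable {N : ℕ} {Ω : Set (EuclideanSpace ℝ (Fin N))} {p : ℝ} [hp : Fact (1 < p)] {α β α₀ : ℝ}
  {h : EuclideanSpace ℝ (Fin N) → ℝ}
  {a : EuclideanSpace ℝ (Fin N) → ℝ → EuclideanSpace ℝ (Fin N) → EuclideanSpace ℝ (Fin N)}
  {a₀ : EuclideanSpace ℝ (Fin N) → ℝ → ℝ} {f : EuclideanSpace ℝ (Fin N) → ℝ} {b : ℝ → ℝ}
  {H : EuclideanSpace ℝ (Fin N) → ℝ → EuclideanSpace ℝ (Fin N) → ℝ}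

/-- An upper bound for solutions in terms of bounds for the obstacle and the data. -/
theorem val_le_of_isVISolution (D : VIData Ω p α β α₀ h a a₀ f b H) {M F K : ℝ} (hK0 : 0 < K)
    (hMK : M ≤ K) (hF : ∀ᵐ x ∂(volOn Ω), |f x| ≤ F) (hFK : F < α₀ * K ^ (p - 1))
    {ψ u : W01 Ω p} (hu : IsVISolution a a₀ H ψ u) (hψ : ∀ᵐ x ∂(volOn Ω), |ψ.val x| ≤ M) :
    ∀ᵐ x ∂(volOn Ω), u.val x ≤ K := by
  obtain ⟨R, hR0, hR⟩ := hu.bounded.exists_ae_bound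
  have hbR : 0 ≤ b R := D.b_nonneg R hR0
  have hα := D.α_pos
  have hα₀ := D.α₀_pos
  have hp0 : 0 < p := zero_lt_one.trans hp.out
  -- `R` is the unquantified bound of u itself; it influences only this rate, not the level `K`. The
  -- rate is chosen so that Φ' ≥ lΦ gives Φ' α|Du|^p ≥ b(R)|Du|^p Φ.
  set l := b R / α with hl
  have hl0 : 0 ≤ l := by positivity
  let Φ : ℝ → ℝ := fun t => Real.exp (l * t) * expNegInvGlue (t - K)
  have hg : ContDiff ℝ ∞ fun t : ℝ => expNegInvGlue (t - K) :=
    expNegInvGlue.contDiff.comp (contDiff_id.sub contDiff_const)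
  have hΦ : ContDiff ℝ ∞ Φ := (by fun_prop : ContDiff ℝ ∞ fun t => Real.exp (l * t)).mul hg
  have hΦ0 : ∀ t ≤ K, Φ t = 0 := fun t ht => by
    simp only [Φ]
    rw [expNegInvGlue.zero_of_nonpos (sub_nonpos.2 ht), mul_zero]
  have hΦpos : ∀ t, K < t → 0 < Φ t := fun t ht =>
    mul_pos (Real.exp_pos _) (expNegInvGlue.pos_of_pos (sub_pos.2 ht))
  have hΦnn : ∀ t, 0 ≤ Φ t := fun t => mul_nonneg (Real.exp_pos _).le (expNegInvGlue.nonneg _)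
  have hΦ' : ∀ t, l * Φ t ≤ deriv Φ t := by
    intro t
    have hmono : Monotone fun t : ℝ => expNegInvGlue (t - K) :=
      fun x y hxy => expNegInvGlue.monotone (sub_le_sub_right hxy K)
    have d1 : HasDerivAt (fun t => expNegInvGlue (t - K))
        (deriv (fun t => expNegInvGlue (t - K)) t) t :=
      (hg.differentiable (by simp)).differentiableAt.hasDerivAt
    have d2 : HasDerivAt (fun t : ℝ => Real.exp (l * t)) (Real.exp (l * t) * l) t := by
      simpa using ((hasDerivAt_id t).const_mul l).exp
    have d3 : HasDerivAt Φ (Real.exp (l * t) * l * expNegInvGlue (t - K) +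
        Real.exp (l * t) * deriv (fun t => expNegInvGlue (t - K)) t) t := d2.mul d1
    rw [d3.deriv]
    have h1 : 0 ≤ deriv (fun t => expNegInvGlue (t - K)) t := hmono.deriv_nonneg
    have h2 := mul_nonneg (Real.exp_pos (l * t)).le h1
    simp only [Φ]
    linarith
  obtain ⟨z, hz, hz'⟩ := W01.exists_comp_of_bounded hΦ (hΦ0 0 hK0.le) hR
  obtain ⟨B, hB⟩ := (isCompact_Icc (a := -R) (b := R)).exists_bound_of_continuousOn
    hΦ.continuous.continuousOn
  have hzb : MemLp z.val (∞ : ℝ≥0∞) (volOn Ω) := by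
    refine memLp_top_of_bound (W01.memLp_val z).1 B ?_
    filter_upwards [hz, hR] with x h1 h2
    rw [h1]
    exact hB _ (abs_le.1 h2)
  -- Since exp(lu) ≤ exp(lR), the factor exp(-lR) gives exp(-lR)Φ(u) ≤ u - K where u > K, so the
  -- modified function stays above K ≥ M ≥ ψ.
  obtain ⟨hI, hle⟩ := D.integral_test_le_zero hu hzb (Real.exp_pos (-(l * R))) (by
    filter_upwards [hz, hR, hψ, hu.mem_obstacleSet] with x h1 h2 h3 h4
    rw [h1]
    rcases le_or_gt (u.val x) K with h5 | h5
    · rw [hΦ0 _ h5, mul_zero, sub_zero]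
      exact h4
    · have h6 : Real.exp (-(l * R)) * Φ (u.val x) ≤ u.val x - K := by
        have e1 : Real.exp (-(l * R)) * Real.exp (l * u.val x) ≤ 1 := by
          rw [← Real.exp_add, Real.exp_le_one_iff]
          have := mul_le_mul_of_nonneg_left ((le_abs_self _).trans h2) hl0
          linarith
        calc _ = Real.exp (-(l * R)) * Real.exp (l * u.val x) * expNegInvGlue (u.val x - K) := by
              simp only [Φ]; ring
          _ ≤ 1 * (u.val x - K) := mul_le_mul e1 (expNegInvGlue_le_self (sub_pos.2 h5))
              (expNegInvGlue.nonneg _) zero_le_one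
          _ = _ := one_mul _
      linarith [le_abs_self (ψ.val x)])
  set c := α₀ * K ^ (p - 1) - F with hc
  have hc0 : 0 < c := sub_pos.2 hFK
  -- The principal part absorbs b(R)|Du|^p Φ, and a₀ ≥ α₀K^{p-1} on {u > K} beats f with margin c >
  -- 0. The integral of cΦ(u) is therefore at most zero, which forces Φ(u) = 0.
  have hpt : ∀ᵐ x ∂(volOn Ω), c * Φ (u.val x) ≤
      inner ℝ (a x (u.val x) (u.grad x)) (z.grad x)
        + a₀ x (u.val x) * z.val x + H x (u.val x) (u.grad x) * z.val x := by
    filter_upwards [hz, hz', hR, D.a_coercive, D.a₀_coercive, D.abs_H_le R, hF]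
      with x h1 h2 h3 h4 h5 h6 h7
    rw [h1, h2, inner_smul_right]
    set s := u.val x
    set X := ‖u.grad x‖ ^ p
    have hX : 0 ≤ X := by positivity
    have k1 : b R * X * Φ s ≤ deriv Φ s * inner ℝ (a x s (u.grad x)) (u.grad x) := by
      calc b R * X * Φ s = (l * Φ s) * (α * X) := by rw [hl]; field_simp
        _ ≤ _ := mul_le_mul (hΦ' s) (h4 _ _) (by positivity)
            ((mul_nonneg hl0 (hΦnn s)).trans (hΦ' s))
    have k2 : α₀ * K ^ (p - 1) * Φ s ≤ a₀ x s * Φ s := by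
      rcases le_or_gt s K with h8 | h8
      · simp [hΦ0 _ h8]
      · have hs0 : 0 < s := hK0.trans h8
        have hp1 : 0 < p - 1 := sub_pos.2 hp.out
        refine mul_le_mul_of_nonneg_right ?_ (hΦnn s)
        have e1 := h5 s
        rw [abs_of_pos hs0] at e1
        have e2 : s ^ (p - 1) * s = s ^ p := by
          rw [← Real.rpow_add_one hs0.ne', sub_add_cancel]
        rw [← e2, ← mul_assoc] at e1
        have e3 := le_of_mul_le_mul_right e1 hs0
        exact le_trans (by gcongr) e3
    have k3 : -(F + b R * X) * Φ s ≤ H x s (u.grad x) * Φ s := by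
      refine mul_le_mul_of_nonneg_right ?_ (hΦnn s)
      have e1 := (abs_le.1 (h6 s (u.grad x) h3)).1
      linarith [(abs_le.1 h7).2]
    have : c * Φ s = α₀ * K ^ (p - 1) * Φ s - F * Φ s := by rw [hc]; ring
    linarith
  have hm : AEStronglyMeasurable (fun x => c * Φ (u.val x)) (volOn Ω) :=
    (hΦ.continuous.comp_aestronglyMeasurable (W01.memLp_val u).1).const_mul c
  have hcI : Integrable (fun x => c * Φ (u.val x)) (volOn Ω) := by
    refine hI.mono hm ?_
    filter_upwards [hpt] with x hx
    rw [Real.norm_of_nonneg (mul_nonneg hc0.le (hΦnn _))]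
    exact hx.trans (Real.le_norm_self _)
  have hzero : ∫ x in Ω, c * Φ (u.val x) = 0 :=
    le_antisymm ((integral_mono_ae hcI hI hpt).trans hle)
      (integral_nonneg fun x => mul_nonneg hc0.le (hΦnn _))
  have hae := (integral_eq_zero_iff_of_nonneg
    (fun x => mul_nonneg hc0.le (hΦnn (u.val x))) hcI).1 hzero
  filter_upwards [hae] with x hx
  by_contra hcon
  have := mul_pos hc0 (hΦpos _ (not_le.1 hcon))
  exact this.ne' hx

/-- Solutions are bounded in terms of a bound for the obstacle. -/
theorem exists_uniform_bound (D : VIData Ω p α β α₀ h a a₀ f b H) (M : ℝ) :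
    ∃ K, 0 < K ∧ M ≤ K ∧ ∀ ψ u : W01 Ω p, IsVISolution a a₀ H ψ u →
      (∀ᵐ x ∂(volOn Ω), |ψ.val x| ≤ M) → ∀ᵐ x ∂(volOn Ω), |u.val x| ≤ K := by
  obtain ⟨F, hF0, hF⟩ := D.f_memLp.exists_ae_bound
  have hα₀ := D.α₀_pos
  have hp1 : 0 < p - 1 := sub_pos.2 hp.out
  -- `t` solves α₀t^{p-1} = F; the extra 1 in the level makes the inequality strict and the level
  -- positive.
  set t := (F / α₀) ^ (1 / (p - 1)) with ht
  have ht0 : 0 ≤ t := by positivity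
  have hK0 : 0 < |M| + t + 1 := by positivity
  have hMK : M ≤ |M| + t + 1 := by linarith [le_abs_self M]
  refine ⟨|M| + t + 1, hK0, hMK, fun ψ u hu hψ => ?_⟩
  have hFK : F < α₀ * (|M| + t + 1) ^ (p - 1) := by
    have h1 : t ^ (p - 1) = F / α₀ := by
      rw [ht, ← Real.rpow_mul (by positivity), one_div_mul_cancel hp1.ne', Real.rpow_one]
    have h2 : t ^ (p - 1) < (|M| + t + 1) ^ (p - 1) :=
      Real.rpow_lt_rpow ht0 (by linarith [abs_nonneg M]) hp1
    rw [h1, div_lt_iff₀ hα₀] at h2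
    linarith
  filter_upwards [D.val_le_of_isVISolution hK0 hMK hF hFK hu hψ, hψ, hu.mem_obstacleSet]
    with x h1 h2 h3
  -- The lower bound costs nothing: u ≥ ψ ≥ -M.
  refine abs_le.2 ⟨?_, h1⟩
  have := (abs_le.1 h2).1
  linarith

/-- The variational inequality tested with `φ(u - w)`, where `φ(s) = s exp(λ s²)`. -/
theorem integral_expTest_le_zero (D : VIData Ω p α β α₀ h a a₀ f b H) {ψ u w : W01 Ω p}
    (hu : IsVISolution a a₀ H ψ u) {K B : ℝ} (hK : ∀ᵐ x ∂(volOn Ω), |u.val x| ≤ K)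
    (hw : w ∈ obstacleSet ψ) (hB : ∀ᵐ x ∂(volOn Ω), |w.val x| ≤ B) {l : ℝ} (hl : 0 ≤ l) :
    Integrable (fun x => expTestDeriv l (u.val x - w.val x) *
        inner ℝ (a x (u.val x) (u.grad x)) (u.grad x - w.grad x)
      + a₀ x (u.val x) * expTest l (u.val x - w.val x)
      + H x (u.val x) (u.grad x) * expTest l (u.val x - w.val x)) (volOn Ω) ∧
    ∫ x in Ω, (expTestDeriv l (u.val x - w.val x) *
        inner ℝ (a x (u.val x) (u.grad x)) (u.grad x - w.grad x)
      + a₀ x (u.val x) * expTest l (u.val x - w.val x)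
      + H x (u.val x) (u.grad x) * expTest l (u.val x - w.val x)) ≤ 0 := by
  have hd : ∀ᵐ x ∂(volOn Ω), |(u - w).val x| ≤ K + B := by
    filter_upwards [hK, hB, W01.val_sub u w] with x h1 h2 h3
    rw [h3]
    exact (abs_sub _ _).trans (add_le_add h1 h2)
  obtain ⟨z, hz, hz'⟩ := W01.exists_comp_of_bounded (contDiff_expTest l) (expTest_zero l) hd
  have hzv : ∀ᵐ x ∂(volOn Ω), z.val x = expTest l (u.val x - w.val x) := by
    filter_upwards [hz, W01.val_sub u w] with x h1 h2
    rw [h1, h2]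
  have hzg : ∀ᵐ x ∂(volOn Ω), z.grad x =
      expTestDeriv l (u.val x - w.val x) • (u.grad x - w.grad x) := by
    filter_upwards [hz', W01.val_sub u w, W01.grad_sub u w] with x h1 h2 h3
    rw [h1, h2, h3, deriv_expTest]
  have hzb : MemLp z.val (∞ : ℝ≥0∞) (volOn Ω) := by
    refine memLp_top_of_bound (W01.memLp_val z).1 (expTest l (K + B)) ?_
    filter_upwards [hz, hd] with x h1 h2
    rw [h1]
    exact abs_expTest_le hl h2
  -- With this factor the perturbation equals θ(u - w) with 0 < θ ≤ 1, so the competitor is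
  -- pointwise a convex combination of u and w, both above ψ.
  obtain ⟨hI, hle⟩ := D.integral_test_le_zero hu hzb (Real.exp_pos (-(l * (K + B) ^ 2))) (by
    filter_upwards [hzv, hK, hB, hu.mem_obstacleSet, hw] with x h1 h2 h3 h4 h5
    rw [h1, expTest]
    set d := u.val x - w.val x with hdef
    have e1 : |d| ≤ K + B := (abs_sub _ _).trans (add_le_add h2 h3)
    have e2 : d ^ 2 ≤ (K + B) ^ 2 :=
      sq_le_sq' (by linarith [neg_abs_le d]) ((le_abs_self d).trans e1)
    have e3 : Real.exp (-(l * (K + B) ^ 2)) * Real.exp (l * d ^ 2) ≤ 1 := by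
      rw [← Real.exp_add, Real.exp_le_one_iff]
      have := mul_le_mul_of_nonneg_left e2 hl
      linarith
    have e4 : 0 < Real.exp (-(l * (K + B) ^ 2)) * Real.exp (l * d ^ 2) := by positivity
    have e5 : Real.exp (-(l * (K + B) ^ 2)) * (d * Real.exp (l * d ^ 2)) =
      (Real.exp (-(l * (K + B) ^ 2)) * Real.exp (l * d ^ 2)) * d := by ring
    rw [e5]
    set θ := Real.exp (-(l * (K + B) ^ 2)) * Real.exp (l * d ^ 2)
    have e6 : u.val x - θ * d = (1 - θ) * u.val x + θ * w.val x := by rw [hdef]; ring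
    rw [e6]
    nlinarith [mul_le_mul_of_nonneg_left h4 (sub_nonneg.2 e3),
      mul_le_mul_of_nonneg_left h5 e4.le])
  have hcongr : (fun x => inner ℝ (a x (u.val x) (u.grad x)) (z.grad x)
      + a₀ x (u.val x) * z.val x + H x (u.val x) (u.grad x) * z.val x) =ᵐ[volOn Ω]
      (fun x => expTestDeriv l (u.val x - w.val x) *
        inner ℝ (a x (u.val x) (u.grad x)) (u.grad x - w.grad x)
      + a₀ x (u.val x) * expTest l (u.val x - w.val x)
      + H x (u.val x) (u.grad x) * expTest l (u.val x - w.val x)) := by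
    filter_upwards [hzv, hzg] with x h1 h2
    rw [h1, h2, inner_smul_right]
  exact ⟨hI.congr hcongr, (integral_congr_ae hcongr).symm.trans_le hle⟩

end VIData

/-! ### Elementary inequalities and convergence tools -/

theorem le_one_add_rpow {p x : ℝ} (hp : 1 < p) (hx : 0 ≤ x) : x ≤ 1 + x ^ p := by
  rcases le_total x 1 with h | h
  · linarith [Real.rpow_nonneg hx p]
  · linarith [Real.self_le_rpow_of_one_le h hp.le]

theorem add_rpow_le_two_rpow_mul {q s t : ℝ} (hq : 0 < q) (hs : 0 ≤ s) (ht : 0 ≤ t) :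
    (s + t) ^ q ≤ 2 ^ q * (s ^ q + t ^ q) := by
  have hm : 0 ≤ max s t := le_max_of_le_left hs
  calc (s + t) ^ q ≤ (2 * max s t) ^ q := by
        refine Real.rpow_le_rpow (add_nonneg hs ht) ?_ hq.le
        linarith [le_max_left s t, le_max_right s t]
    _ = 2 ^ q * (max s t) ^ q := Real.mul_rpow zero_le_two hm
    _ ≤ _ := by
        gcongr
        rcases max_cases s t with ⟨h, -⟩ | ⟨h, -⟩ <;> rw [h]
        · exact le_add_of_nonneg_right (by positivity)
        · exact le_add_of_nonneg_left (by positivity)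

section Convergence

variable {α E : Type*} {m : MeasurableSpace α} {μ : Measure α} [NormedAddCommGroup E]

theorem tendsto_integral_norm_rpow_zero {r : ℝ} (hr : 1 < r) {Z : ℕ → α → E} {G : α → ℝ}
    (hG : MemLp G (ENNReal.ofReal r) μ) (hZ : ∀ n, AEStronglyMeasurable (Z n) μ)
    (hle : ∀ n, ∀ᵐ x ∂μ, ‖Z n x‖ ≤ G x)
    (hlim : ∀ᵐ x ∂μ, Tendsto (fun n => Z n x) atTop (𝓝 0)) :
    Tendsto (fun n => ∫ x, ‖Z n x‖ ^ r ∂μ) atTop (𝓝 0) := by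
  have : Fact (1 < r) := ⟨hr⟩
  have hr0 : 0 < r := by linarith
  have := tendsto_integral_of_dominated_convergence (F := fun n x => ‖Z n x‖ ^ r)
    (f := fun _ => (0 : ℝ)) (μ := μ) (fun x => ‖G x‖ ^ r)
    (fun n => ((hZ n).norm.aemeasurable.pow_const r).aestronglyMeasurable)
    hG.integrable_norm_rpow_ofReal ?_ ?_
  · simpa using this
  · intro n
    filter_upwards [hle n] with x hx
    rw [Real.norm_of_nonneg (by positivity)]
    exact Real.rpow_le_rpow (norm_nonneg _) (hx.trans (Real.le_norm_self _)) hr0.le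
  · filter_upwards [hlim] with x hx
    have := hx.norm.rpow_const (p := r) (Or.inr hr0.le)
    simpa [Real.zero_rpow hr0.ne'] using this

/-- Hölder's inequality: one factor is bounded, the other tends to zero in the conjugate space. The
exponents are left general because either factor of the energy may be the vanishing one. -/
theorem tendsto_integral_inner_zero [InnerProductSpace ℝ E] {r r' : ℝ}
    (hrr : r.HolderConjugate r') {F Z : ℕ → α → E}
    (hF : ∀ n, MemLp (F n) (ENNReal.ofReal r) μ) (hZ : ∀ n, MemLp (Z n) (ENNReal.ofReal r') μ)
    {C : ℝ} (hC : ∀ n, ∫ x, ‖F n x‖ ^ r ∂μ ≤ C)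
    (hlim : Tendsto (fun n => ∫ x, ‖Z n x‖ ^ r' ∂μ) atTop (𝓝 0)) :
    Tendsto (fun n => ∫ x, inner ℝ (F n x) (Z n x) ∂μ) atTop (𝓝 0) := by
  have hr0 : 0 < r := hrr.pos
  have hr0' : 0 < r' := hrr.symm.pos
  have hb : ∀ n, ‖∫ x, inner ℝ (F n x) (Z n x) ∂μ‖ ≤
      C ^ (1 / r) * (∫ x, ‖Z n x‖ ^ r' ∂μ) ^ (1 / r') := by
    intro n
    have : ENNReal.HolderConjugate (ENNReal.ofReal r) (ENNReal.ofReal r') := hrr.ennrealOfReal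
    have hi : Integrable (fun x => ‖F n x‖ * ‖Z n x‖) μ := (hF n).norm.integrable_mul (hZ n).norm
    calc _ ≤ ∫ x, ‖F n x‖ * ‖Z n x‖ ∂μ :=
          norm_integral_le_of_norm_le hi (Eventually.of_forall fun x => norm_inner_le_norm _ _)
      _ ≤ (∫ x, ‖F n x‖ ^ r ∂μ) ^ (1 / r) * (∫ x, ‖Z n x‖ ^ r' ∂μ) ^ (1 / r') :=
          integral_mul_norm_le_Lp_mul_Lq hrr (hF n) (hZ n)
      _ ≤ _ := by
          gcongr
          exact hC n
  refine squeeze_zero_norm hb ?_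
  have := (hlim.rpow_const (p := 1 / r') (Or.inr (by positivity))).const_mul (C ^ (1 / r))
  simpa [Real.zero_rpow (one_div_pos.2 hr0').ne', hr0'.ne'] using this

/-- The pointwise argument for the almost everywhere convergence of the gradients. -/
theorem tendsto_of_tendsto_inner_monotone [InnerProductSpace ℝ E] [FiniteDimensional ℝ E]
    {A : ℝ → E → E} (hA : Continuous fun q : ℝ × E => A q.1 q.2)
    (hmono : ∀ s ξ η, ξ ≠ η → 0 < inner ℝ (A s ξ - A s η) (ξ - η))
    {s : ℕ → ℝ} {ξ : ℕ → E} {s₀ : ℝ} {ξ₀ : E} (hs : Tendsto s atTop (𝓝 s₀))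
    {C : ℝ} (hC : ∀ n, ‖ξ n‖ ≤ C)
    (hlim : Tendsto (fun n => inner ℝ (A (s n) (ξ n) - A (s n) ξ₀) (ξ n - ξ₀)) atTop (𝓝 0)) :
    Tendsto ξ atTop (𝓝 ξ₀) := by
  have : ProperSpace E := FiniteDimensional.proper ℝ E
  -- A bounded sequence has cluster points; at a cluster point η continuity makes the monotonicity
  -- product of η and ξ₀ at s₀ vanish, so η = ξ₀.
  refine tendsto_of_subseq_tendsto fun ns hns => ?_
  obtain ⟨η, -, φ, hφ, hη⟩ := (isCompact_closedBall (0 : E) C).tendsto_subseq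
    (x := fun n => ξ (ns n)) fun n => by simpa using hC (ns n)
  refine ⟨φ, ?_⟩
  have hsub : Tendsto (fun n => ns (φ n)) atTop atTop := hns.comp hφ.tendsto_atTop
  have hs' : Tendsto (fun n => s (ns (φ n))) atTop (𝓝 s₀) := hs.comp hsub
  have hη' : Tendsto (fun n => ξ (ns (φ n))) atTop (𝓝 η) := hη
  have h1 : Tendsto (fun n => A (s (ns (φ n))) (ξ (ns (φ n)))) atTop (𝓝 (A s₀ η)) :=
    (hA.tendsto (s₀, η)).comp (hs'.prodMk_nhds hη')
  have h2 : Tendsto (fun n => A (s (ns (φ n))) ξ₀) atTop (𝓝 (A s₀ ξ₀)) :=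
    (hA.tendsto (s₀, ξ₀)).comp (hs'.prodMk_nhds tendsto_const_nhds)
  have h3 := (h1.sub h2).inner (𝕜 := ℝ) (hη'.sub_const ξ₀)
  have h4 := tendsto_nhds_unique h3 (hlim.comp hsub)
  have h5 : η = ξ₀ := by
    by_contra hne
    exact (hmono s₀ η ξ₀ hne).ne' h4
  rw [← h5]
  exact hη'

end Convergence

/-! ### The uniform Sobolev bound -/

namespace VIData

variable {N : ℕ} {Ω : Set (EuclideanSpace ℝ (Fin N))} {p : ℝ} [hp : Fact (1 < p)] {α β α₀ : ℝ}
  {h : EuclideanSpace ℝ (Fin N) → ℝ}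
  {a : EuclideanSpace ℝ (Fin N) → ℝ → EuclideanSpace ℝ (Fin N) → EuclideanSpace ℝ (Fin N)}
  {a₀ : EuclideanSpace ℝ (Fin N) → ℝ → ℝ} {f : EuclideanSpace ℝ (Fin N) → ℝ} {b : ℝ → ℝ}
  {H : EuclideanSpace ℝ (Fin N) → ℝ → EuclideanSpace ℝ (Fin N) → ℝ}

omit hp in
theorem memLp_abs_h_add_const (D : VIData Ω p α β α₀ h a a₀ f b H) (c : ℝ) :
    MemLp (fun x => |h x| + c) (ENNReal.ofReal (p / (p - 1))) (volOn Ω) := by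
  have := D.isFiniteMeasure
  exact D.h_memLp.norm.add (memLp_const c)

theorem integrable_rpow_of_memLp {F : EuclideanSpace ℝ (Fin N) → ℝ} (hF0 : ∀ x, 0 ≤ F x)
    (hF : MemLp F (ENNReal.ofReal (p / (p - 1))) (volOn Ω)) :
    Integrable (fun x => F x ^ (p / (p - 1))) (volOn Ω) := by
  have : Fact (1 < p / (p - 1)) := ⟨(Real.HolderConjugate.conjExponent hp.out).symm.lt⟩
  refine hF.integrable_norm_rpow_ofReal.congr (Eventually.of_forall fun x => ?_)
  simp only
  rw [Real.norm_of_nonneg (hF0 x)]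

omit hp in
theorem norm_a_le_of_abs_le (D : VIData Ω p α β α₀ h a a₀ f b H) (hp : 1 < p) (K : ℝ) :
    ∀ᵐ x ∂(volOn Ω), ∀ (s : ℝ) (ξ : EuclideanSpace ℝ (Fin N)), |s| ≤ K →
      ‖a x s ξ‖ ≤ β * ((|h x| + K ^ (p - 1)) + ‖ξ‖ ^ (p - 1)) := by
  have := D.β_pos
  filter_upwards [D.norm_a_le] with x hx s ξ hs
  refine (hx s ξ).trans ?_
  rw [Real.norm_eq_abs]
  have : 0 ≤ p - 1 := by linarith
  gcongr

omit hp in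
theorem abs_a₀_le_of_abs_le (D : VIData Ω p α β α₀ h a a₀ f b H) (hp : 1 < p) (K : ℝ) :
    ∀ᵐ x ∂(volOn Ω), ∀ s : ℝ, |s| ≤ K → |a₀ x s| ≤ β * (|h x| + K ^ (p - 1)) := by
  have := D.β_pos
  filter_upwards [D.a₀_growth] with x hx s hs
  refine (hx s).trans ?_
  have : 0 ≤ p - 1 := by linarith
  gcongr
  exact le_abs_self _

/-- Solutions are bounded in `W_0^{1,p}(Ω)` in terms of an admissible function. -/
theorem exists_norm_bound (D : VIData Ω p α β α₀ h a a₀ f b H) {K B : ℝ} (hK0 : 0 ≤ K)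
    (hB0 : 0 ≤ B) (S : ℝ) :
    ∃ R, ∀ ψ u w : W01 Ω p, IsVISolution a a₀ H ψ u → (∀ᵐ x ∂(volOn Ω), |u.val x| ≤ K) →
      w ∈ obstacleSet ψ → (∀ᵐ x ∂(volOn Ω), |w.val x| ≤ B) → ‖w‖ ≤ S → ‖u‖ ≤ R := by
  have := D.isFiniteMeasure
  have hα := D.α_pos
  have hβ := D.β_pos
  have hp0 : 0 < p := zero_lt_one.trans hp.out
  have hbK : 0 ≤ b K := D.b_nonneg K hK0
  -- With this ratio b(K)|Du|^p ≤ κ a·Du, so the gradient part of `H` is charged to the principal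
  -- part.
  set κ := b K / α with hκ
  have hκ0 : 0 ≤ κ := by positivity
  have hl : 0 ≤ κ ^ 2 := by positivity
  have hKB : 0 ≤ K + B := add_nonneg hK0 hB0
  set L := expTestDeriv (κ ^ 2) (K + B) with hL
  set P := expTest (κ ^ 2) (K + B) with hP
  have hL0 : 0 ≤ L := expTestDeriv_nonneg hl _
  have hP0 : 0 ≤ P := (abs_nonneg _).trans (abs_expTest_le hl (abs_of_nonneg hKB).le)
  -- The coercive part keeps α/2 |Du|^p after absorbing `H`. This η makes the cross term with Dw
  -- cost at most α/4 of it, since φ' ≤ L and L/(L+1) ≤ 1.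
  obtain ⟨C₁, hC₁, hY₁⟩ := exists_rpow_sub_one_mul_le hp.out
    (η := α / (4 * (L + 1) * β)) (by positivity)
  obtain ⟨C₂, hC₂, hY₂⟩ := exists_mul_le_rpow_add_rpow hp.out (η := 1) one_pos
  let A : EuclideanSpace ℝ (Fin N) → ℝ := fun x => |h x| + K ^ (p - 1)
  have hA0 : ∀ x, 0 ≤ A x := fun x => by positivity
  have hA : MemLp A (ENNReal.ofReal (p / (p - 1))) (volOn Ω) := D.memLp_abs_h_add_const _
  have hAi : Integrable A (volOn Ω) := hA.integrable (by
    rw [← ENNReal.ofReal_one]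
    exact ENNReal.ofReal_le_ofReal (Real.HolderConjugate.conjExponent hp.out).symm.lt.le)
  let g : EuclideanSpace ℝ (Fin N) → ℝ := fun x =>
    L * β * (C₂ * A x ^ (p / (p - 1))) + (β * A x + f x) * P
  have hg : Integrable g (volOn Ω) :=
    (((integrable_rpow_of_memLp hA0 hA).const_mul _).const_mul _).add
      (((hAi.const_mul _).add D.integrable_f).mul_const _)
  set T := 4 / α * (L * β * (1 + C₁) * S ^ p + ∫ x in Ω, g x) with hT
  -- The two entries bound function and gradient; the added 1 comes from x ≤ 1 + x^p, which turns
  -- bounds on p-th powers into bounds on norms.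
  refine ⟨max (1 + (volOn Ω).real Set.univ * K ^ p) (1 + T), fun ψ u w hu hK hw hB hS => ?_⟩
  obtain ⟨hI, hle⟩ := D.integral_expTest_le_zero hu hK hw hB hl
  have hS0 : 0 ≤ S := (norm_nonneg w).trans hS
  have hXi := (W01.memLp_grad u).integrable_norm_rpow_ofReal
  have hYi := (W01.memLp_grad w).integrable_norm_rpow_ofReal
  have hpt : ∀ᵐ x ∂(volOn Ω), α / 4 * ‖u.grad x‖ ^ p ≤
      (expTestDeriv (κ ^ 2) (u.val x - w.val x) *
        inner ℝ (a x (u.val x) (u.grad x)) (u.grad x - w.grad x)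
      + a₀ x (u.val x) * expTest (κ ^ 2) (u.val x - w.val x)
      + H x (u.val x) (u.grad x) * expTest (κ ^ 2) (u.val x - w.val x))
      + (L * β * (1 + C₁) * ‖w.grad x‖ ^ p + g x) := by
    filter_upwards [hK, hB, D.a_coercive, D.norm_a_le_of_abs_le hp.out K,
      D.abs_a₀_le_of_abs_le hp.out K, D.abs_H_le K, D.f_nonneg] with x h1 h2 h3 h4 h5 h6 h7
    set d := u.val x - w.val x with hd
    have hdle : |d| ≤ K + B := (abs_sub _ _).trans (add_le_add h1 h2)
    set X := ‖u.grad x‖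
    set Y := ‖w.grad x‖
    set av := a x (u.val x) (u.grad x)
    have hX0 : 0 ≤ X := norm_nonneg _
    have hY0 : 0 ≤ Y := norm_nonneg _
    have hφ : |expTest (κ ^ 2) d| ≤ P := abs_expTest_le hl hdle
    have hφ' : expTestDeriv (κ ^ 2) d ≤ L := expTestDeriv_le hl hdle
    have hφ'0 := expTestDeriv_nonneg hl d
    have hhalf := half_le_expTestDeriv_sub κ d
    set φ := expTest (κ ^ 2) d
    set φ' := expTestDeriv (κ ^ 2) d
    have h3' := h3 (u.val x) (u.grad x)
    have hXp : 0 ≤ X ^ p := by positivity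
    have hYp : 0 ≤ Y ^ p := by positivity
    have k1 : φ' * inner ℝ av (w.grad x) ≤
        L * β * (C₂ * A x ^ (p / (p - 1))) + L * β * (1 + C₁) * Y ^ p + α / 4 * X ^ p := by
      have e1 : inner ℝ av (w.grad x) ≤ β * (A x + X ^ (p - 1)) * Y :=
        (real_inner_le_norm _ _).trans (mul_le_mul_of_nonneg_right (h4 _ _ h1) hY0)
      have e2 := hY₁ X Y hX0 hY0
      have e3 := hY₂ (A x) Y (hA0 x) hY0
      have e4 : 0 ≤ β * (A x + X ^ (p - 1)) * Y := by
        have := hA0 x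
        positivity
      have e5 : L * β * (α / (4 * (L + 1) * β) * X ^ p) ≤ α / 4 * X ^ p := by
        have e6 : L * β * (α / (4 * (L + 1) * β) * X ^ p) = (L / (L + 1)) * (α / 4 * X ^ p) := by
          field_simp
        rw [e6]
        refine mul_le_of_le_one_left (by positivity) ?_
        rw [div_le_one (by positivity)]
        linarith
      have hLβ : 0 ≤ L * β := by positivity
      calc φ' * inner ℝ av (w.grad x) ≤ φ' * (β * (A x + X ^ (p - 1)) * Y) := by gcongr
        _ ≤ L * (β * (A x + X ^ (p - 1)) * Y) := by gcongr
        _ = L * β * (A x * Y) + L * β * (X ^ (p - 1) * Y) := by ring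
        _ ≤ L * β * (1 * Y ^ p + C₂ * A x ^ (p / (p - 1))) +
            L * β * (α / (4 * (L + 1) * β) * X ^ p + C₁ * Y ^ p) := by gcongr
        _ ≤ _ := by linarith
    have k2 : -(β * A x * P) ≤ a₀ x (u.val x) * φ := by
      have e1 : |a₀ x (u.val x) * φ| ≤ β * A x * P := by
        rw [abs_mul]
        exact mul_le_mul (h5 _ h1) hφ (abs_nonneg _) (mul_nonneg hβ.le (hA0 x))
      exact (abs_le.1 e1).1
    have k3 : -(f x * P) - κ * |φ| * inner ℝ av (u.grad x) ≤ H x (u.val x) (u.grad x) * φ := by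
      have e1 : |H x (u.val x) (u.grad x) * φ| ≤ (f x + b K * X ^ p) * |φ| := by
        rw [abs_mul]
        exact mul_le_mul_of_nonneg_right (h6 _ _ h1) (abs_nonneg _)
      have e2 : f x * |φ| ≤ f x * P := by gcongr
      have e3 : b K * X ^ p ≤ κ * inner ℝ av (u.grad x) := by
        calc b K * X ^ p = κ * (α * X ^ p) := by rw [hκ]; field_simp
          _ ≤ _ := by gcongr
      have e4 := mul_le_mul_of_nonneg_right e3 (abs_nonneg φ)
      have e5 := (abs_le.1 e1).1
      linarith
    have k4 : α / 2 * X ^ p ≤ (φ' - κ * |φ|) * inner ℝ av (u.grad x) := by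
      calc α / 2 * X ^ p = 1 / 2 * (α * X ^ p) := by ring
        _ ≤ _ := mul_le_mul hhalf h3' (by positivity) (by linarith)
    rw [inner_sub_right]
    simp only [g]
    linarith
  have hint := integral_mono_ae (hXi.const_mul (α / 4))
    (hI.add ((hYi.const_mul (L * β * (1 + C₁))).add hg)) hpt
  have e1 := integral_add hI ((hYi.const_mul (L * β * (1 + C₁))).add hg)
  have e2 := integral_add (hYi.const_mul (L * β * (1 + C₁))) hg
  simp only [Pi.add_apply] at hint e1
  rw [e1, e2, integral_const_mul, integral_const_mul] at hint
  have n1 : ∫ x in Ω, ‖u.grad x‖ ^ p = ‖(u : SobolevPair Ω p).2‖ ^ p :=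
    (Lp_norm_rpow_eq_integral _).symm
  have n2 : ∫ x in Ω, ‖w.grad x‖ ^ p = ‖(w : SobolevPair Ω p).2‖ ^ p :=
    (Lp_norm_rpow_eq_integral _).symm
  have n3 : ‖(w : SobolevPair Ω p).2‖ ^ p ≤ S ^ p := by
    have : ‖(w : SobolevPair Ω p).2‖ ≤ S := (norm_snd_le (w : SobolevPair Ω p)).trans hS
    gcongr
  rw [n1, n2] at hint
  have hgrad : ‖(u : SobolevPair Ω p).2‖ ^ p ≤ T := by
    have e3 : L * β * (1 + C₁) * ‖(w : SobolevPair Ω p).2‖ ^ p ≤ L * β * (1 + C₁) * S ^ p := by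
      gcongr
    have e4 : α / 4 * ‖(u : SobolevPair Ω p).2‖ ^ p ≤
        L * β * (1 + C₁) * S ^ p + ∫ x in Ω, g x := by linarith
    calc _ = 4 / α * (α / 4 * ‖(u : SobolevPair Ω p).2‖ ^ p) := by field_simp
      _ ≤ _ := by rw [hT]; gcongr
  have hval : ‖(u : SobolevPair Ω p).1‖ ^ p ≤ (volOn Ω).real Set.univ * K ^ p := by
    rw [Lp_norm_rpow_eq_integral]
    calc _ ≤ ∫ x in Ω, K ^ p := by
          refine integral_mono_ae (W01.memLp_val u).integrable_norm_rpow_ofReal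
            (integrable_const _) ?_
          filter_upwards [hK] with x hx
          exact Real.rpow_le_rpow (norm_nonneg _) hx hp0.le
      _ = _ := by rw [integral_const, smul_eq_mul]
  rw [Submodule.coe_norm, Prod.norm_def]
  refine max_le_max ?_ ?_
  · exact (le_one_add_rpow hp.out (norm_nonneg _)).trans (by linarith)
  · exact (le_one_add_rpow hp.out (norm_nonneg _)).trans (by linarith)

end VIData

/-! ### Vanishing of the monotonicity gap -/

namespace VIData

variable {N : ℕ} {Ω : Set (EuclideanSpace ℝ (Fin N))} {p : ℝ} [hp : Fact (1 < p)] {α β α₀ : ℝ}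
  {h : EuclideanSpace ℝ (Fin N) → ℝ}
  {a : EuclideanSpace ℝ (Fin N) → ℝ → EuclideanSpace ℝ (Fin N) → EuclideanSpace ℝ (Fin N)}
  {a₀ : EuclideanSpace ℝ (Fin N) → ℝ → ℝ} {f : EuclideanSpace ℝ (Fin N) → ℝ} {b : ℝ → ℝ}
  {H : EuclideanSpace ℝ (Fin N) → ℝ → EuclideanSpace ℝ (Fin N) → ℝ}

/-- Since (p - 1)p' = p, the growth condition turns the energy bound into an L^{p'} bound of the
fluxes, as needed for Hölder against strongly vanishing fields. -/
theorem exists_integral_norm_a_rpow_le (D : VIData Ω p α β α₀ h a a₀ f b H) {K : ℝ} (hK0 : 0 ≤ K)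
    (R : ℝ) : ∃ C, ∀ u : W01 Ω p, (∀ᵐ x ∂(volOn Ω), |u.val x| ≤ K) → ‖u‖ ≤ R →
      ∫ x in Ω, ‖a x (u.val x) (u.grad x)‖ ^ (p / (p - 1)) ≤ C := by
  have hβ := D.β_pos
  have hp0 : 0 < p := zero_lt_one.trans hp.out
  have hp1 : 0 < p - 1 := sub_pos.2 hp.out
  set q := p / (p - 1) with hq
  have hq0 : 0 < q := by positivity
  let A : EuclideanSpace ℝ (Fin N) → ℝ := fun x => |h x| + K ^ (p - 1)
  have hA0 : ∀ x, 0 ≤ A x := fun x => by positivity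
  have hA : Integrable (fun x => A x ^ q) (volOn Ω) :=
    integrable_rpow_of_memLp hA0 (D.memLp_abs_h_add_const _)
  refine ⟨β ^ q * (2 ^ q * ((∫ x in Ω, A x ^ q) + R ^ p)), fun u hu hR => ?_⟩
  have hXi := (W01.memLp_grad u).integrable_norm_rpow_ofReal
  have hgrad : ∫ x in Ω, ‖u.grad x‖ ^ p ≤ R ^ p := by
    have e1 : ∫ x in Ω, ‖u.grad x‖ ^ p = ‖(u : SobolevPair Ω p).2‖ ^ p :=
      (Lp_norm_rpow_eq_integral _).symm
    have e2 : ‖(u : SobolevPair Ω p).2‖ ≤ R := (norm_snd_le (u : SobolevPair Ω p)).trans hR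
    rw [e1]
    gcongr
  calc ∫ x in Ω, ‖a x (u.val x) (u.grad x)‖ ^ q
      ≤ ∫ x in Ω, β ^ q * (2 ^ q * (A x ^ q + ‖u.grad x‖ ^ p)) := by
        refine integral_mono_of_nonneg (Eventually.of_forall fun x => by positivity)
          (((hA.add hXi).const_mul _).const_mul _) ?_
        filter_upwards [hu, D.norm_a_le_of_abs_le hp.out K] with x h1 h2
        have e1 : (‖u.grad x‖ ^ (p - 1)) ^ q = ‖u.grad x‖ ^ p := by
          rw [← Real.rpow_mul (norm_nonneg _), hq, mul_div_cancel₀ _ hp1.ne']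
        calc ‖a x (u.val x) (u.grad x)‖ ^ q ≤ (β * (A x + ‖u.grad x‖ ^ (p - 1))) ^ q :=
              Real.rpow_le_rpow (norm_nonneg _) (h2 _ _ h1) hq0.le
          _ = β ^ q * (A x + ‖u.grad x‖ ^ (p - 1)) ^ q :=
              Real.mul_rpow hβ.le (add_nonneg (hA0 x) (by positivity))
          _ ≤ β ^ q * (2 ^ q * (A x ^ q + (‖u.grad x‖ ^ (p - 1)) ^ q)) := by
              gcongr
              exact add_rpow_le_two_rpow_mul hq0 (hA0 x) (by positivity)
          _ = _ := by rw [e1]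
    _ = β ^ q * (2 ^ q * ((∫ x in Ω, A x ^ q) + ∫ x in Ω, ‖u.grad x‖ ^ p)) := by
        rw [integral_const_mul, integral_const_mul, integral_add hA hXi]
    _ ≤ _ := by gcongr

/-- The monotonicity gap of a weakly convergent sequence of solutions tends to zero. -/
theorem tendsto_integral_monotone (D : VIData Ω p α β α₀ h a a₀ f b H) {Ψ U W : ℕ → W01 Ω p}
    {u₀ : W01 Ω p} (hU : ∀ n, IsVISolution a a₀ H (Ψ n) (U n)) {K B R : ℝ} (hK0 : 0 ≤ K)
    (hB0 : 0 ≤ B) (hK : ∀ n, ∀ᵐ x ∂(volOn Ω), |(U n).val x| ≤ K)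
    (hW : ∀ n, W n ∈ obstacleSet (Ψ n)) (hB : ∀ n, ∀ᵐ x ∂(volOn Ω), |(W n).val x| ≤ B)
    (hR : ∀ n, ‖U n‖ ≤ R)
    (hweak : ∀ ℓ : StrongDual ℝ (W01 Ω p), Tendsto (fun n => ℓ (U n)) atTop (𝓝 (ℓ u₀)))
    (hae : ∀ᵐ x ∂(volOn Ω), Tendsto (fun n => (U n).val x) atTop (𝓝 (u₀.val x)))
    {G : EuclideanSpace ℝ (Fin N) → ℝ} (hG : MemLp G (ENNReal.ofReal p) (volOn Ω))
    (hWG : ∀ n, ∀ᵐ x ∂(volOn Ω), ‖(W n).grad x‖ ≤ G x)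
    (hWv : ∀ᵐ x ∂(volOn Ω), Tendsto (fun n => (W n).val x) atTop (𝓝 (u₀.val x)))
    (hWg : ∀ᵐ x ∂(volOn Ω), Tendsto (fun n => (W n).grad x) atTop (𝓝 (u₀.grad x))) :
    Tendsto (fun n => ∫ x in Ω, inner ℝ (a x ((U n).val x) ((U n).grad x) -
      a x ((U n).val x) (u₀.grad x)) ((U n).grad x - u₀.grad x)) atTop (𝓝 0) := by
  have := D.isFiniteMeasure
  have hα := D.α_pos
  have hβ := D.β_pos
  have hp0 : 0 < p := zero_lt_one.trans hp.out
  have hpq : Real.HolderConjugate p (p / (p - 1)) := Real.HolderConjugate.conjExponent hp.out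
  have hbK : 0 ≤ b K := D.b_nonneg K hK0
  set κ := b K / α with hκ
  have hκ0 : 0 ≤ κ := by positivity
  have hl : 0 ≤ κ ^ 2 := by positivity
  have hKB : 0 ≤ K + B := add_nonneg hK0 hB0
  set L := expTestDeriv (κ ^ 2) (K + B) with hL
  set P := expTest (κ ^ 2) (K + B) with hP
  have hL0 : 0 ≤ L := expTestDeriv_nonneg hl _
  have hP0 : 0 ≤ P := (abs_nonneg _).trans (abs_expTest_le hl (abs_of_nonneg hKB).le)
  let A : EuclideanSpace ℝ (Fin N) → ℝ := fun x => |h x| + K ^ (p - 1)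
  have hA0 : ∀ x, 0 ≤ A x := fun x => by positivity
  have hA : MemLp A (ENNReal.ofReal (p / (p - 1))) (volOn Ω) := D.memLp_abs_h_add_const _
  have hAi : Integrable A (volOn Ω) := hA.integrable (by
    rw [← ENNReal.ofReal_one]
    exact ENNReal.ofReal_le_ofReal hpq.symm.lt.le)
  let d : ℕ → EuclideanSpace ℝ (Fin N) → ℝ := fun n x => (U n).val x - (W n).val x
  have hdm : ∀ n, AEStronglyMeasurable (d n) (volOn Ω) := fun n =>
    (W01.memLp_val _).1.sub (W01.memLp_val _).1
  have hdle : ∀ n, ∀ᵐ x ∂(volOn Ω), |d n x| ≤ K + B := fun n => by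
    filter_upwards [hK n, hB n] with x h1 h2
    exact (abs_sub _ _).trans (add_le_add h1 h2)
  have hd0 : ∀ᵐ x ∂(volOn Ω), Tendsto (fun n => d n x) atTop (𝓝 0) := by
    filter_upwards [hae, hWv] with x h1 h2
    simpa using h1.sub h2
  let φ : ℕ → EuclideanSpace ℝ (Fin N) → ℝ := fun n x => expTest (κ ^ 2) (d n x)
  let φ' : ℕ → EuclideanSpace ℝ (Fin N) → ℝ := fun n x => expTestDeriv (κ ^ 2) (d n x)
  have hφm : ∀ n, AEStronglyMeasurable (φ n) (volOn Ω) := fun n =>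
    (contDiff_expTest _).continuous.comp_aestronglyMeasurable (hdm n)
  have hφ'm : ∀ n, AEStronglyMeasurable (φ' n) (volOn Ω) := fun n =>
    (continuous_expTestDeriv _).comp_aestronglyMeasurable (hdm n)
  have hφle : ∀ n, ∀ᵐ x ∂(volOn Ω), |φ n x| ≤ P := fun n => by
    filter_upwards [hdle n] with x h1 using abs_expTest_le hl h1
  have hφ'0 : ∀ n x, 0 ≤ φ' n x := fun n x => expTestDeriv_nonneg hl _
  have hφ'le : ∀ n, ∀ᵐ x ∂(volOn Ω), φ' n x ≤ L := fun n => by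
    filter_upwards [hdle n] with x h1 using expTestDeriv_le hl h1
  have hφ0 : ∀ᵐ x ∂(volOn Ω), Tendsto (fun n => φ n x) atTop (𝓝 0) := by
    filter_upwards [hd0] with x h1
    have := ((contDiff_expTest (κ ^ 2)).continuous.tendsto 0).comp h1
    rwa [expTest_zero] at this
  have hφ'1 : ∀ᵐ x ∂(volOn Ω), Tendsto (fun n => φ' n x) atTop (𝓝 1) := by
    filter_upwards [hd0] with x h1
    have := ((continuous_expTestDeriv (κ ^ 2)).tendsto 0).comp h1
    rwa [expTestDeriv_zero] at this
  -- The net weight of a·DU after the absorption of `H`: at least 1/2 everywhere, bounded by `L`,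
  -- and tending to 1 almost everywhere because U - W → 0.
  let c : ℕ → EuclideanSpace ℝ (Fin N) → ℝ := fun n x => φ' n x - κ * |φ n x|
  have hcm : ∀ n, AEStronglyMeasurable (c n) (volOn Ω) := fun n =>
    (hφ'm n).sub ((hφm n).norm.const_mul κ)
  have hchalf : ∀ n x, 1 / 2 ≤ c n x := fun n x => half_le_expTestDeriv_sub κ _
  have hcle : ∀ n, ∀ᵐ x ∂(volOn Ω), |c n x| ≤ L := fun n => by
    filter_upwards [hφ'le n] with x h1
    rw [abs_of_nonneg (by linarith [hchalf n x])]
    have : 0 ≤ κ * |φ n x| := by positivity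
    simp only [c]
    linarith
  have hc1 : ∀ᵐ x ∂(volOn Ω), Tendsto (fun n => c n x) atTop (𝓝 1) := by
    filter_upwards [hφ0, hφ'1] with x h1 h2
    simpa using h2.sub (h1.abs.const_mul κ)
  -- the three error terms
  have lim1 : Tendsto (fun n => ∫ x in Ω, (β * A x + f x) * |φ n x|) atTop (𝓝 0) := by
    have := tendsto_integral_of_dominated_convergence
      (F := fun n x => (β * A x + f x) * |φ n x|) (f := fun _ => (0 : ℝ)) (μ := volOn Ω)
      (fun x => (β * A x + f x) * P)
      (fun n => ((hAi.const_mul β).add D.integrable_f).1.mul (hφm n).norm)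
      (((hAi.const_mul β).add D.integrable_f).mul_const P) ?_ ?_
    · simpa using this
    · intro n
      filter_upwards [hφle n, D.f_nonneg] with x h1 h2
      have h3 : 0 ≤ β * A x + f x := add_nonneg (mul_nonneg hβ.le (hA0 x)) h2
      rw [Real.norm_of_nonneg (by positivity)]
      gcongr
    · filter_upwards [hφ0] with x h1
      simpa using h1.abs.const_mul (β * A x + f x)
  -- `Z` is the remainder in the identity φ' a·(DU - DW) - κ|φ| a·DU = c a·(DU - Du₀) - a·Z. It
  -- tends to zero strongly in L^p, so boundedness of the fluxes suffices.
  let Z : ℕ → EuclideanSpace ℝ (Fin N) → EuclideanSpace ℝ (Fin N) := fun n x =>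
    φ' n x • ((W n).grad x - u₀.grad x) + (κ * |φ n x|) • u₀.grad x
  let GZ : EuclideanSpace ℝ (Fin N) → ℝ := fun x =>
    L * (G x + ‖u₀.grad x‖) + κ * P * ‖u₀.grad x‖
  have hGZ : MemLp GZ (ENNReal.ofReal p) (volOn Ω) :=
    ((hG.add (W01.memLp_grad u₀).norm).const_mul L).add
      ((W01.memLp_grad u₀).norm.const_mul (κ * P))
  have hZm : ∀ n, AEStronglyMeasurable (Z n) (volOn Ω) := fun n =>
    ((hφ'm n).smul ((W01.memLp_grad _).1.sub (W01.memLp_grad _).1)).add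
      (((hφm n).norm.const_mul κ).smul (W01.memLp_grad _).1)
  have hZle : ∀ n, ∀ᵐ x ∂(volOn Ω), ‖Z n x‖ ≤ GZ x := fun n => by
    filter_upwards [hφle n, hφ'le n, hWG n] with x h1 h2 h3
    refine (norm_add_le _ _).trans (add_le_add ?_ ?_)
    · rw [norm_smul, Real.norm_of_nonneg (hφ'0 n x)]
      refine mul_le_mul h2 ((norm_sub_le _ _).trans (by gcongr)) (norm_nonneg _) hL0
    · rw [norm_smul, Real.norm_of_nonneg (by positivity)]
      gcongr
  have hZp : ∀ n, MemLp (Z n) (ENNReal.ofReal p) (volOn Ω) := fun n =>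
    hGZ.mono (hZm n) (by filter_upwards [hZle n] with x h1 using h1.trans (Real.le_norm_self _))
  have hZ0 : ∀ᵐ x ∂(volOn Ω), Tendsto (fun n => Z n x) atTop (𝓝 0) := by
    filter_upwards [hφ0, hφ'1, hWg] with x h1 h2 h3
    have e1 := h2.smul (h3.sub_const (u₀.grad x))
    have e2 := (h1.abs.const_mul κ).smul (tendsto_const_nhds (x := u₀.grad x))
    simpa using e1.add e2
  have hap : ∀ n, MemLp (fun x => a x ((U n).val x) ((U n).grad x))
      (ENNReal.ofReal (p / (p - 1))) (volOn Ω) := fun n =>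
    D.memLp_a (W01.memLp_val _) (W01.memLp_grad _)
  have lim2 : Tendsto (fun n => ∫ x in Ω, inner ℝ (a x ((U n).val x) ((U n).grad x)) (Z n x))
      atTop (𝓝 0) := by
    obtain ⟨C, hC⟩ := D.exists_integral_norm_a_rpow_le hK0 R
    exact tendsto_integral_inner_zero hpq.symm hap hZp (fun n => hC (U n) (hK n) (hR n))
      (tendsto_integral_norm_rpow_zero hp.out hGZ hZm hZle hZ0)
  have ha'p : ∀ n, MemLp (fun x => a x ((U n).val x) (u₀.grad x))
      (ENNReal.ofReal (p / (p - 1))) (volOn Ω) := fun n =>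
    D.memLp_a (W01.memLp_val _) (W01.memLp_grad _)
  have ha₀p : MemLp (fun x => a x (u₀.val x) (u₀.grad x))
      (ENNReal.ofReal (p / (p - 1))) (volOn Ω) :=
    D.memLp_a (W01.memLp_val _) (W01.memLp_grad _)
  have hsubp : ∀ n, MemLp (fun x => (U n).grad x - u₀.grad x) (ENNReal.ofReal p) (volOn Ω) :=
    fun n => (W01.memLp_grad _).sub (W01.memLp_grad _)
  have hca'p : ∀ n, MemLp (fun x => c n x • a x ((U n).val x) (u₀.grad x))
      (ENNReal.ofReal (p / (p - 1))) (volOn Ω) := fun n => by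
    refine (ha'p n).of_le_mul (c := L) ((hcm n).smul (ha'p n).1) ?_
    filter_upwards [hcle n] with x h1
    rw [norm_smul]
    exact mul_le_mul_of_nonneg_right h1 (norm_nonneg _)
  -- Here DU - Du₀ is only weakly null, so its partner must converge strongly: c a(x, U, Du₀) → a(x,
  -- u₀, Du₀) in L^{p'}, by dominated convergence, since the gradient argument is frozen at Du₀. The
  -- fixed limit then pairs with the weak convergence.
  have lim3 : Tendsto (fun n => ∫ x in Ω, inner ℝ (c n x • a x ((U n).val x) (u₀.grad x))
      ((U n).grad x - u₀.grad x)) atTop (𝓝 0) := by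
    let GF : EuclideanSpace ℝ (Fin N) → ℝ := fun x =>
      (L + 1) * (β * (A x + ‖u₀.grad x‖ ^ (p - 1)))
    have hGF : MemLp GF (ENNReal.ofReal (p / (p - 1))) (volOn Ω) :=
      ((hA.add (memLp_norm_rpow_sub_one (W01.memLp_grad u₀))).const_mul β).const_mul (L + 1)
    let F : ℕ → EuclideanSpace ℝ (Fin N) → EuclideanSpace ℝ (Fin N) := fun n x =>
      c n x • a x ((U n).val x) (u₀.grad x) - a x (u₀.val x) (u₀.grad x)
    have hFp : ∀ n, MemLp (F n) (ENNReal.ofReal (p / (p - 1))) (volOn Ω) := fun n =>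
      (hca'p n).sub ha₀p
    have hu₀K : ∀ᵐ x ∂(volOn Ω), |u₀.val x| ≤ K := by
      filter_upwards [hae, ae_all_iff.2 hK] with x h1 h2
      exact le_of_tendsto h1.abs (Eventually.of_forall h2)
    have hFle : ∀ n, ∀ᵐ x ∂(volOn Ω), ‖F n x‖ ≤ GF x := fun n => by
      filter_upwards [hcle n, hK n, hu₀K, D.norm_a_le_of_abs_le hp.out K] with x h1 h2 h3 h4
      refine (norm_sub_le _ _).trans ?_
      rw [norm_smul]
      have e1 := h4 _ (u₀.grad x) h2
      have e2 := h4 _ (u₀.grad x) h3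
      have e3 := mul_le_mul h1 e1 (norm_nonneg _) hL0
      simp only [GF]
      rw [add_mul, one_mul]
      exact add_le_add e3 e2
    have hF0 : ∀ᵐ x ∂(volOn Ω), Tendsto (fun n => F n x) atTop (𝓝 0) := by
      filter_upwards [hc1, hae, D.a_car.continuous] with x h1 h2 h3
      have e1 : Tendsto (fun n => a x ((U n).val x) (u₀.grad x)) atTop
          (𝓝 (a x (u₀.val x) (u₀.grad x))) :=
        (h3.tendsto (u₀.val x, u₀.grad x)).comp (h2.prodMk_nhds tendsto_const_nhds)
      have e2 := (h1.smul e1).sub_const (a x (u₀.val x) (u₀.grad x))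
      simpa using e2
    have hbd : ∀ n, ∫ x in Ω, ‖(U n).grad x - u₀.grad x‖ ^ p ≤ (R + ‖u₀‖) ^ p := fun n => by
      have e1 : ∫ x in Ω, ‖(U n).grad x - u₀.grad x‖ ^ p =
          ‖((U n - u₀ : W01 Ω p) : SobolevPair Ω p).2‖ ^ p := by
        rw [Lp_norm_rpow_eq_integral]
        refine integral_congr_ae ?_
        filter_upwards [W01.grad_sub (U n) u₀] with x h1
        rw [← h1]; rfl
      rw [e1]
      have e2 : ‖((U n - u₀ : W01 Ω p) : SobolevPair Ω p).2‖ ≤ R + ‖u₀‖ :=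
        (norm_snd_le (U n - u₀ : W01 Ω p).1).trans
          ((norm_sub_le (U n) u₀).trans (by gcongr; exact hR n))
      gcongr
    have l1 := tendsto_integral_inner_zero hpq hsubp hFp hbd
      (tendsto_integral_norm_rpow_zero hpq.symm.lt hGF (fun n => (hFp n).1) hFle hF0)
    obtain ⟨ℓ, hℓ⟩ := W01.exists_dual_grad (p := p) ha₀p
    have l2 : Tendsto (fun n => ℓ (U n - u₀)) atTop (𝓝 0) := by
      simpa using (hweak ℓ).sub_const (ℓ u₀)
    have l3 := l1.add l2
    rw [add_zero] at l3
    refine l3.congr fun n => ?_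
    rw [hℓ, ← integral_add]
    · refine integral_congr_ae ?_
      filter_upwards [W01.grad_sub (U n) u₀] with x h1
      rw [h1, real_inner_comm, ← inner_add_left]
      simp only [F, sub_add_cancel]
    · simpa only [real_inner_comm] using integrable_inner (hFp n) (hsubp n)
    · exact integrable_inner ha₀p (W01.memLp_grad _)
  have hEi : ∀ n, Integrable (fun x => inner ℝ (a x ((U n).val x) ((U n).grad x) -
      a x ((U n).val x) (u₀.grad x)) ((U n).grad x - u₀.grad x)) (volOn Ω) := fun n =>
    integrable_inner ((hap n).sub (ha'p n)) (hsubp n)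
  have hE0 : ∀ n, ∀ᵐ x ∂(volOn Ω), 0 ≤ inner ℝ (a x ((U n).val x) ((U n).grad x) -
      a x ((U n).val x) (u₀.grad x)) ((U n).grad x - u₀.grad x) := fun n => by
    filter_upwards [D.a_monotone] with x h1
    by_cases he : (U n).grad x = u₀.grad x
    · simp [he]
    · exact (h1 _ _ _ he).le
  -- As c ≥ 1/2 and the gap is nonnegative, half the gap is at most c times it. The identity behind
  -- `Z` and the tested inequality bound the integral of the latter by the three error terms;
  -- doubling accounts for the factor 2.
  have hle : ∀ n, ∫ x in Ω, inner ℝ (a x ((U n).val x) ((U n).grad x) -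
      a x ((U n).val x) (u₀.grad x)) ((U n).grad x - u₀.grad x) ≤
      2 * ((∫ x in Ω, (β * A x + f x) * |φ n x|)
        + (∫ x in Ω, inner ℝ (a x ((U n).val x) ((U n).grad x)) (Z n x))
        - ∫ x in Ω, inner ℝ (c n x • a x ((U n).val x) (u₀.grad x))
            ((U n).grad x - u₀.grad x)) := by
    intro n
    obtain ⟨hI, hIle⟩ := D.integral_expTest_le_zero (hU n) (hK n) (hW n) (hB n) hl
    have i1 : Integrable (fun x => (β * A x + f x) * |φ n x|) (volOn Ω) := by
      refine (((hAi.const_mul β).add D.integrable_f).mul_const P).mono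
        (((hAi.const_mul β).add D.integrable_f).1.mul (hφm n).norm) ?_
      filter_upwards [hφle n] with x h1
      simp only [Pi.add_apply, norm_mul, Real.norm_eq_abs, abs_abs]
      rw [abs_of_nonneg hP0]
      gcongr
    have i2 := integrable_inner (hap n) (hZp n)
    have i3 := integrable_inner (hca'p n) (hsubp n)
    have hpt : ∀ᵐ x ∂(volOn Ω), 1 / 2 * inner ℝ (a x ((U n).val x) ((U n).grad x) -
        a x ((U n).val x) (u₀.grad x)) ((U n).grad x - u₀.grad x) ≤
        (expTestDeriv (κ ^ 2) ((U n).val x - (W n).val x) *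
          inner ℝ (a x ((U n).val x) ((U n).grad x)) ((U n).grad x - (W n).grad x)
        + a₀ x ((U n).val x) * expTest (κ ^ 2) ((U n).val x - (W n).val x)
        + H x ((U n).val x) ((U n).grad x) * expTest (κ ^ 2) ((U n).val x - (W n).val x))
        + (((β * A x + f x) * |φ n x|
        + inner ℝ (a x ((U n).val x) ((U n).grad x)) (Z n x))
        - inner ℝ (c n x • a x ((U n).val x) (u₀.grad x)) ((U n).grad x - u₀.grad x)) := by
      filter_upwards [hE0 n, hK n, D.a_coercive, D.abs_a₀_le_of_abs_le hp.out K, D.abs_H_le K]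
        with x h1 h2 h3 h4 h5
      change _ ≤ (φ' n x * _ + _ * φ n x + _ * φ n x) + _
      have h3' := h3 ((U n).val x) ((U n).grad x)
      have k2 : -(β * A x * |φ n x|) ≤ a₀ x ((U n).val x) * φ n x := by
        have e1 : |a₀ x ((U n).val x) * φ n x| ≤ β * A x * |φ n x| := by
          rw [abs_mul]
          exact mul_le_mul_of_nonneg_right (h4 _ h2) (abs_nonneg _)
        exact (abs_le.1 e1).1
      have k3 : -(f x * |φ n x|) -
          κ * |φ n x| * inner ℝ (a x ((U n).val x) ((U n).grad x)) ((U n).grad x) ≤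
          H x ((U n).val x) ((U n).grad x) * φ n x := by
        have e1 : |H x ((U n).val x) ((U n).grad x) * φ n x| ≤
            (f x + b K * ‖(U n).grad x‖ ^ p) * |φ n x| := by
          rw [abs_mul]
          exact mul_le_mul_of_nonneg_right (h5 _ _ h2) (abs_nonneg _)
        have e3 : b K * ‖(U n).grad x‖ ^ p ≤
            κ * inner ℝ (a x ((U n).val x) ((U n).grad x)) ((U n).grad x) := by
          calc b K * ‖(U n).grad x‖ ^ p = κ * (α * ‖(U n).grad x‖ ^ p) := by
                rw [hκ]; field_simp
            _ ≤ _ := by gcongr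
        have e4 := mul_le_mul_of_nonneg_right e3 (abs_nonneg (φ n x))
        have e5 := (abs_le.1 e1).1
        linarith
      have k4 := mul_le_mul_of_nonneg_right (hchalf n x) h1
      refine k4.trans ?_
      simp only [Z, inner_sub_left, inner_sub_right, inner_add_right, inner_smul_right,
        inner_smul_left, conj_trivial, c]
      linarith
    have hint := integral_mono_ae ((hEi n).const_mul (1 / 2)) (hI.add ((i1.add i2).sub i3)) hpt
    have e1 := integral_add hI ((i1.add i2).sub i3)
    have e2 := integral_sub (i1.add i2) i3
    have e3 := integral_add i1 i2
    simp only [Pi.add_apply, Pi.sub_apply] at hint e1 e2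
    rw [e1, e2, e3, integral_const_mul] at hint
    linarith
  have hlim := ((lim1.add lim2).sub lim3).const_mul 2
  simp only [add_zero, sub_zero, mul_zero] at hlim
  exact squeeze_zero (fun n => integral_nonneg_of_ae (hE0 n)) hle hlim

end VIData

/-! ### Strong convergence and passage to the limit -/

namespace VIData

variable {N : ℕ} {Ω : Set (EuclideanSpace ℝ (Fin N))} {p : ℝ} [hp : Fact (1 < p)] {α β α₀ : ℝ}
  {h : EuclideanSpace ℝ (Fin N) → ℝ}
  {a : EuclideanSpace ℝ (Fin N) → ℝ → EuclideanSpace ℝ (Fin N) → EuclideanSpace ℝ (Fin N)}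
  {a₀ : EuclideanSpace ℝ (Fin N) → ℝ → ℝ} {f : EuclideanSpace ℝ (Fin N) → ℝ} {b : ℝ → ℝ}
  {H : EuclideanSpace ℝ (Fin N) → ℝ → EuclideanSpace ℝ (Fin N) → ℝ}

/-- The monotonicity gap controls the gradient, up to a fixed integrable function. -/
theorem exists_coercive_bound (D : VIData Ω p α β α₀ h a a₀ f b H) {K : ℝ} (hK0 : 0 ≤ K)
    (v : W01 Ω p) : ∃ g : EuclideanSpace ℝ (Fin N) → ℝ, Integrable g (volOn Ω) ∧
      ∀ᵐ x ∂(volOn Ω), ∀ (s : ℝ) (ξ : EuclideanSpace ℝ (Fin N)), |s| ≤ K →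
        α / 2 * ‖ξ‖ ^ p ≤ inner ℝ (a x s ξ - a x s (v.grad x)) (ξ - v.grad x) + g x := by
  have hα := D.α_pos
  have hβ := D.β_pos
  have hp0 : 0 < p := zero_lt_one.trans hp.out
  -- Expanding the product gives α|ξ|^p, a nonnegative diagonal term that is dropped, and two cross
  -- terms. With η = α/(4β) each of these costs α/4 |ξ|^p, leaving α/2.
  obtain ⟨C₁, hC₁, hY₁⟩ := exists_rpow_sub_one_mul_le hp.out (η := α / (4 * β)) (by positivity)
  obtain ⟨C₂, hC₂, hY₂⟩ := exists_mul_le_rpow_add_rpow hp.out (η := α / (4 * β)) (by positivity)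
  let A : EuclideanSpace ℝ (Fin N) → ℝ := fun x => |h x| + K ^ (p - 1)
  have hA0 : ∀ x, 0 ≤ A x := fun x => by positivity
  have hA : MemLp A (ENNReal.ofReal (p / (p - 1))) (volOn Ω) := D.memLp_abs_h_add_const _
  have hA' : MemLp (fun x => A x + ‖v.grad x‖ ^ (p - 1)) (ENNReal.ofReal (p / (p - 1)))
      (volOn Ω) := hA.add (memLp_norm_rpow_sub_one (W01.memLp_grad v))
  have hA'0 : ∀ x, 0 ≤ A x + ‖v.grad x‖ ^ (p - 1) := fun x =>
    add_nonneg (hA0 x) (by positivity)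
  refine ⟨fun x => β * (A x * ‖v.grad x‖ + C₁ * ‖v.grad x‖ ^ p +
    C₂ * (A x + ‖v.grad x‖ ^ (p - 1)) ^ (p / (p - 1))), ?_, ?_⟩
  · exact (((integrable_mul hA (W01.memLp_grad v).norm).add
      ((W01.memLp_grad v).integrable_norm_rpow_ofReal.const_mul C₁)).add
      ((integrable_rpow_of_memLp hA'0 hA').const_mul C₂)).const_mul β
  · filter_upwards [D.a_coercive, D.norm_a_le_of_abs_le hp.out K] with x h1 h2 s ξ hs
    set η := v.grad x
    have e1 := h1 s ξ
    have e2 : 0 ≤ inner ℝ (a x s η) η := le_trans (by positivity) (h1 s η)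
    have e3 : inner ℝ (a x s ξ) η ≤ β * (A x + ‖ξ‖ ^ (p - 1)) * ‖η‖ :=
      (real_inner_le_norm _ _).trans
        (mul_le_mul_of_nonneg_right (h2 s ξ hs) (norm_nonneg _))
    have e4 : inner ℝ (a x s η) ξ ≤ β * (A x + ‖η‖ ^ (p - 1)) * ‖ξ‖ :=
      (real_inner_le_norm _ _).trans
        (mul_le_mul_of_nonneg_right (h2 s η hs) (norm_nonneg _))
    have e5 := mul_le_mul_of_nonneg_left (hY₁ ‖ξ‖ ‖η‖ (norm_nonneg _) (norm_nonneg _)) hβ.le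
    have e6 := mul_le_mul_of_nonneg_left (hY₂ (A x + ‖η‖ ^ (p - 1)) ‖ξ‖ (hA'0 x)
      (norm_nonneg _)) hβ.le
    have e7 : β * (α / (4 * β) * ‖ξ‖ ^ p) = α / 4 * ‖ξ‖ ^ p := by field_simp
    rw [inner_sub_left, inner_sub_right, inner_sub_right]
    rw [mul_add, e7] at e5 e6
    linarith

/-- If the monotonicity gap tends to zero, then a subsequence converges strongly. -/
theorem exists_subseq_tendsto_of_monotone (D : VIData Ω p α β α₀ h a a₀ f b H) {U : ℕ → W01 Ω p}
    {u₀ : W01 Ω p} {K : ℝ} (hK0 : 0 ≤ K) (hK : ∀ n, ∀ᵐ x ∂(volOn Ω), |(U n).val x| ≤ K)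
    (hae : ∀ᵐ x ∂(volOn Ω), Tendsto (fun n => (U n).val x) atTop (𝓝 (u₀.val x)))
    (hE : Tendsto (fun n => ∫ x in Ω, inner ℝ (a x ((U n).val x) ((U n).grad x) -
      a x ((U n).val x) (u₀.grad x)) ((U n).grad x - u₀.grad x)) atTop (𝓝 0)) :
    ∃ φ : ℕ → ℕ, StrictMono φ ∧ Tendsto (fun n => U (φ n)) atTop (𝓝 u₀) := by
  have := D.isFiniteMeasure
  have hα := D.α_pos
  have hp0 : 0 < p := zero_lt_one.trans hp.out
  let e : ℕ → EuclideanSpace ℝ (Fin N) → ℝ := fun n x =>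
    inner ℝ (a x ((U n).val x) ((U n).grad x) - a x ((U n).val x) (u₀.grad x))
      ((U n).grad x - u₀.grad x)
  have hei : ∀ n, Integrable (e n) (volOn Ω) := fun n =>
    integrable_inner
      ((D.memLp_a (W01.memLp_val _) (W01.memLp_grad _)).sub
        (D.memLp_a (W01.memLp_val _) (W01.memLp_grad _)))
      ((W01.memLp_grad _).sub (W01.memLp_grad _))
  have he0 : ∀ n, ∀ᵐ x ∂(volOn Ω), 0 ≤ e n x := fun n => by
    filter_upwards [D.a_monotone] with x h1
    by_cases he : (U n).grad x = u₀.grad x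
    · simp [e, he]
    · exact (h1 _ _ _ he).le
  -- Because the gap is nonnegative, convergence of its integral is L^1 convergence; this supplies
  -- pointwise convergence and an integrable majorant along a subsequence.
  have hL1 : Tendsto (fun n => (hei n).toL1 (e n)) atTop (𝓝 0) := by
    rw [tendsto_zero_iff_norm_tendsto_zero]
    refine hE.congr fun n => ?_
    rw [L1.norm_of_fun_eq_integral_norm]
    refine integral_congr_ae ?_
    filter_upwards [he0 n] with x hx
    rw [Real.norm_of_nonneg hx]
  obtain ⟨φ, G, hφ, hG, hGle, hlim⟩ := exists_subseq_dominated_of_tendsto_Lp hL1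
  have hcoe : ∀ᵐ x ∂(volOn Ω), ∀ n, (hei (φ n)).toL1 (e (φ n)) x = e (φ n) x :=
    ae_all_iff.2 fun n => (hei (φ n)).coeFn_toL1
  have hGi : Integrable G (volOn Ω) := memLp_one_iff_integrable.1 hG
  obtain ⟨g, hg, hbound⟩ := D.exists_coercive_bound hK0 u₀
  let M : EuclideanSpace ℝ (Fin N) → ℝ := fun x => 2 / α * (G x + g x)
  have hM : Integrable M (volOn Ω) := (hGi.add hg).const_mul _
  have hgradM : ∀ᵐ x ∂(volOn Ω), ∀ n, ‖(U (φ n)).grad x‖ ^ p ≤ M x := by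
    filter_upwards [hcoe, hGle, hbound, ae_all_iff.2 hK] with x h1 h2 h3 h4 n
    have e1 : e (φ n) x ≤ G x := by
      have := h2 n
      rw [h1 n] at this
      exact (Real.le_norm_self _).trans this
    have e2 := h3 _ ((U (φ n)).grad x) (h4 (φ n))
    have e3 : α / 2 * ‖(U (φ n)).grad x‖ ^ p ≤ G x + g x := e2.trans (by gcongr)
    calc _ = 2 / α * (α / 2 * ‖(U (φ n)).grad x‖ ^ p) := by field_simp
      _ ≤ _ := by simp only [M]; gcongr
  have hgradle : ∀ᵐ x ∂(volOn Ω), ∀ n, ‖(U (φ n)).grad x‖ ≤ |M x| ^ (1 / p) := by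
    filter_upwards [hgradM] with x h1 n
    calc ‖(U (φ n)).grad x‖ = (‖(U (φ n)).grad x‖ ^ p) ^ (1 / p) := by
          rw [← Real.rpow_mul (norm_nonneg _), mul_one_div_cancel hp0.ne', Real.rpow_one]
      _ ≤ _ := by
          gcongr
          exact (h1 n).trans (le_abs_self _)
  have hdom : MemLp (fun x => |M x| ^ (1 / p)) (ENNReal.ofReal p) (volOn Ω) := by
    have hm : AEStronglyMeasurable (fun x => |M x| ^ (1 / p)) (volOn Ω) :=
      (hM.1.norm.aemeasurable.pow_const _).aestronglyMeasurable
    rw [← integrable_norm_rpow_iff hm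
      (by simpa using hp0) ENNReal.ofReal_ne_top, ENNReal.toReal_ofReal hp0.le]
    refine hM.norm.congr (Eventually.of_forall fun x => ?_)
    simp only
    rw [Real.norm_of_nonneg (Real.rpow_nonneg (abs_nonneg _) _), ← Real.rpow_mul (abs_nonneg _),
      one_div_mul_cancel hp0.ne', Real.rpow_one, Real.norm_eq_abs]
  -- The majorant bounds the gradients at almost every point, so the finite-dimensional monotonicity
  -- argument applies there.
  have hgrad : ∀ᵐ x ∂(volOn Ω), Tendsto (fun n => (U (φ n)).grad x) atTop (𝓝 (u₀.grad x)) := by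
    filter_upwards [hae, hcoe, hlim, hgradle, D.a_car.continuous, D.a_monotone,
      Lp.coeFn_zero ℝ 1 (volOn Ω)] with x h1 h2 h3 h4 h5 h6 h7
    refine tendsto_of_tendsto_inner_monotone h5 h6 (h1.comp hφ.tendsto_atTop) h4 ?_
    simp only [h2] at h3
    rw [h7] at h3
    exact h3
  refine ⟨φ, hφ, W01.tendsto_of_dominated ((memLp_const K).add hdom) (fun n => ?_) (fun n => ?_)
    ?_ hgrad⟩
  · filter_upwards [hK (φ n)] with x h1
    exact h1.trans (le_add_of_nonneg_right (by positivity))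
  · filter_upwards [hgradle] with x h1
    exact (h1 n).trans (le_add_of_nonneg_left hK0)
  · filter_upwards [hae] with x h1 using h1.comp hφ.tendsto_atTop

/-- Strong limits of solutions are solutions, provided that the bounded admissible functions of
the limit problem can be approximated. -/
theorem isVISolution_of_tendsto (D : VIData Ω p α β α₀ h a a₀ f b H) {Ψ U : ℕ → W01 Ω p}
    {ψ₀ u₀ : W01 Ω p} (hU : ∀ n, IsVISolution a a₀ H (Ψ n) (U n)) {K : ℝ}
    (hK : ∀ n, ∀ᵐ x ∂(volOn Ω), |(U n).val x| ≤ K)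
    (hlim : Tendsto U atTop (𝓝 u₀)) (hu₀ : u₀ ∈ obstacleSet ψ₀)
    (hu₀K : ∀ᵐ x ∂(volOn Ω), |u₀.val x| ≤ K)
    (hrec : ∀ v ∈ obstacleSet ψ₀, MemLp v.val (∞ : ℝ≥0∞) (volOn Ω) →
      ∃ (φ : ℕ → ℕ) (W : ℕ → W01 Ω p) (B : ℝ), StrictMono φ ∧
        (∀ n, W n ∈ obstacleSet (Ψ (φ n))) ∧ (∀ n, ∀ᵐ x ∂(volOn Ω), |(W n).val x| ≤ B) ∧
        Tendsto W atTop (𝓝 v)) : IsVISolution a a₀ H ψ₀ u₀ := by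
  refine ⟨hu₀, memLp_top_of_bound (W01.memLp_val u₀).1 K hu₀K, fun v hv hvb => ?_⟩
  obtain ⟨φ, W, B, hφ, hW, hB, hWv⟩ := hrec v hv hvb
  obtain ⟨χ₁, G₁, hχ₁, hG₁, hle₁, hv₁, hg₁⟩ :=
    W01.exists_subseq_dominated (hlim.comp hφ.tendsto_atTop)
  obtain ⟨χ₂, G₂, hχ₂, hG₂, hle₂, hv₂, hg₂⟩ :=
    W01.exists_subseq_dominated (hWv.comp hχ₁.tendsto_atTop)
  let X : ℕ → W01 Ω p := fun n => U (φ (χ₁ (χ₂ n)))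
  let Y : ℕ → W01 Ω p := fun n => W (χ₁ (χ₂ n))
  have hXle : ∀ᵐ x ∂(volOn Ω), ∀ n, |(X n).val x| ≤ G₁ x ∧ ‖(X n).grad x‖ ≤ G₁ x := by
    filter_upwards [hle₁] with x h1 n using h1 (χ₂ n)
  have hYle : ∀ᵐ x ∂(volOn Ω), ∀ n, |(Y n).val x| ≤ G₂ x ∧ ‖(Y n).grad x‖ ≤ G₂ x := hle₂
  have hXv : ∀ᵐ x ∂(volOn Ω), Tendsto (fun n => (X n).val x) atTop (𝓝 (u₀.val x)) := by
    filter_upwards [hv₁] with x h1 using h1.comp hχ₂.tendsto_atTop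
  have hXg : ∀ᵐ x ∂(volOn Ω), Tendsto (fun n => (X n).grad x) atTop (𝓝 (u₀.grad x)) := by
    filter_upwards [hg₁] with x h1 using h1.comp hχ₂.tendsto_atTop
  have hXK : ∀ᵐ x ∂(volOn Ω), ∀ n, |(X n).val x| ≤ K := ae_all_iff.2 fun n => hK _
  have hYB : ∀ᵐ x ∂(volOn Ω), ∀ n, |(Y n).val x| ≤ B := ae_all_iff.2 fun n => hB _
  have hβ := D.β_pos
  have hp1 : 0 ≤ p - 1 := (sub_pos.2 hp.out).le
  have hbnd := D.memLp_growth hG₁ hG₁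
  have hbi := integrable_mul hbnd (hG₂.add hG₁)
  have hbp : ∀ x, 0 ≤ β * (|h x| + ‖G₁ x‖ ^ (p - 1) + ‖G₁ x‖ ^ (p - 1)) := fun x => by positivity
  have l1 : Tendsto (fun n => lerayLionsPairing a (X n) (Y n - X n)) atTop
      (𝓝 (lerayLionsPairing a u₀ (v - u₀))) := by
    refine tendsto_integral_of_dominated_convergence _ (fun n => ?_) hbi (fun n => ?_) ?_
    · exact (integrable_inner (D.memLp_a (W01.memLp_val _) (W01.memLp_grad _))
        (W01.memLp_grad _)).1
    · filter_upwards [hXle, hYle, D.norm_a_le, W01.grad_sub (Y n) (X n)] with x h1 h2 h3 h4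
      rw [h4]
      refine (norm_inner_le_norm _ _).trans (mul_le_mul ?_ ?_ (norm_nonneg _) (hbp x))
      · refine (h3 _ _).trans ?_
        have e1 := (h1 n).1.trans (Real.le_norm_self _)
        have e2 := (h1 n).2.trans (Real.le_norm_self _)
        rw [Real.norm_eq_abs ((X n).val x)]
        gcongr
      · exact (norm_sub_le _ _).trans (add_le_add (h2 n).2 (h1 n).2)
    · filter_upwards [hXv, hXg, hg₂, D.a_car.continuous, W01.grad_sub v u₀,
        ae_all_iff.2 fun n => W01.grad_sub (Y n) (X n)] with x h1 h2 h3 h4 h5 h6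
      simp only [h5, h6]
      have e1 : Tendsto (fun n => a x ((X n).val x) ((X n).grad x)) atTop
          (𝓝 (a x (u₀.val x) (u₀.grad x))) :=
        (h4.tendsto (u₀.val x, u₀.grad x)).comp (h1.prodMk_nhds h2)
      exact e1.inner (h3.sub h2)
  have l2 : Tendsto (fun n => ∫ x in Ω, a₀ x ((X n).val x) * ((Y n).val x - (X n).val x)) atTop
      (𝓝 (∫ x in Ω, a₀ x (u₀.val x) * (v.val x - u₀.val x))) := by
    refine tendsto_integral_of_dominated_convergence _ (fun n => ?_) hbi (fun n => ?_) ?_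
    · exact (integrable_mul (D.memLp_a₀ (W01.memLp_val _))
        ((W01.memLp_val _).sub (W01.memLp_val _))).1
    · filter_upwards [hXle, hYle, D.a₀_growth] with x h1 h2 h3
      rw [norm_mul]
      refine mul_le_mul ?_ ?_ (norm_nonneg _) (hbp x)
      · refine (h3 _).trans ?_
        have e1 : |(X n).val x| ^ (p - 1) ≤ ‖G₁ x‖ ^ (p - 1) := by
          have := (h1 n).1.trans (Real.le_norm_self _)
          gcongr
        have e2 : 0 ≤ ‖G₁ x‖ ^ (p - 1) := by positivity
        gcongr
        linarith [le_abs_self (h x)]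
      · exact (norm_sub_le _ _).trans (add_le_add (h2 n).1 (h1 n).1)
    · filter_upwards [hXv, hv₂, D.a₀_car.continuous] with x h1 h2 h3
      exact ((h3.tendsto _).comp h1).mul (h2.sub h1)
  have l3 : Tendsto (fun n => ∫ x in Ω, H x ((X n).val x) ((X n).grad x) *
      ((Y n).val x - (X n).val x)) atTop
      (𝓝 (∫ x in Ω, H x (u₀.val x) (u₀.grad x) * (v.val x - u₀.val x))) := by
    -- Strong convergence is essential at this point: it dominates |DU|^p by an integrable function.
    -- The sup bounds on U and on the competitors control the other factor.
    have hGi : Integrable (fun x => (f x + b K * ‖G₁ x‖ ^ p) * (B + K)) (volOn Ω) :=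
      (D.integrable_f.add (hG₁.integrable_norm_rpow_ofReal.const_mul _)).mul_const _
    refine tendsto_integral_of_dominated_convergence _ (fun n => ?_) hGi (fun n => ?_) ?_
    · exact (D.aestronglyMeasurable_H (W01.memLp_val _).1 (W01.memLp_grad _).1).mul
        ((W01.memLp_val _).1.sub (W01.memLp_val _).1)
    · filter_upwards [hXle, hXK, hYB, D.abs_H_le K, D.f_nonneg] with x h1 h2 h3 h4 h5
      have hb : 0 ≤ b K := D.b_nonneg K ((abs_nonneg _).trans (h2 n))
      have hp0 : 0 ≤ p := by linarith
      rw [norm_mul]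
      refine mul_le_mul ?_ ((norm_sub_le _ _).trans (add_le_add (h3 n) (h2 n))) (norm_nonneg _)
        (by positivity)
      refine (h4 _ _ (h2 n)).trans ?_
      have e1 := (h1 n).2.trans (Real.le_norm_self _)
      gcongr
    · filter_upwards [hXv, hXg, hv₂, D.H_car.continuous] with x h1 h2 h3 h4
      have e1 : Tendsto (fun n => H x ((X n).val x) ((X n).grad x)) atTop
          (𝓝 (H x (u₀.val x) (u₀.grad x))) :=
        (h4.tendsto (u₀.val x, u₀.grad x)).comp (h1.prodMk_nhds h2)
      exact e1.mul (h3.sub h1)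
  refine ge_of_tendsto' ((l1.add l2).add l3) fun n => ?_
  exact (hU _).inequality _ (hW _) (memLp_top_of_bound (W01.memLp_val _).1 B (hB _))

end VIData

/-! ### Bounded recovery sequences and the stability theorem -/

/-- Bounded recovery sequences: along a subsequence, bounded admissible functions of the limit
problem are strong limits of uniformly bounded admissible functions. -/
theorem MoscoConverges.exists_bounded_recovery {N : ℕ} {Ω : Set (EuclideanSpace ℝ (Fin N))} {p : ℝ}
    [hp : Fact (1 < p)] (hΩ : IsOpen Ω) {ψ : ℕ → W01 Ω p} {ψ₀ v : W01 Ω p}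
    (hMosco : MoscoConverges (fun n => obstacleSet (ψ n)) (obstacleSet ψ₀)) {M : ℝ}
    (hψ : ∀ n, ∀ᵐ x ∂(volOn Ω), |(ψ n).val x| ≤ M) (hv : v ∈ obstacleSet ψ₀)
    (hvb : MemLp v.val (∞ : ℝ≥0∞) (volOn Ω)) {σ : ℕ → ℕ} (hσ : StrictMono σ) :
    ∃ (φ : ℕ → ℕ) (W : ℕ → W01 Ω p) (B : ℝ), StrictMono φ ∧
      (∀ n, W n ∈ obstacleSet (ψ (σ (φ n)))) ∧ (∀ n, ∀ᵐ x ∂(volOn Ω), |(W n).val x| ≤ B) ∧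
      Tendsto W atTop (𝓝 v) := by
  obtain ⟨C, hC0, hC⟩ := hvb.exists_ae_bound
  -- The height exceeds the bounds of the obstacles and of v, so T fixes the values of both.
  -- Monotonicity then gives T(w) ≥ T(ψ) = ψ, and T(v) = v.
  obtain ⟨T, hT, hTid, hTm, hT', B, hTB⟩ := exists_smooth_truncation
    (K := max M C + 1) (by linarith [le_max_right M C])
  have hT0 : T 0 = 0 := hTid 0 (by rw [abs_zero]; linarith [le_max_right M C])
  obtain ⟨w, hw, hwlim⟩ := hMosco.recovery v hv
  have hwσ : Tendsto (fun n => w (σ n)) atTop (𝓝 v) :=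
    (tendsto_iff_norm_sub_tendsto_zero.2 hwlim).comp hσ.tendsto_atTop
  choose W hWv hWg using fun n => W01.exists_comp hT hT0 hT' (w (σ n))
  obtain ⟨v', hv'v, hv'g⟩ := W01.exists_comp hT hT0 hT' v
  obtain ⟨φ, hφ, hφlim⟩ := W01.exists_subseq_tendsto_comp hT hT0 hT' hwσ hWv hWg hv'v hv'g
  -- T(v) and v agree as functions; uniqueness of weak gradients, where the openness of Ω enters,
  -- makes them equal as Sobolev elements.
  have hv' : v' = v := by
    refine W01.ext_val hΩ _ _ ?_
    filter_upwards [hv'v, hC] with x h1 h2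
    rw [h1, hTid _ (by linarith [le_max_right M C])]
  rw [hv'] at hφlim
  refine ⟨φ, fun n => W (φ n), B, hφ, fun n => ?_, fun n => ?_, hφlim⟩
  · have hwn : ∀ᵐ x ∂(volOn Ω), (ψ (σ (φ n))).val x ≤ (w (σ (φ n))).val x := hw (σ (φ n))
    change ∀ᵐ x ∂(volOn Ω), (ψ (σ (φ n))).val x ≤ (W (φ n)).val x
    filter_upwards [hwn, hψ (σ (φ n)), hWv (φ n)] with x h1 h2 h3
    rw [h3, ← hTid ((ψ (σ (φ n))).val x) (by linarith [le_max_left M C])]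
    exact hTm h1
  · filter_upwards [hWv (φ n)] with x h1
    rw [h1]
    exact hTB _

theorem mainTheorem1 {N : ℕ} (hN : 1 ≤ N)
    {Ω : Set (EuclideanSpace ℝ (Fin N))} (hΩ : IsOpen Ω) (hΩb : Bornology.IsBounded Ω)
    {p : ℝ} [Fact (1 < p)]
    {α β α₀ : ℝ} (hα : 0 < α) (hβ : 0 < β) (hα₀ : 0 < α₀)
    {h : EuclideanSpace ℝ (Fin N) → ℝ} (hh : MemLp h (ENNReal.ofReal (p / (p - 1))) (volOn Ω))
    -- the principal part
    {a : EuclideanSpace ℝ (Fin N) → ℝ → EuclideanSpace ℝ (Fin N) → EuclideanSpace ℝ (Fin N)}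
    (ha : IsCaratheodory Ω (fun x (q : ℝ × EuclideanSpace ℝ (Fin N)) => a x q.1 q.2))
    (ha_coercive : ∀ᵐ x ∂(volOn Ω), ∀ (s : ℝ) (ξ : EuclideanSpace ℝ (Fin N)),
      α * ‖ξ‖ ^ p ≤ inner ℝ (a x s ξ) ξ)
    (ha_growth : ∀ᵐ x ∂(volOn Ω), ∀ (s : ℝ) (ξ : EuclideanSpace ℝ (Fin N)),
      ‖a x s ξ‖ ≤ β * (h x + |s| ^ (p - 1) + ‖ξ‖ ^ (p - 1)))
    (ha_monotone : ∀ᵐ x ∂(volOn Ω), ∀ (s : ℝ) (ξ η : EuclideanSpace ℝ (Fin N)), ξ ≠ η →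
      0 < inner ℝ (a x s ξ - a x s η) (ξ - η))
    -- the zero-order term
    {a₀ : EuclideanSpace ℝ (Fin N) → ℝ → ℝ} (ha₀ : IsCaratheodory Ω a₀)
    (ha₀_growth : ∀ᵐ x ∂(volOn Ω), ∀ s : ℝ, |a₀ x s| ≤ β * (h x + |s| ^ (p - 1)))
    (ha₀_coercive : ∀ᵐ x ∂(volOn Ω), ∀ s : ℝ, α₀ * |s| ^ p ≤ a₀ x s * s)
    -- the term with natural growth
    {f : EuclideanSpace ℝ (Fin N) → ℝ} (hf : MemLp f ∞ (volOn Ω))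
    (hf_nonneg : ∀ᵐ x ∂(volOn Ω), 0 ≤ f x)
    {b : ℝ → ℝ} (hb_nonneg : ∀ t, 0 ≤ t → 0 ≤ b t) (hb_mono : MonotoneOn b (Set.Ici 0))
    (hb_cont : ContinuousOn b (Set.Ici 0))
    {H : EuclideanSpace ℝ (Fin N) → ℝ → EuclideanSpace ℝ (Fin N) → ℝ}
    (hH : IsCaratheodory Ω (fun x (q : ℝ × EuclideanSpace ℝ (Fin N)) => H x q.1 q.2))
    (hH_growth : ∀ᵐ x ∂(volOn Ω), ∀ (s : ℝ) (ξ : EuclideanSpace ℝ (Fin N)),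
      |H x s ξ| ≤ f x + b |s| * ‖ξ‖ ^ p)
    -- the obstacles
    {ψ : ℕ → W01 Ω p} {ψ₀ : W01 Ω p}
    (hψ : ∃ M : ℝ, ∀ n, ∀ᵐ x ∂(volOn Ω), |(ψ n).val x| ≤ M)
    (hψ₀ : MemLp ψ₀.val ∞ (volOn Ω))
    (hMosco : MoscoConverges (fun n => obstacleSet (ψ n)) (obstacleSet ψ₀))
    -- the solutions
    {u : ℕ → W01 Ω p} (hu : ∀ n, IsVISolution a a₀ H (ψ n) (u n)) :
    ∃ (n : ℕ → ℕ) (u₀ : W01 Ω p), StrictMono n ∧ u₀ ∈ obstacleSet ψ₀ ∧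
      Tendsto (fun j => u (n j)) atTop (𝓝 u₀) ∧ IsVISolution a a₀ H ψ₀ u₀ := by
  obtain ⟨M, hM⟩ := hψ
  have D : VIData Ω p α β α₀ h a a₀ f b H :=
    { volume_ne_top := hΩb.measure_lt_top.ne
      α_pos := hα
      β_pos := hβ
      α₀_pos := hα₀
      h_memLp := hh
      a_car := ha
      a_coercive := ha_coercive
      a_growth := ha_growth
      a_monotone := ha_monotone
      a₀_car := ha₀
      a₀_growth := ha₀_growth
      a₀_coercive := ha₀_coercive
      f_memLp := hf
      f_nonneg := hf_nonneg
      b_nonneg := hb_nonneg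
      b_mono := hb_mono
      H_car := hH
      H_growth := hH_growth }
  obtain ⟨K, hK0, -, hK'⟩ := D.exists_uniform_bound M
  have hK : ∀ n, ∀ᵐ x ∂(volOn Ω), |(u n).val x| ≤ K := fun n => hK' _ _ (hu n) (hM n)
  -- ψ₀ is a bounded element of its own constraint set available before any limit is known; its
  -- recovery sequence supplies the comparison functions for the energy bound.
  have hψ₀mem : ψ₀ ∈ obstacleSet ψ₀ := by
    change ∀ᵐ x ∂(volOn Ω), ψ₀.val x ≤ ψ₀.val x
    exact Eventually.of_forall fun x => le_rfl
  -- a bound in the Sobolev space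
  obtain ⟨φ₀, W₀, B₀, hφ₀, hW₀, hB₀, hlim₀⟩ :=
    hMosco.exists_bounded_recovery hΩ hM hψ₀mem hψ₀ strictMono_id
  obtain ⟨S, hS⟩ := (Metric.isBounded_range_of_tendsto W₀ hlim₀).exists_norm_le
  obtain ⟨R, hR⟩ := D.exists_norm_bound hK0.le (abs_nonneg B₀) S
  have hUR : ∀ n, ‖u (φ₀ n)‖ ≤ R := fun n =>
    hR _ _ (W₀ n) (hu _) (hK _) (hW₀ n)
      (by filter_upwards [hB₀ n] with x hx using hx.trans (le_abs_self _)) (hS _ ⟨n, rfl⟩)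
  -- weak and almost everywhere convergence
  obtain ⟨φ₁, u₀, hφ₁, hweak₁⟩ := W01.exists_subseq_tendsto_weak hUR
  obtain ⟨φ₂, hφ₂, hae₂⟩ := W01.exists_subseq_tendsto_ae_of_weak D.volume_ne_top
    (fun n => hUR (φ₁ n)) hweak₁
  have hσ : StrictMono fun n => φ₀ (φ₁ (φ₂ n)) := hφ₀.comp (hφ₁.comp hφ₂)
  -- The first Mosco condition is needed before strong convergence, because the next recovery
  -- sequence must approximate u₀ itself.
  have hu₀ : u₀ ∈ obstacleSet ψ₀ :=
    hMosco.weak_limit (fun n => φ₀ (φ₁ n)) (fun n => u (φ₀ (φ₁ n))) u₀ (hφ₀.comp hφ₁)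
      (fun n => (hu _).mem_obstacleSet) (tendsto_toWeakSpace_iff.2 hweak₁)
  have hu₀K : ∀ᵐ x ∂(volOn Ω), |u₀.val x| ≤ K := by
    filter_upwards [hae₂, ae_all_iff.2 hK] with x h1 h2
    exact le_of_tendsto h1.abs (Eventually.of_forall fun n => h2 _)
  have hu₀b : MemLp u₀.val (∞ : ℝ≥0∞) (volOn Ω) :=
    memLp_top_of_bound (W01.memLp_val u₀).1 K hu₀K
  -- strong convergence
  obtain ⟨φ₃, W₃, B₃, hφ₃, hW₃, hB₃, hlim₃⟩ :=
    hMosco.exists_bounded_recovery hΩ hM hu₀ hu₀b hσ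
  obtain ⟨φ₄, G, hφ₄, hG, hGle, hWv, hWg⟩ := W01.exists_subseq_dominated hlim₃
  let τ : ℕ → ℕ := fun n => φ₀ (φ₁ (φ₂ (φ₃ (φ₄ n))))
  have hτ : StrictMono τ := hσ.comp (hφ₃.comp hφ₄)
  have h34 : Tendsto (fun n => φ₃ (φ₄ n)) atTop atTop := (hφ₃.comp hφ₄).tendsto_atTop
  have haeτ : ∀ᵐ x ∂(volOn Ω), Tendsto (fun n => (u (τ n)).val x) atTop (𝓝 (u₀.val x)) := by
    filter_upwards [hae₂] with x h1 using h1.comp h34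
  -- The comparison functions now recover the weak limit, so that U - W → 0 almost everywhere.
  have hE := D.tendsto_integral_monotone (Ψ := fun n => ψ (τ n)) (U := fun n => u (τ n))
    (W := fun n => W₃ (φ₄ n)) (fun n => hu _) hK0.le (abs_nonneg B₃) (fun n => hK _)
    (fun n => hW₃ _)
    (fun n => by filter_upwards [hB₃ (φ₄ n)] with x hx using hx.trans (le_abs_self _))
    (fun n => hUR _) (fun ℓ => (hweak₁ ℓ).comp (hφ₂.tendsto_atTop.comp h34)) haeτ hG
    (fun n => by filter_upwards [hGle] with x hx using (hx n).2) hWv hWg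
  obtain ⟨φ₅, hφ₅, hstrong⟩ :=
    D.exists_subseq_tendsto_of_monotone hK0.le (fun n => hK (τ n)) haeτ hE
  refine ⟨fun n => τ (φ₅ n), u₀, hτ.comp hφ₅, hu₀, hstrong, ?_⟩
  exact D.isVISolution_of_tendsto (Ψ := fun n => ψ (τ (φ₅ n))) (fun n => hu _) (fun n => hK _)
    hstrong hu₀ hu₀K fun v hv hvb => hMosco.exists_bounded_recovery hΩ hM hv hvb (hτ.comp hφ₅)
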